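/- **Assemblies of power operations.** Let $\mathcal M_n$, $n\ge 0$, be exact categories (in the sense of Quillen). For $k\ge 1$ let $F_k(\mathcal M_n)$ be the category of sequences $V_1\rightarrowtail\cdots\rightarrowtail V_k$ of admissible monomorphisms in $\mathcal M_n$. An *assembly of power operations* on $(\mathcal M_n)_{n\ge0}$ consists of bi-exact functors $\otimes\colon\mathcal M_n\times\mathcal M_p\to\mathcal M_{n+p}$ with natural associativity isomorphisms satisfying the pentagon identity; functors $F_k(\mathcal M_n)\to\mathcal M_{nk}$, $(V_1\rightarrowtail\cdots\rightarrowtail V_k)\mapsto V_1\wedge\cdots\wedge V_k$ for $k\ge1$, $n\ge 0$, which for $k=1$ are naturally identified with the identity; and natural maps $$(E1)\quad (V\wedge\cdots\wedge W)\otimes (X\wedge\cdots\wedge Y)\to V\wedge\cdots\wedge W\wedge X\wedge\cdots\wedge Y,$$ $$(E2)\quad V\wedge\cdots\wedge W\wedge X\wedge\cdots\wedge Y\to (V\wedge\cdots\wedge W)\otimes \left(\tfrac XW\wedge\cdots\wedge\tfrac YW\right)$$ for every sequence $V\rightarrowtail\cdots\rightarrowtail W\rightarrowtail X\rightarrowtail\cdots\rightarrowtail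 Y$ and, in (E2), every choice of the quotient objects, where the maps (E1) and the maps (E2) are each associative with respect to sequences cut into three non-empty parts. These data satisfy the following. For $U\rightarrowtail\cdots\rightarrowtail V\rightarrowtail W\rightarrowtail\cdots\rightarrowtail X\rightarrowtail Y\rightarrowtail\cdots\rightarrowtail Z$, up to the associativity isomorphisms: (E3) the composite $(U\wedge\cdots\wedge X)\otimes(Y\wedge\cdots\wedge Z)\to U\wedge\cdots\wedge Z\to (U\wedge\cdots\wedge V)\otimes(\frac WV\wedge\cdots\wedge\frac ZV)$ of (E1) and (E2) equals the composite via $(U\wedge\cdots\wedge V)\otimes(\frac WV\wedge\cdots\wedge\frac XV)\otimes(\frac YV\wedge\cdots\wedge\frac ZV)$ of (E2) tensored with the map induced by the quotient maps, followed by (E1); (E4) the composite $(U\wedge\cdots\wedge V)\otimes(W\wedge\cdots\wedge Z)\to U\wedge\cdots\wedge Z\to(U\wedge\cdots\wedge X)\otimes(\frac YX\wedge\cdots\wedge\frac ZX)$ of (E1) and (E2) equals the composite via $(U\wedge\cdots\wedge V)\otimes(W\wedge\cdots\wedge X)\otimes(\frac YX\wedge\cdots\wedge\frac ZX)$ of (E2)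 and (E1). (E5) For $U\rightarrowtail\cdots\rightarrowtail V\rightarrowtail W'\rightarrowtail W\rightarrowtail X\rightarrowtail\cdots\rightarrowtail Y$ (where the parts $U,\dots,V$ and $X,\dots,Y$ may be empty) the sequence $$0\to U\wedge\cdots\wedge V\wedge W'\wedge X\wedge\cdots\wedge Y\to U\wedge\cdots\wedge V\wedge W\wedge X\wedge\cdots\wedge Y\to (U\wedge\cdots\wedge V)\otimes\left(\tfrac W{W'}\wedge\tfrac X{W'}\wedge\cdots\wedge\tfrac Y{W'}\right)\to0$$ is exact, where the second map is (E2) followed by the map induced by $\frac{\,\cdot\,}{V}\to\frac{\,\cdot\,}{W'}$ (if $U,\dots,V$ is empty, the tensor factor is omitted and the second map is induced by the quotient maps). **Complexes.** For an exact category $\mathcal M$ let $C^\infty\mathcal M$ be the category of chain complexes in $\mathcal M$ supported in non-negative degrees, and $C\mathcal M$ its full subcategory of bounded complexes, both with the degreewise short exact sequences. If $\mathcal M$ is idempotent complete, let $N$ and $\Gamma$ be the mutually inverse equivalences (normalized chain complex functor and its inverse) of the Dold–Kan correspondence between simplicial objects in $\mathcal M$ and $C^\infty\mathcal M$. **Proposition.**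 Let an assembly of power operations on idempotent complete exact categories $\mathcal M_n$, $n\ge 0$, be given. For $V_\cdot\in C^\infty\mathcal M_n$ and $W_\cdot\in C^\infty\mathcal M_p$ put $V_\cdot\otimes_\Delta W_\cdot:=N(\Gamma V_\cdot\otimes\Gamma W_\cdot)$, the tensor product of simplicial objects being taken levelwise (i.e. it is the diagonal of the bisimplicial tensor product), and for $V_{1\cdot}\rightarrowtail\cdots\rightarrowtail V_{k\cdot}$ in $F_k(C^\infty\mathcal M_n)$ put $V_{1\cdot}\wedge\cdots\wedge V_{k\cdot}:=N(\Gamma V_{1\cdot}\wedge\cdots\wedge\Gamma V_{k\cdot})$, where the given power operation is applied levelwise. Then: 1. $C^\infty\mathcal M_n$, $n\ge0$, are exact categories and, together with these functors and with the structure maps (associativity, identification for $k=1$, (E1), (E2)) induced levelwise through $N$ and $\Gamma$ by the given ones, they form an assembly of power operations. 2. $C\mathcal M_n$, $n\ge0$, are exact categories, the functors $\otimes_\Delta$ and the power operations on $C^\infty\mathcal M_n$ send (sequences of) bounded complexes to bounded complexes, and the assembly in 1. restricts to an assembly of power operations on $C\mathcal M_n$, $n\ge 0$. -/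

import Mathlib

open CategoryTheory CategoryTheory.Limits

universe v u v' u' w

noncomputable section

namespace PowerOps

/-! ### Exact categories -/

/-- A distinguished class of short sequences (the candidate admissible short exact sequences,
or conflations) in a preadditive category. -/
class Conflations (C : Type u) [Category.{v} C] [Preadditive C] where
  /-- the distinguished sequences -/
  conflation : ShortComplex C → Prop

section Exact

variable {C : Type u} [Category.{v} C] [Preadditive C] [Conflations C]

/-- `X ⟶ Y ⟶ Z` is a conflation: the composite vanishes and the short sequence is distinguished. -/
def IsConflation {X Y Z : C} (f : X ⟶ Y) (g : Y ⟶ Z) : Prop :=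
  ∃ w : f ≫ g = 0, Conflations.conflation (ShortComplex.mk f g w)

/-- Admissible monomorphisms. -/
def IsInflation {X Y : C} (f : X ⟶ Y) : Prop := ∃ (Z : C) (g : Y ⟶ Z), IsConflation f g

/-- Admissible epimorphisms. -/
def IsDeflation {Y Z : C} (g : Y ⟶ Z) : Prop := ∃ (X : C) (f : X ⟶ Y), IsConflation f g

end Exact

/-- Quillen's axioms: an additive category with a class of kernel-cokernel pairs, closed
under isomorphism, such that identities are admissible monomorphisms and epimorphisms, these two
classes are closed under composition, admissible monomorphisms have pushouts along arbitrary
morphisms which are again admissible monomorphisms, and dually. -/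
class IsExactCategory (C : Type u) [Category.{v} C] [Preadditive C] [Conflations C] : Prop
    extends HasFiniteBiproducts C where
  of_iso : ∀ {S T : ShortComplex C}, Nonempty (S ≅ T) →
    Conflations.conflation S → Conflations.conflation T
  isKernel : ∀ {S : ShortComplex C}, Conflations.conflation S →
    Nonempty (IsLimit (KernelFork.ofι S.f S.zero))
  isCokernel : ∀ {S : ShortComplex C}, Conflations.conflation S →
    Nonempty (IsColimit (CokernelCofork.ofπ S.g S.zero))
  id_inflation : ∀ X : C, IsInflation (𝟙 X)
  id_deflation : ∀ X : C, IsDeflation (𝟙 X)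
  comp_inflation : ∀ {X Y Z : C} (f : X ⟶ Y) (g : Y ⟶ Z),
    IsInflation f → IsInflation g → IsInflation (f ≫ g)
  comp_deflation : ∀ {X Y Z : C} (f : X ⟶ Y) (g : Y ⟶ Z),
    IsDeflation f → IsDeflation g → IsDeflation (f ≫ g)
  pushout_inflation : ∀ {X Y X' : C} (i : X ⟶ Y) (f : X ⟶ X'), IsInflation i →
    ∃ (Y' : C) (f' : Y ⟶ Y') (i' : X' ⟶ Y'), IsPushout i f f' i' ∧ IsInflation i'
  pullback_deflation : ∀ {Y Z Z' : C} (p : Y ⟶ Z) (f : Z' ⟶ Z), IsDeflation p →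
    ∃ (Y' : C) (f' : Y' ⟶ Y) (p' : Y' ⟶ Z'), IsPullback f' p' p f ∧ IsDeflation p'

/-- A functor sends conflations to conflations. -/
def PreservesConflations {C : Type u} [Category.{v} C] [Preadditive C] [Conflations C]
    {D : Type u'} [Category.{v'} D] [Preadditive D] [Conflations D] (F : C ⥤ D) : Prop :=
  ∀ {X Y Z : C} (f : X ⟶ Y) (g : Y ⟶ Z), IsConflation f g → IsConflation (F.map f) (F.map g)

/-- Exact functors between exact categories. -/
structure IsExactFunctor {C : Type u} [Category.{v} C] [Preadditive C] [Conflations C]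
    {D : Type u'} [Category.{v'} D] [Preadditive D] [Conflations D] (F : C ⥤ D) : Prop where
  additive : F.Additive
  preserves : PreservesConflations F

section Instances

variable {C : Type u} [Category.{v} C] [Preadditive C] [Conflations C]

/-- Functor categories (in particular simplicial objects): levelwise conflations. -/
instance functorConflations (J : Type u') [Category.{v'} J] : Conflations (J ⥤ C) where
  conflation S := ∀ j, Conflations.conflation (S.map ((evaluation J C).obj j))

/-- Complexes: degreewise conflations. -/
instance complexConflations {ι : Type w} (c : ComplexShape ι) :
    Conflations (HomologicalComplex C c) where
  conflation S := ∀ i, Conflations.conflation (S.map (HomologicalComplex.eval C c i))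

/-- Full subcategories: those conflations of the ambient category whose terms all lie in the
subcategory. -/
instance fullConflations (P : ObjectProperty C) : Conflations P.FullSubcategory where
  conflation S := Conflations.conflation (S.map P.ι)

end Instances

/-! ### Sequences of admissible monomorphisms -/

section Seq

variable (k : ℕ) (C : Type u) [Category.{v} C] [Preadditive C] [Conflations C]

/-- `F_k(C)`: sequences `V_1 ↣ ⋯ ↣ V_k` of admissible monomorphisms; the morphisms are the
natural transformations. The terms are indexed by `0, …, k - 1`. -/
abbrev AdmSeq : Type _ :=
  ObjectProperty.FullSubcategory (C := Fin k ⥤ C)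
    (fun V => ∀ (i j : Fin k) (h : i ≤ j), IsInflation (V.map (homOfLE h)))

end Seq

namespace AdmSeq

/-- The first `a` of `k` indices. -/
def headMap {a k : ℕ} (h : a ≤ k) : Fin a →o Fin k :=
  ⟨fun i => ⟨i.1, by omega⟩, fun _ _ h => h⟩

/-- The last `b` of `k = a + b` indices. -/
def tailMap {a b k : ℕ} (h : a + b = k) : Fin b →o Fin k :=
  ⟨fun i => ⟨a + i.1, by omega⟩, fun _ _ h => Nat.add_le_add_left h a⟩

/-- All indices except `p`. -/
def skipMap {k : ℕ} (p : ℕ) (hp : p < k + 1) : Fin k →o Fin (k + 1) :=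
  (Fin.succAboveOrderEmb ⟨p, hp⟩).toOrderHom

variable {C : Type u} [Category.{v} C] [Preadditive C] [Conflations C] {a b k l : ℕ}

/-- Reindexing of sequences along a monotone map. -/
def restrict (φ : Fin a →o Fin k) : AdmSeq k C ⥤ AdmSeq a C where
  obj V :=
    { obj :=
        { obj := fun i => V.obj.obj (φ i)
          map := fun f => V.obj.map (homOfLE (φ.monotone (leOfHom f)))
          map_id := fun i => V.obj.map_id (φ i)
          map_comp := fun _ _ => by rw [← V.obj.map_comp]; rfl }
      property := fun i j h => V.property (φ i) (φ j) (φ.monotone h) }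
  map f := ObjectProperty.homMk
    { app := fun i => f.hom.app (φ i)
      naturality := fun _ _ _ => f.hom.naturality _ }
  map_id _ := rfl
  map_comp _ _ := rfl

/-- The initial part of length `a` of a sequence. -/
abbrev head (h : a ≤ k) : AdmSeq k C ⥤ AdmSeq a C := restrict (headMap h)

/-- The final part of length `b` of a sequence of length `a + b`. -/
abbrev tail (h : a + b = k) : AdmSeq k C ⥤ AdmSeq b C := restrict (tailMap h)

/-- The morphism of sequences whose components are given morphisms `V_{φ i} ⟶ V_{ψ i}` of the
sequence `V`, where `φ ≤ ψ`. For `φ = ψ` it is the identity. -/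
def shift {φ ψ : Fin a →o Fin k} (h : ∀ i, φ i ≤ ψ i) (V : AdmSeq k C) :
    (restrict φ).obj V ⟶ (restrict ψ).obj V :=
  ObjectProperty.homMk
    { app := fun i => V.obj.map (homOfLE (h i))
      naturality := fun _ _ _ => by
        dsimp only [restrict]
        rw [← V.obj.map_comp, ← V.obj.map_comp]
        rfl }

/-- For `V` of length `a + b + c`, the (identical) last `c` terms of `V` and of the last `b + c`
terms of `V`. -/
def tailTail {a b c d e k : ℕ} (had : a + b = d) (hbc : b + c = e) (hd : d + c = k)
    (he : a + e = k) (V : AdmSeq k C) :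
    (tail hd).obj V ⟶ (tail hbc).obj ((tail he).obj V) :=
  shift (φ := tailMap hd) (ψ := (tailMap he).comp (tailMap hbc))
    (fun i => by
      change d + i.1 ≤ a + (b + i.1)
      omega) V

end AdmSeq

open AdmSeq

theorem skip_le {k a : ℕ} {ha : a + 1 < k + 1} {ha' : a < k + 1} (i : Fin k) :
    skipMap (a + 1) ha i ≤ skipMap a ha' i := by
  change (Fin.succAbove ⟨a + 1, ha⟩ i).1 ≤ (Fin.succAbove ⟨a, ha'⟩ i).1
  simp only [Fin.succAbove, Fin.lt_def, Fin.val_castSucc]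
  split_ifs <;> simp
  all_goals omega

theorem skip_tail_le {a b k : ℕ} (hk : a + b = k) {ha : a < k + 1} {h : a + 1 + b = k + 1}
    (i : Fin b) : ((skipMap a ha).comp (tailMap hk)) i ≤ tailMap h i := by
  change (Fin.succAbove ⟨a, ha⟩ (⟨a + i.1, by omega⟩ : Fin k)).1 ≤ a + 1 + i.1
  simp only [Fin.succAbove, Fin.lt_def, Fin.val_castSucc]
  split_ifs <;> simp

theorem skip_zero_le {k : ℕ} {h₀ : 0 < k + 1} {h : 1 + k = k + 1} (i : Fin k) :
    skipMap 0 h₀ i ≤ tailMap h i := by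
  change (Fin.succAbove ⟨0, h₀⟩ i).1 ≤ 1 + i.1
  simp [Fin.succAbove, add_comm]

section Quotients

variable {C : Type u} [Category.{v} C] [Preadditive C] [Conflations C] {a b k : ℕ}

/-- A choice of quotients `V_{a+1}/V_a ↣ ⋯ ↣ V_{a+b}/V_a` for a sequence
`V_1 ↣ ⋯ ↣ V_{a+b}` (with `a ≥ 1`). -/
structure QuotientSeq (h : a + b = k) (V : AdmSeq k C) where
  /-- the sequence of quotients -/
  seq : AdmSeq b C
  /-- the quotient maps -/
  π : (tail h).obj V ⟶ seq
  /-- `V_a ↣ V_{a+j} ↠ V_{a+j}/V_a` is a conflation; `i` is the index of `V_a`. -/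
  conf : ∀ (i : Fin k) (_ : i.1 + 1 = a) (j : Fin b) (hij : i ≤ tailMap h j),
    IsConflation (V.obj.map (homOfLE hij)) (π.hom.app j)

/-- For `V` of length `a + b + c` the quotients by `V_a` of the first `a + b` terms. -/
def QuotientSeq.initial {a b c d e k : ℕ} (had : a + b = d) (hbc : b + c = e) (hd : d + c = k)
    (he : a + e = k) {V : AdmSeq k C} (Q : QuotientSeq he V) :
    QuotientSeq had ((head (show d ≤ k by omega)).obj V) where
  seq := (head (show b ≤ e by omega)).obj Q.seq
  π := (head (show b ≤ e by omega)).map Q.π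
  conf i hi j hij := Q.conf (headMap (by omega) i) hi (headMap (by omega) j) hij

/-- For `V` of length `a + b + c`, quotients of `V_{a+b+1}, …` by `V_{a+b}` are also quotients for
the sequence of the last `b + c` terms of `V`. -/
def QuotientSeq.ofTail {a b c d e k : ℕ} (_hb : 1 ≤ b) (had : a + b = d)
    (hbc : b + c = e) (hd : d + c = k) (he : a + e = k) {V : AdmSeq k C} (Q : QuotientSeq hd V) :
    QuotientSeq hbc ((tail he).obj V) where
  seq := Q.seq
  π := shift (φ := (tailMap he).comp (tailMap hbc)) (ψ := tailMap hd)
    (fun i => by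
      change a + (b + i.1) ≤ d + i.1
      omega) V ≫ Q.π
  conf i hi j hij := by
    have key : ∀ (x x' : Fin k) (hx : x = x') (y y' : Fin k) (hy : y = y') (h : x ≤ y)
        (h' : x' ≤ y') (h'' : y ≤ y') (Z : C) (p : V.obj.obj y' ⟶ Z),
        IsConflation (V.obj.map (homOfLE h')) p →
        IsConflation (V.obj.map (homOfLE h)) (V.obj.map (homOfLE h'') ≫ p) := by
      rintro x _ rfl y _ rfl h h' h'' Z p hp
      have e : V.obj.map (homOfLE h'') = 𝟙 _ := V.obj.map_id y
      rw [e, Category.id_comp]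
      exact hp
    have hi' : (tailMap he i).1 + 1 = d := by
      change a + i.1 + 1 = d
      omega
    refine key (tailMap he i) ⟨d - 1, by omega⟩ (Fin.ext ?_) (tailMap he (tailMap hbc j))
      (tailMap hd j) (Fin.ext ?_) _ ?_ _ _ _
      (Q.conf ⟨d - 1, by omega⟩ (by dsimp only; omega) j ?_)
    · dsimp only; omega
    · change a + (b + j.1) = d + j.1
      omega
    all_goals
      change d - 1 ≤ d + j.1
      omega

end Quotients

/-! ### Assemblies of power operations -/

/-- The functors underlying an assembly of power operations: tensor products
`M_n × M_p ⥤ M_{n+p}` and power operations `F_k(M_n) ⥤ M_{nk}` for `k ≥ 1`. The index of the target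
is a separate variable subject to an equation, so that no transport along equalities is needed. -/
structure PowerFunctors (M : ℕ → Type u) [∀ n, Category.{v} (M n)] [∀ n, Preadditive (M n)]
    [∀ n, Conflations (M n)] where
  /-- the tensor products -/
  tensor : ∀ {n p m : ℕ}, n + p = m → (M n ⥤ M p ⥤ M m)
  /-- the power operations -/
  wedge : ∀ {k n m : ℕ}, 1 ≤ k → n * k = m → (AdmSeq k (M n) ⥤ M m)

namespace PowerFunctors

variable {M : ℕ → Type u} [∀ n, Category.{v} (M n)] [∀ n, Preadditive (M n)]
  [∀ n, Conflations (M n)] (D : PowerFunctors M)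

/-- `X ⊗ Y` -/
abbrev tObj {n p m : ℕ} (h : n + p = m) (X : M n) (Y : M p) : M m := ((D.tensor h).obj X).obj Y

/-- `f ⊗ g` -/
def tMap {n p m : ℕ} (h : n + p = m) {X X' : M n} {Y Y' : M p} (f : X ⟶ X') (g : Y ⟶ Y') :
    D.tObj h X Y ⟶ D.tObj h X' Y' :=
  ((D.tensor h).map f).app Y ≫ ((D.tensor h).obj X').map g

end PowerFunctors

theorem PowerFunctors.tMap_id {M : ℕ → Type u} [∀ n, Category.{v} (M n)] [∀ n, Preadditive (M n)]
    [∀ n, Conflations (M n)] (D : PowerFunctors M) {n p m : ℕ} (h : n + p = m) (X : M n)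
    (Y : M p) : D.tMap h (𝟙 X) (𝟙 Y) = 𝟙 (D.tObj h X Y) := by
  dsimp only [tMap]
  simp

theorem PowerFunctors.tMap_comp {M : ℕ → Type u} [∀ n, Category.{v} (M n)]
    [∀ n, Preadditive (M n)] [∀ n, Conflations (M n)] (D : PowerFunctors M) {n p m : ℕ}
    (h : n + p = m) {X X' X'' : M n} {Y Y' Y'' : M p} (f : X ⟶ X') (f' : X' ⟶ X'') (g : Y ⟶ Y')
    (g' : Y' ⟶ Y'') : D.tMap h (f ≫ f') (g ≫ g') = D.tMap h f g ≫ D.tMap h f' g' := by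
  dsimp only [tMap]
  simp

theorem add_index {n a b k na nb nk : ℕ} (hk : a + b = k) (hna : n * a = na) (hnb : n * b = nb)
    (hnk : n * k = nk) : na + nb = nk := by
  subst hk hna hnb hnk; ring

theorem one_le_total {a b k : ℕ} (hk : a + b = k) (ha : 1 ≤ a) : 1 ≤ k := by omega

/-- The full data of an assembly of power operations: besides the functors, the associativity
isomorphisms of the tensor products, the identification of the power operation for `k = 1` with the
identity, and the maps (E1) and (E2). -/
structure PowerData (M : ℕ → Type u) [∀ n, Category.{v} (M n)] [∀ n, Preadditive (M n)]
    [∀ n, Conflations (M n)] extends PowerFunctors M where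
  /-- `(X ⊗ Y) ⊗ Z ≅ X ⊗ (Y ⊗ Z)` -/
  assoc : ∀ {n p q np pq m : ℕ} (h₁ : n + p = np) (h₂ : np + q = m) (h₃ : p + q = pq)
    (h₄ : n + pq = m) (X : M n) (Y : M p) (Z : M q),
    toPowerFunctors.tObj h₂ (toPowerFunctors.tObj h₁ X Y) Z ≅
      toPowerFunctors.tObj h₄ X (toPowerFunctors.tObj h₃ Y Z)
  /-- for `k = 1` the power operation is the identity -/
  wedgeOne : ∀ {n : ℕ} (hn : n * 1 = n) (V : AdmSeq 1 (M n)), (wedge le_rfl hn).obj V ≅ V.obj.obj 0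
  /-- (E1): `V ∧ ⋯ ∧ W ⊗ X ∧ ⋯ ∧ Y ⟶ V ∧ ⋯ ∧ W ∧ X ∧ ⋯ ∧ Y` -/
  mul : ∀ {n a b k na nb nk : ℕ} (ha : 1 ≤ a) (hb : 1 ≤ b) (hk : a + b = k) (hna : n * a = na)
    (hnb : n * b = nb) (hnk : n * k = nk) (V : AdmSeq k (M n)),
    toPowerFunctors.tObj (add_index hk hna hnb hnk)
        ((wedge ha hna).obj ((head (hk ▸ Nat.le_add_right a b)).obj V))
        ((wedge hb hnb).obj ((tail hk).obj V)) ⟶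
      (wedge (one_le_total hk ha) hnk).obj V
  /-- (E2): `V ∧ ⋯ ∧ W ∧ X ∧ ⋯ ∧ Y ⟶ V ∧ ⋯ ∧ W ⊗ X/W ∧ ⋯ ∧ Y/W`, for any choice of quotients -/
  comul : ∀ {n a b k na nb nk : ℕ} (ha : 1 ≤ a) (hb : 1 ≤ b) (hk : a + b = k) (hna : n * a = na)
    (hnb : n * b = nb) (hnk : n * k = nk) (V : AdmSeq k (M n)) (Q : QuotientSeq hk V),
    (wedge (one_le_total hk ha) hnk).obj V ⟶
      toPowerFunctors.tObj (add_index hk hna hnb hnk)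
        ((wedge ha hna).obj ((head (hk ▸ Nat.le_add_right a b)).obj V))
        ((wedge hb hnb).obj Q.seq)

/-- The axioms of an assembly of power operations. -/
structure PowerData.IsAssembly {M : ℕ → Type u} [∀ n, Category.{v} (M n)] [∀ n, Preadditive (M n)]
    [∀ n, Conflations (M n)] (D : PowerData M) : Prop where
  /-- the tensor products are bi-exact -/
  tensor_left : ∀ {n p m : ℕ} (h : n + p = m) (X : M n), IsExactFunctor ((D.tensor h).obj X)
  tensor_right : ∀ {n p m : ℕ} (h : n + p = m) (Y : M p), IsExactFunctor ((D.tensor h).flip.obj Y)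
  /-- the associativity isomorphisms are natural and satisfy the pentagon identity -/
  assoc_natural : ∀ {n p q np pq m : ℕ} (h₁ : n + p = np) (h₂ : np + q = m) (h₃ : p + q = pq)
    (h₄ : n + pq = m) {X X' : M n} {Y Y' : M p} {Z Z' : M q} (f : X ⟶ X') (g : Y ⟶ Y')
    (h : Z ⟶ Z'),
    D.tMap h₂ (D.tMap h₁ f g) h ≫ (D.assoc h₁ h₂ h₃ h₄ X' Y' Z').hom =
      (D.assoc h₁ h₂ h₃ h₄ X Y Z).hom ≫ D.tMap h₄ f (D.tMap h₃ g h)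
  pentagon : ∀ {n p q r np pq qr npq pqr m : ℕ} (hnp : n + p = np) (hpq : p + q = pq)
    (hqr : q + r = qr) (h₁ : np + q = npq) (h₂ : n + pq = npq) (h₃ : p + qr = pqr)
    (h₄ : pq + r = pqr) (h₅ : npq + r = m) (h₆ : n + pqr = m) (h₇ : np + qr = m)
    (W : M n) (X : M p) (Y : M q) (Z : M r),
    D.tMap h₅ (D.assoc hnp h₁ hpq h₂ W X Y).hom (𝟙 Z) ≫
        (D.assoc h₂ h₅ h₄ h₆ W (D.tObj hpq X Y) Z).hom ≫
        D.tMap h₆ (𝟙 W) (D.assoc hpq h₄ hqr h₃ X Y Z).hom =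
      (D.assoc h₁ h₅ hqr h₇ (D.tObj hnp W X) Y Z).hom ≫
        (D.assoc hnp h₇ h₃ h₆ W X (D.tObj hqr Y Z)).hom
  /-- the identification for `k = 1` is natural -/
  wedgeOne_natural : ∀ {n : ℕ} (hn : n * 1 = n) {V V' : AdmSeq 1 (M n)} (f : V ⟶ V'),
    (D.wedge le_rfl hn).map f ≫ (D.wedgeOne hn V').hom = (D.wedgeOne hn V).hom ≫ f.hom.app 0
  /-- (E1): naturality -/
  mul_natural : ∀ {n a b k na nb nk : ℕ} (ha : 1 ≤ a) (hb : 1 ≤ b) (hk : a + b = k)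
    (hna : n * a = na) (hnb : n * b = nb) (hnk : n * k = nk) {V V' : AdmSeq k (M n)} (f : V ⟶ V'),
    D.tMap (add_index hk hna hnb hnk)
        ((D.wedge ha hna).map ((head (hk ▸ Nat.le_add_right a b)).map f))
        ((D.wedge hb hnb).map ((tail hk).map f)) ≫
      D.mul ha hb hk hna hnb hnk V' =
    D.mul ha hb hk hna hnb hnk V ≫ (D.wedge (one_le_total hk ha) hnk).map f
  /-- (E1): associativity -/
  mul_assoc : ∀ {n a b c d e k na nb nc nd ne nk : ℕ} (ha : 1 ≤ a) (hb : 1 ≤ b) (hc : 1 ≤ c)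
    (had : a + b = d) (hbc : b + c = e) (hd : d + c = k) (he : a + e = k)
    (hna : n * a = na) (hnb : n * b = nb) (hnc : n * c = nc) (hnd : n * d = nd) (hne : n * e = ne)
    (hnk : n * k = nk) (V : AdmSeq k (M n)),
    D.tMap (add_index hd hnd hnc hnk)
        (D.mul ha hb had hna hnb hnd ((head (show d ≤ k by omega)).obj V))
        (𝟙 ((D.wedge hc hnc).obj ((tail hd).obj V))) ≫
      D.mul (one_le_total had ha) hc hd hnd hnc hnk V =
    (D.assoc (add_index had hna hnb hnd) (add_index hd hnd hnc hnk) (add_index hbc hnb hnc hne)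
        (add_index he hna hne hnk) _ _ _).hom ≫
      D.tMap (add_index he hna hne hnk) (𝟙 ((D.wedge ha hna).obj ((head (show a ≤ k by omega)).obj V)))
        (D.tMap (add_index hbc hnb hnc hne)
            (𝟙 ((D.wedge hb hnb).obj
              ((head (show b ≤ e by omega)).obj ((tail he).obj V))))
            ((D.wedge hc hnc).map (tailTail had hbc hd he V)) ≫
          D.mul hb hc hbc hnb hnc hne ((tail he).obj V)) ≫
      D.mul ha (one_le_total hbc hb) he hna hne hnk V
  /-- (E2): naturality -/
  comul_natural : ∀ {n a b k na nb nk : ℕ} (ha : 1 ≤ a) (hb : 1 ≤ b) (hk : a + b = k)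
    (hna : n * a = na) (hnb : n * b = nb) (hnk : n * k = nk) {V V' : AdmSeq k (M n)} (f : V ⟶ V')
    (Q : QuotientSeq hk V) (Q' : QuotientSeq hk V') (g : Q.seq ⟶ Q'.seq),
    Q.π ≫ g = (tail hk).map f ≫ Q'.π →
    D.comul ha hb hk hna hnb hnk V Q ≫
      D.tMap (add_index hk hna hnb hnk)
        ((D.wedge ha hna).map ((head (hk ▸ Nat.le_add_right a b)).map f))
        ((D.wedge hb hnb).map g) =
    (D.wedge (one_le_total hk ha) hnk).map f ≫ D.comul ha hb hk hna hnb hnk V' Q'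
  /-- (E2): associativity. For `U ↣ ⋯ ↣ V ↣ W ↣ ⋯ ↣ X ↣ Y ↣ ⋯ ↣ Z`, where `Q₁` are quotients by `V`,
  `Q₂` are quotients by `X`, `Q₁₂` are quotients of `Q₁` by `X/V`, and `g` is the identification of
  `Q₁₂` with `Q₂`. -/
  comul_assoc : ∀ {n a b c d e k na nb nc nd ne nk : ℕ} (ha : 1 ≤ a) (hb : 1 ≤ b) (hc : 1 ≤ c)
    (had : a + b = d) (hbc : b + c = e) (hd : d + c = k) (he : a + e = k)
    (hna : n * a = na) (hnb : n * b = nb) (hnc : n * c = nc) (hnd : n * d = nd) (hne : n * e = ne)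
    (hnk : n * k = nk) (V : AdmSeq k (M n)) (Q₁ : QuotientSeq he V) (Q₂ : QuotientSeq hd V)
    (Q₁₂ : QuotientSeq hbc Q₁.seq) (g : Q₁₂.seq ⟶ Q₂.seq),
    tailTail had hbc hd he V ≫ (tail hbc).map Q₁.π ≫ Q₁₂.π ≫ g = Q₂.π →
    D.comul (one_le_total had ha) hc hd hnd hnc hnk V Q₂ ≫
      D.tMap (add_index hd hnd hnc hnk)
        (D.comul ha hb had hna hnb hnd ((head (show d ≤ k by omega)).obj V)
          (Q₁.initial had hbc hd he))
        (𝟙 ((D.wedge hc hnc).obj Q₂.seq)) ≫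
      (D.assoc (add_index had hna hnb hnd) (add_index hd hnd hnc hnk) (add_index hbc hnb hnc hne)
        (add_index he hna hne hnk) _ _ _).hom =
    D.comul ha (one_le_total hbc hb) he hna hne hnk V Q₁ ≫
      D.tMap (add_index he hna hne hnk) (𝟙 ((D.wedge ha hna).obj ((head (show a ≤ k by omega)).obj V)))
        (D.comul hb hc hbc hnb hnc hne Q₁.seq Q₁₂ ≫
          D.tMap (add_index hbc hnb hnc hne)
            (𝟙 ((D.wedge hb hnb).obj ((head (show b ≤ e by omega)).obj Q₁.seq)))
            ((D.wedge hc hnc).map g))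
  /-- (E3) -/
  mul_comul_left : ∀ {n a b c d e k na nb nc nd ne nk : ℕ} (ha : 1 ≤ a) (hb : 1 ≤ b) (hc : 1 ≤ c)
    (had : a + b = d) (hbc : b + c = e) (hd : d + c = k) (he : a + e = k)
    (hna : n * a = na) (hnb : n * b = nb) (hnc : n * c = nc) (hnd : n * d = nd) (hne : n * e = ne)
    (hnk : n * k = nk) (V : AdmSeq k (M n)) (Q : QuotientSeq he V),
    D.mul (one_le_total had ha) hc hd hnd hnc hnk V ≫
      D.comul ha (one_le_total hbc hb) he hna hne hnk V Q =
    D.tMap (add_index hd hnd hnc hnk)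
        (D.comul ha hb had hna hnb hnd ((head (show d ≤ k by omega)).obj V)
          (Q.initial had hbc hd he))
        ((D.wedge hc hnc).map (tailTail had hbc hd he V ≫ (tail hbc).map Q.π)) ≫
      (D.assoc (add_index had hna hnb hnd) (add_index hd hnd hnc hnk) (add_index hbc hnb hnc hne)
        (add_index he hna hne hnk) _ _ _).hom ≫
      D.tMap (add_index he hna hne hnk) (𝟙 ((D.wedge ha hna).obj ((head (show a ≤ k by omega)).obj V)))
        (D.mul hb hc hbc hnb hnc hne Q.seq)
  /-- (E4) -/
  mul_comul_right : ∀ {n a b c d e k na nb nc nd ne nk : ℕ} (ha : 1 ≤ a) (hb : 1 ≤ b) (hc : 1 ≤ c)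
    (had : a + b = d) (hbc : b + c = e) (hd : d + c = k) (he : a + e = k)
    (hna : n * a = na) (hnb : n * b = nb) (hnc : n * c = nc) (hnd : n * d = nd) (hne : n * e = ne)
    (hnk : n * k = nk) (V : AdmSeq k (M n)) (Q : QuotientSeq hd V),
    D.mul ha (one_le_total hbc hb) he hna hne hnk V ≫
      D.comul (one_le_total had ha) hc hd hnd hnc hnk V Q =
    D.tMap (add_index he hna hne hnk) (𝟙 ((D.wedge ha hna).obj ((head (show a ≤ k by omega)).obj V)))
        (D.comul hb hc hbc hnb hnc hne ((tail he).obj V) (Q.ofTail hb had hbc hd he)) ≫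
      (D.assoc (add_index had hna hnb hnd) (add_index hd hnd hnc hnk) (add_index hbc hnb hnc hne)
        (add_index he hna hne hnk) _ _ _).inv ≫
      D.tMap (add_index hd hnd hnc hnk)
        (D.mul ha hb had hna hnb hnd ((head (show d ≤ k by omega)).obj V))
        (𝟙 ((D.wedge hc hnc).obj Q.seq))
  /-- (E5) when the part `U ↣ ⋯ ↣ V` is empty: for `W' ↣ W ↣ X ↣ ⋯ ↣ Y` (`R`, of length `k + 1`) with
  quotients `Q` by `W'`, the sequence
  `W' ∧ X ∧ ⋯ ∧ Y ⟶ W ∧ X ∧ ⋯ ∧ Y ⟶ W/W' ∧ X/W' ∧ ⋯ ∧ Y/W'` is a conflation. -/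
  exact_zero : ∀ {n k nk : ℕ} (hk : 1 ≤ k) (hnk : n * k = nk) (R : AdmSeq (k + 1) (M n))
    (Q : QuotientSeq (add_comm 1 k) R),
    IsConflation
      ((D.wedge hk hnk).map
        (shift (φ := skipMap 1 (by omega)) (ψ := skipMap 0 (by omega)) skip_le R))
      ((D.wedge hk hnk).map (shift (φ := skipMap 0 (by omega)) skip_zero_le R ≫ Q.π))
  /-- (E5) when the part `U ↣ ⋯ ↣ V` has length `a ≥ 1`: for
  `U ↣ ⋯ ↣ V ↣ W' ↣ W ↣ X ↣ ⋯ ↣ Y` (`R`, of length `a + b + 1`), with quotients `Q` by `W'`, quotients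
  `Q'` of `W, X, …, Y` by `V`, and the induced `g : Q' ⟶ Q`, the sequence
  `U ∧ ⋯ ∧ V ∧ W' ∧ X ∧ ⋯ ∧ Y ⟶ U ∧ ⋯ ∧ V ∧ W ∧ X ∧ ⋯ ∧ Y ⟶ U ∧ ⋯ ∧ V ⊗ W/W' ∧ X/W' ∧ ⋯ ∧ Y/W'`
  is a conflation. -/
  exact_succ : ∀ {n a b k na nb nk : ℕ} (ha : 1 ≤ a) (hb : 1 ≤ b) (hk : a + b = k)
    (hna : n * a = na) (hnb : n * b = nb) (hnk : n * k = nk) (R : AdmSeq (k + 1) (M n))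
    (Q : QuotientSeq (show a + 1 + b = k + 1 by omega) R)
    (Q' : QuotientSeq hk ((restrict (skipMap a (by omega))).obj R)) (g : Q'.seq ⟶ Q.seq),
    Q'.π ≫ g = shift (φ := (skipMap a (by omega)).comp (tailMap hk)) (skip_tail_le hk) R ≫ Q.π →
    IsConflation
      ((D.wedge (one_le_total hk ha) hnk).map
        (shift (φ := skipMap (a + 1) (by omega)) (ψ := skipMap a (by omega)) skip_le R))
      (D.comul ha hb hk hna hnb hnk ((restrict (skipMap a (by omega))).obj R) Q' ≫
        D.tMap (add_index hk hna hnb hnk) (𝟙 _) ((D.wedge hb hnb).map g))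
/-! ### Levelwise operations on diagrams -/

section Functoriality

variable {C : Type u} [Category.{v} C] [Preadditive C] [Conflations C]
  {C' : Type u'} [Category.{v'} C'] [Preadditive C'] [Conflations C']

/-- A functor preserving conflations acts on sequences of admissible monomorphisms. -/
def mapSeq (k : ℕ) (F : C ⥤ C') (hF : PreservesConflations F) : AdmSeq k C ⥤ AdmSeq k C' where
  obj V := ⟨V.obj ⋙ F, fun i j h => by
    obtain ⟨Z, g, hg⟩ := V.property i j h
    exact ⟨F.obj Z, F.map g, hF _ _ hg⟩⟩
  map f := ObjectProperty.homMk (Functor.whiskerRight f.hom F)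

/-- A functor preserving conflations sends a choice of quotients to a choice of quotients. -/
def QuotientSeq.map {a b k : ℕ} {h : a + b = k} {V : AdmSeq k C} (Q : QuotientSeq h V)
    (F : C ⥤ C') (hF : PreservesConflations F) : QuotientSeq h ((mapSeq k F hF).obj V) where
  seq := (mapSeq b F hF).obj Q.seq
  π := (mapSeq b F hF).map Q.π
  conf i hi j hij := hF _ _ (Q.conf i hi j hij)

/-- A natural transformation acts on sequences of admissible monomorphisms. -/
def mapSeqHom {k : ℕ} {F G : C ⥤ C'} (hF : PreservesConflations F) (hG : PreservesConflations G)
    (t : F ⟶ G) (V : AdmSeq k C) : (mapSeq k F hF).obj V ⟶ (mapSeq k G hG).obj V :=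
  ObjectProperty.homMk (Functor.whiskerLeft V.obj t)

theorem evaluation_preserves (J : Type w) [SmallCategory J] (j : J) :
    PreservesConflations ((evaluation J C).obj j) :=
  fun _ _ ⟨w, h⟩ => ⟨congr_app w j, h j⟩

end Functoriality

section Levelwise

variable {M : ℕ → Type u} [∀ n, Category.{v} (M n)] [∀ n, Preadditive (M n)]
  [∀ n, Conflations (M n)] (J : Type) [SmallCategory J]

/-- The value at `j` of a sequence of diagrams. -/
abbrev evalSeq {C : Type u} [Category.{v} C] [Preadditive C] [Conflations C] {k : ℕ} (j : J)
    (V : AdmSeq k (J ⥤ C)) : AdmSeq k C :=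
  (mapSeq k ((evaluation J C).obj j) (evaluation_preserves J j)).obj V

/-- The transition maps between the values of a sequence of diagrams. -/
abbrev evalSeqMap {C : Type u} [Category.{v} C] [Preadditive C] [Conflations C] {k : ℕ} {i j : J}
    (f : i ⟶ j) (V : AdmSeq k (J ⥤ C)) : evalSeq J i V ⟶ evalSeq J j V :=
  mapSeqHom (evaluation_preserves J i) (evaluation_preserves J j) ((evaluation J C).map f) V

/-- The levelwise tensor product of two `J`-diagrams. For simplicial objects, this is the diagonal of
the bisimplicial object given by the tensor products of all levels. -/
def levelwiseTensorObj (D : PowerFunctors M) {n p m : ℕ} (h : n + p = m) (X : J ⥤ M n)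
    (Y : J ⥤ M p) : J ⥤ M m where
  obj j := D.tObj h (X.obj j) (Y.obj j)
  map f := D.tMap h (X.map f) (Y.map f)
  map_id j := by rw [X.map_id, Y.map_id, D.tMap_id]
  map_comp f g := by rw [X.map_comp, Y.map_comp, D.tMap_comp]

/-- The levelwise tensor product of morphisms of `J`-diagrams. -/
def levelwiseTensorMap (D : PowerFunctors M) {n p m : ℕ} (h : n + p = m) {X X' : J ⥤ M n}
    {Y Y' : J ⥤ M p} (f : X ⟶ X') (g : Y ⟶ Y') :
    levelwiseTensorObj J D h X Y ⟶ levelwiseTensorObj J D h X' Y' where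
  app j := D.tMap h (f.app j) (g.app j)
  naturality i j φ := by
    change D.tMap h (X.map φ) (Y.map φ) ≫ D.tMap h (f.app j) (g.app j) =
      D.tMap h (f.app i) (g.app i) ≫ D.tMap h (X'.map φ) (Y'.map φ)
    rw [← D.tMap_comp, ← D.tMap_comp, f.naturality, g.naturality]

/-- The levelwise power operation on a sequence of `J`-diagrams, regarded as a `J`-diagram of
sequences. -/
def levelwiseWedgeObj (D : PowerFunctors M) {k n m : ℕ} (hk : 1 ≤ k) (h : n * k = m)
    (V : AdmSeq k (J ⥤ M n)) : J ⥤ M m where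
  obj j := (D.wedge hk h).obj (evalSeq J j V)
  map f := (D.wedge hk h).map (evalSeqMap J f V)
  map_id j := by
    have e : evalSeqMap J (𝟙 j) V = 𝟙 (evalSeq J j V) := by
      apply ObjectProperty.hom_ext
      apply NatTrans.ext
      funext i
      exact (V.obj.obj i).map_id j
    rw [e, CategoryTheory.Functor.map_id]
  map_comp f g := by
    have e : evalSeqMap J (f ≫ g) V = evalSeqMap J f V ≫ evalSeqMap J g V := by
      apply ObjectProperty.hom_ext
      apply NatTrans.ext
      funext i
      exact (V.obj.obj i).map_comp f g
    rw [e, Functor.map_comp]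

/-- The levelwise power operation on morphisms. -/
def levelwiseWedgeMap (D : PowerFunctors M) {k n m : ℕ} (hk : 1 ≤ k) (h : n * k = m)
    {V V' : AdmSeq k (J ⥤ M n)} (φ : V ⟶ V') :
    levelwiseWedgeObj J D hk h V ⟶ levelwiseWedgeObj J D hk h V' where
  app j := (D.wedge hk h).map
    ((mapSeq k ((evaluation J _).obj j) (evaluation_preserves J j)).map φ)
  naturality i j f := by
    change (D.wedge hk h).map (evalSeqMap J f V) ≫ (D.wedge hk h).map _ =
      (D.wedge hk h).map _ ≫ (D.wedge hk h).map (evalSeqMap J f V')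
    rw [← Functor.map_comp, ← Functor.map_comp]
    refine congr_arg (D.wedge hk h).map ?_
    apply ObjectProperty.hom_ext
    apply NatTrans.ext
    funext i
    exact (φ.hom.app i).naturality f

/-- Levelwise tensor products and power operations on `J`-diagrams. -/
def levelwiseFunctors (D : PowerFunctors M) : PowerFunctors (fun n => J ⥤ M n) where
  tensor h :=
    { obj := fun X =>
        { obj := fun Y => levelwiseTensorObj J D h X Y
          map := fun g => levelwiseTensorMap J D h (𝟙 X) g
          map_id := fun Y => by
            apply NatTrans.ext
            funext j
            exact D.tMap_id h _ _
          map_comp := fun f g => by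
            apply NatTrans.ext
            funext j
            change D.tMap h (𝟙 _) (f.app j ≫ g.app j) =
              D.tMap h (𝟙 _) (f.app j) ≫ D.tMap h (𝟙 _) (g.app j)
            rw [← D.tMap_comp, Category.comp_id] }
      map := fun f =>
        { app := fun Y => levelwiseTensorMap J D h f (𝟙 Y)
          naturality := fun _ _ g => by
            apply NatTrans.ext
            funext j
            change D.tMap h (𝟙 _) (g.app j) ≫ D.tMap h (f.app j) (𝟙 _) =
              D.tMap h (f.app j) (𝟙 _) ≫ D.tMap h (𝟙 _) (g.app j)
            rw [← D.tMap_comp, ← D.tMap_comp]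
            simp only [Category.comp_id, Category.id_comp] }
      map_id := fun X => by
        apply NatTrans.ext
        funext Y
        apply NatTrans.ext
        funext j
        exact D.tMap_id h _ _
      map_comp := fun f g => by
        apply NatTrans.ext
        funext Y
        apply NatTrans.ext
        funext j
        change D.tMap h (f.app j ≫ g.app j) (𝟙 _) =
          D.tMap h (f.app j) (𝟙 _) ≫ D.tMap h (g.app j) (𝟙 _)
        rw [← D.tMap_comp, Category.comp_id] }
  wedge hk h :=
    { obj := fun V => levelwiseWedgeObj J D hk h V
      map := fun φ => levelwiseWedgeMap J D hk h φ
      map_id := fun V => by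
        apply NatTrans.ext
        funext j
        exact (D.wedge hk h).map_id _
      map_comp := fun f g => by
        apply NatTrans.ext
        funext j
        change (D.wedge hk h).map _ = (D.wedge hk h).map _ ≫ (D.wedge hk h).map _
        rw [← Functor.map_comp]
        rfl }

/-- The levelwise assembly data on `J`-diagrams. -/
def levelwise (D : PowerData M) (hD : D.IsAssembly) : PowerData (fun n => J ⥤ M n) where
  toPowerFunctors := levelwiseFunctors J D.toPowerFunctors
  assoc h₁ h₂ h₃ h₄ X Y Z :=
    NatIso.ofComponents (fun j => D.assoc h₁ h₂ h₃ h₄ (X.obj j) (Y.obj j) (Z.obj j))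
      (fun f => hD.assoc_natural h₁ h₂ h₃ h₄ (X.map f) (Y.map f) (Z.map f))
  wedgeOne hn V :=
    NatIso.ofComponents (fun j => D.wedgeOne hn (evalSeq J j V))
      (fun f => hD.wedgeOne_natural hn (evalSeqMap J f V))
  mul ha hb hk hna hnb hnk V :=
    { app := fun j => D.mul ha hb hk hna hnb hnk (evalSeq J j V)
      naturality := fun _ _ f => hD.mul_natural ha hb hk hna hnb hnk (evalSeqMap J f V) }
  comul ha hb hk hna hnb hnk V Q :=
    { app := fun j => D.comul ha hb hk hna hnb hnk (evalSeq J j V)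
        (Q.map ((evaluation J _).obj j) (evaluation_preserves J j))
      naturality := fun i j f =>
        (hD.comul_natural ha hb hk hna hnb hnk (evalSeqMap J f V)
          (Q.map ((evaluation J _).obj i) (evaluation_preserves J i))
          (Q.map ((evaluation J _).obj j) (evaluation_preserves J j))
          (evalSeqMap J f Q.seq) (by
            ext l
            exact ((Q.π.hom.app l).naturality f).symm)).symm }

end Levelwise

/-! ### Transport along equivalences -/

section Transport

variable {A : ℕ → Type u} [∀ n, Category.{v} (A n)] [∀ n, Preadditive (A n)]
  [∀ n, Conflations (A n)]
  {B : ℕ → Type u'} [∀ n, Category.{v'} (B n)] [∀ n, Preadditive (B n)]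
  [∀ n, Conflations (B n)]

/-- Apply the functors of the equivalences `E n : A n ≌ B n`, then the operations of `B`, then the
inverse functor. -/
def transportFunctors (E : ∀ n, A n ≌ B n) (hE : ∀ n, PreservesConflations (E n).functor)
    (D : PowerFunctors B) : PowerFunctors A where
  tensor {n p m} h :=
    (E n).functor ⋙ D.tensor h ⋙ (Functor.whiskeringLeft _ _ _).obj (E p).functor ⋙
      (Functor.whiskeringRight _ _ _).obj (E m).inverse
  wedge {k n m} hk h := mapSeq k (E n).functor (hE n) ⋙ D.wedge hk h ⋙ (E m).inverse

/-- `E (E⁻¹ X) ≅ X` -/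
abbrev cancel (E : ∀ n, A n ≌ B n) {n : ℕ} (X : B n) :
    (E n).functor.obj ((E n).inverse.obj X) ≅ X := (E n).counitIso.app X

/-- Transport of the data of an assembly along equivalences `E n : A n ≌ B n`. -/
def transport (E : ∀ n, A n ≌ B n) (hE : ∀ n, PreservesConflations (E n).functor)
    (D : PowerData B) : PowerData A where
  toPowerFunctors := transportFunctors E hE D.toPowerFunctors
  assoc {n p q _ _ m} h₁ h₂ h₃ h₄ X Y Z := (E m).inverse.mapIso
    (((D.tensor h₂).mapIso (cancel E _)).app ((E q).functor.obj Z) ≪≫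
      D.assoc h₁ h₂ h₃ h₄ ((E n).functor.obj X) ((E p).functor.obj Y) ((E q).functor.obj Z) ≪≫
      ((D.tensor h₄).obj ((E n).functor.obj X)).mapIso (cancel E _).symm)
  wedgeOne {n} hn V :=
    (E n).inverse.mapIso (D.wedgeOne hn ((mapSeq 1 (E n).functor (hE n)).obj V)) ≪≫
      ((E n).unitIso.app (V.obj.obj 0)).symm
  mul {n _ _ k _ _ nk} ha hb hk hna hnb hnk V := (E nk).inverse.map
    (D.tMap (add_index hk hna hnb hnk) (cancel E _).hom (cancel E _).hom ≫
      D.mul ha hb hk hna hnb hnk ((mapSeq k (E n).functor (hE n)).obj V))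
  comul {n _ _ k _ _ nk} ha hb hk hna hnb hnk V Q := (E nk).inverse.map
    (D.comul ha hb hk hna hnb hnk ((mapSeq k (E n).functor (hE n)).obj V)
        (Q.map (E n).functor (hE n)) ≫
      D.tMap (add_index hk hna hnb hnk) (cancel E _).inv (cancel E _).inv)

end Transport

/-! ### Restriction to full subcategories -/

section Restriction

variable {M : ℕ → Type u} [∀ n, Category.{v} (M n)] [∀ n, Preadditive (M n)]
  [∀ n, Conflations (M n)]

theorem ι_preserves {C : Type u} [Category.{v} C] [Preadditive C] [Conflations C]
    (P : ObjectProperty C) : PreservesConflations P.ι :=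
  fun _ _ ⟨w, h⟩ => ⟨congr_arg InducedCategory.Hom.hom w, h⟩

/-- The full subcategories given by `P n` are closed under tensor products. -/
def TensorClosed (D : PowerFunctors M) (P : ∀ n, ObjectProperty (M n)) : Prop :=
  ∀ {n p m : ℕ} (h : n + p = m) (X : M n) (Y : M p), P n X → P p Y → P m (D.tObj h X Y)

/-- The power operations send sequences of objects (and admissible monomorphisms) in the full
subcategory given by `P n` to objects of the full subcategory given by `P (n * k)`. -/
def WedgeClosed (D : PowerFunctors M) (P : ∀ n, ObjectProperty (M n)) : Prop :=
  ∀ {k n m : ℕ} (hk : 1 ≤ k) (h : n * k = m) (V : AdmSeq k (P n).FullSubcategory),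
    P m ((D.wedge hk h).obj ((mapSeq k (P n).ι (ι_preserves (P n))).obj V))

/-- Restriction of the functors to full subcategories. -/
def restrictFunctors (D : PowerFunctors M) (P : ∀ n, ObjectProperty (M n))
    (ht : TensorClosed D P) (hw : WedgeClosed D P) :
    PowerFunctors (fun n => (P n).FullSubcategory) where
  tensor {n p m} h :=
    { obj := fun X => (P m).lift ((P p).ι ⋙ (D.tensor h).obj X.obj)
        (fun Y => ht h X.obj Y.obj X.property Y.property)
      map := fun f =>
        { app := fun Y => ObjectProperty.homMk (((D.tensor h).map f.hom).app Y.obj)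
          naturality := fun _ _ g => by
            ext
            exact ((D.tensor h).map f.hom).naturality g.hom }
      map_id := fun X => by
        ext Y
        exact congr_app ((D.tensor h).map_id X.obj) Y.obj
      map_comp := fun f g => by
        ext Y
        exact congr_app ((D.tensor h).map_comp f.hom g.hom) Y.obj }
  wedge {k n m} hk h :=
    (P m).lift (mapSeq k (P n).ι (ι_preserves (P n)) ⋙ D.wedge hk h) (hw hk h)

/-- Restriction of the data of an assembly to full subcategories. -/
def restrictData (D : PowerData M) (P : ∀ n, ObjectProperty (M n))
    (ht : TensorClosed D.toPowerFunctors P) (hw : WedgeClosed D.toPowerFunctors P) :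
    PowerData (fun n => (P n).FullSubcategory) where
  toPowerFunctors := restrictFunctors D.toPowerFunctors P ht hw
  assoc h₁ h₂ h₃ h₄ X Y Z := ObjectProperty.isoMk _ (D.assoc h₁ h₂ h₃ h₄ X.obj Y.obj Z.obj)
  wedgeOne {n} hn V := ObjectProperty.isoMk _
    (D.wedgeOne hn ((mapSeq 1 (P n).ι (ι_preserves (P n))).obj V))
  mul {n _ _ k _ _ _} ha hb hk hna hnb hnk V := ObjectProperty.homMk
    (D.mul ha hb hk hna hnb hnk ((mapSeq k (P n).ι (ι_preserves (P n))).obj V))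
  comul {n _ _ k _ _ _} ha hb hk hna hnb hnk V Q := ObjectProperty.homMk
    (D.comul ha hb hk hna hnb hnk ((mapSeq k (P n).ι (ι_preserves (P n))).obj V)
      (Q.map (P n).ι (ι_preserves (P n))))

end Restriction

/-! ### Finite coproducts of conflations -/

section Coproducts

variable {C : Type u} [Category.{v} C] [Preadditive C] [Conflations C] [IsExactCategory C]

theorem isInflation_of_isPushout {X Y X' Y' : C} {i : X ⟶ Y} {f : X ⟶ X'} {f' : Y ⟶ Y'}
    {i' : X' ⟶ Y'} (h : IsPushout i f f' i') (hi : IsInflation i) : IsInflation i' := by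
  obtain ⟨Y'', f'', i'', h', Z, g, w, hg⟩ := IsExactCategory.pushout_inflation i f hi
  let e : Y'' ≅ Y' := h'.isoIsPushout _ _ h
  have he : i'' ≫ e.hom = i' := h'.inr_isoIsPushout_hom _ _ h
  have w' : i' ≫ e.inv ≫ g = 0 := by rw [← he]; simp [w]
  refine ⟨Z, e.inv ≫ g, w', IsExactCategory.of_iso ⟨?_⟩ hg⟩
  exact ShortComplex.isoMk (Iso.refl _) e (Iso.refl _) (by simp [he]) (by simp)

theorem isInflation_of_isIso {X Y : C} (f : X ⟶ Y) [IsIso f] : IsInflation f := by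
  obtain ⟨Z, g, w, hg⟩ := IsExactCategory.id_inflation X
  refine ⟨Z, inv f ≫ g, by simpa using w, IsExactCategory.of_iso ⟨?_⟩ hg⟩
  exact ShortComplex.isoMk (Iso.refl _) (asIso f) (Iso.refl _) (by simp) (by simp)

theorem isInflation_cofan (J : Type) [Finite J] :
    ∀ (A B : J → C) (f : ∀ j, A j ⟶ B j) (_ : ∀ j, IsInflation (f j))
      (cA : Cofan A) (_ : IsColimit cA) (cB : Cofan B) (_ : IsColimit cB) (F : cA.pt ⟶ cB.pt)
      (_ : ∀ j, cA.inj j ≫ F = f j ≫ cB.inj j), IsInflation F := by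
  induction J using Finite.induction_empty_option with
  | of_equiv e ih =>
    rename_i α β
    intro A B f hf cA hA cB hB F hF
    have key : ∀ (A : β → C) (c : Cofan A) (h : IsColimit c),
        Nonempty (IsColimit (Cofan.mk c.pt (fun i => c.inj (e i)))) := by
      intro A c h
      refine ⟨Cofan.IsColimit.mk _
        (fun s => Cofan.IsColimit.desc h (fun j => eqToHom (by simp) ≫ s.inj (e.symm j))) ?_ ?_⟩
      · intro s j
        have : ∀ (k : α) (hk : k = j), eqToHom (by rw [hk]) ≫ s.inj k = s.inj j := by
          rintro _ rfl; simp
        simpa using this _ (e.symm_apply_apply j)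
      · intro s m hm
        refine Cofan.IsColimit.hom_ext h _ _ (fun j => ?_)
        obtain ⟨j, rfl⟩ := e.surjective j
        have : ∀ (k : α) (hk : k = j), eqToHom (by rw [hk]) ≫ s.inj k = s.inj j := by
          rintro _ rfl; simp
        have h2 := this _ (e.symm_apply_apply j)
        have h3 := hm j
        simp only [Cofan.IsColimit.fac]
        exact h3.trans h2.symm
    exact ih _ _ (fun i => f (e i)) (fun i => hf _) _ (key A cA hA).some _ (key B cB hB).some F
      (fun i => hF (e i))
  | h_empty =>
    intro A B f hf cA hA cB hB F hF
    have hz : ∀ (A : PEmpty → C) (c : Cofan A) (_ : IsColimit c), 𝟙 c.pt = 0 :=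
      fun A c h => Cofan.IsColimit.hom_ext h _ _ (fun j => j.elim)
    have : IsIso F := ⟨0, by rw [comp_zero, hz A cA hA], by rw [zero_comp, hz B cB hB]⟩
    exact isInflation_of_isIso F
  | h_option ih =>
    rename_i α _
    intro A B f hf cA hA cB hB F hF
    let A' : α → C := fun i => A (some i)
    let B' : α → C := fun i => B (some i)
    let f' : ∐ A' ⟶ ∐ B' := Limits.Sigma.map (fun i => f (some i))
    have hf' : IsInflation f' := ih A' B' (fun i => f (some i)) (fun i => hf _) _
      (coproductIsCoproduct A') _ (coproductIsCoproduct B') f' (fun i => by simp [f'])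
    let u : ∐ A' ⟶ cA.pt := Sigma.desc (fun i => cA.inj (some i))
    let p : cA.pt ⟶ (∐ B') ⨿ A none := Cofan.IsColimit.desc hA (fun j => match j with
      | some i => f (some i) ≫ Sigma.ι B' i ≫ coprod.inl
      | none => coprod.inr)
    have hps : ∀ i, cA.inj (some i) ≫ p = f (some i) ≫ Sigma.ι B' i ≫ coprod.inl :=
      fun i => Cofan.IsColimit.fac hA _ (some i)
    have hpn : cA.inj none ≫ p = coprod.inr := Cofan.IsColimit.fac hA _ none
    have w1 : f' ≫ coprod.inl = u ≫ p := by
      refine Sigma.hom_ext _ _ (fun i => ?_)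
      simp [f', u, hps]
    have sq1 : IsPushout f' u (coprod.inl : _ ⟶ (∐ B') ⨿ A none) p := by
      refine ⟨⟨w1⟩, ⟨PushoutCocone.IsColimit.mk _
        (fun s => coprod.desc s.inl (cA.inj none ≫ s.inr)) ?_ ?_ ?_⟩⟩
      · intro s
        exact coprod.inl_desc _ _
      · intro s
        refine Cofan.IsColimit.hom_ext hA _ _ (fun j => ?_)
        cases j with
        | none => rw [← Category.assoc, hpn, coprod.inr_desc]
        | some i =>
          have := Sigma.ι A' i ≫= s.condition
          simp only [f', u, Sigma.ι_map_assoc, Sigma.ι_desc_assoc] at this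
          rw [← Category.assoc, hps]
          simpa only [Category.assoc, coprod.inl_desc] using this
      · intro s m h1 h2
        apply coprod.hom_ext
        · rw [coprod.inl_desc, h1]
        · rw [coprod.inr_desc, ← h2, ← Category.assoc, hpn]
    let u' : ∐ B' ⟶ cB.pt := Sigma.desc (fun i => cB.inj (some i))
    let q : (∐ B') ⨿ A none ⟶ cB.pt := coprod.desc u' (f none ≫ cB.inj none)
    have sq2 : IsPushout (f none) (coprod.inr : _ ⟶ (∐ B') ⨿ A none) (cB.inj none) q := by
      refine ⟨⟨by simp only [q, coprod.inr_desc]⟩, ⟨PushoutCocone.IsColimit.mk _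
        (fun s => Cofan.IsColimit.desc hB (fun j => match j with
          | some i => Sigma.ι B' i ≫ coprod.inl ≫ s.inr
          | none => s.inl)) ?_ ?_ ?_⟩⟩
      · intro s
        exact Cofan.IsColimit.fac hB _ none
      · intro s
        apply coprod.hom_ext
        · refine Sigma.hom_ext _ _ (fun i => ?_)
          simp only [q, u', coprod.inl_desc_assoc, Sigma.ι_desc_assoc]
          exact Cofan.IsColimit.fac hB _ (some i)
        · simp only [q, coprod.inr_desc_assoc, Category.assoc]
          rw [← s.condition]
          congr 1
          exact Cofan.IsColimit.fac hB _ none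
      · intro s m h1 h2
        refine Cofan.IsColimit.hom_ext hB _ _ (fun j => ?_)
        rw [Cofan.IsColimit.fac]
        cases j with
        | none => exact h1
        | some i => simp only [← h2, q, u', coprod.inl_desc_assoc, Sigma.ι_desc_assoc]
    have hF' : F = p ≫ q := by
      refine Cofan.IsColimit.hom_ext hA _ _ (fun j => ?_)
      cases j with
      | none => rw [hF, ← Category.assoc, hpn]; simp only [q, coprod.inr_desc]
      | some i => rw [hF, ← Category.assoc, hps]; simp only [q, u', Category.assoc, coprod.inl_desc, Sigma.ι_desc]
    rw [hF']
    exact IsExactCategory.comp_inflation _ _ (isInflation_of_isPushout sq1 hf')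
      (isInflation_of_isPushout sq2 (hf none))

theorem isConflation_cofan (J : Type) [Finite J] (A B Z : J → C) (f : ∀ j, A j ⟶ B j)
    (g : ∀ j, B j ⟶ Z j) (hfg : ∀ j, IsConflation (f j) (g j))
    {cA : Cofan A} (hA : IsColimit cA) {cB : Cofan B} (hB : IsColimit cB) {cZ : Cofan Z}
    (hZ : IsColimit cZ) (F : cA.pt ⟶ cB.pt) (G : cB.pt ⟶ cZ.pt)
    (hF : ∀ j, cA.inj j ≫ F = f j ≫ cB.inj j) (hG : ∀ j, cB.inj j ≫ G = g j ≫ cZ.inj j) :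
    IsConflation F G := by
  have w : F ≫ G = 0 := by
    refine Cofan.IsColimit.hom_ext hA _ _ (fun j => ?_)
    rw [← Category.assoc, hF, Category.assoc, hG, ← Category.assoc, (hfg j).1]
    simp
  obtain ⟨Q, p, w', hp⟩ := isInflation_cofan J A B f (fun j => ⟨_, _, hfg j⟩) cA hA cB hB F hF
  obtain ⟨hp'⟩ := IsExactCategory.isCokernel hp
  have hcok : ∀ j, IsColimit (CokernelCofork.ofπ (g j) (hfg j).1) :=
    fun j => (IsExactCategory.isCokernel (hfg j).2).some
  let r : cZ.pt ⟶ Q := Cofan.IsColimit.desc hZ (fun j =>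
    (CokernelCofork.IsColimit.desc' (hcok j) (cB.inj j ≫ p) (by
      rw [← Category.assoc, ← hF, Category.assoc, w', comp_zero])).1)
  have hr : ∀ j, g j ≫ cZ.inj j ≫ r = cB.inj j ≫ p := fun j => by
    rw [Cofan.IsColimit.fac]
    exact (CokernelCofork.IsColimit.desc' (hcok j) (cB.inj j ≫ p) _).2
  let t : Q ⟶ cZ.pt := (CokernelCofork.IsColimit.desc' hp' G w).1
  have ht : p ≫ t = G := (CokernelCofork.IsColimit.desc' hp' G w).2
  have hGr : G ≫ r = p := by
    refine Cofan.IsColimit.hom_ext hB _ _ (fun j => ?_)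
    rw [← Category.assoc, hG, Category.assoc, hr]
  let e : Q ≅ cZ.pt :=
    { hom := t
      inv := r
      hom_inv_id := Cofork.IsColimit.hom_ext hp' (by
        change p ≫ t ≫ r = p ≫ 𝟙 Q
        rw [← Category.assoc, ht, hGr, Category.comp_id])
      inv_hom_id := by
        refine Cofan.IsColimit.hom_ext hZ _ _ (fun j => ?_)
        refine Cofork.IsColimit.hom_ext (hcok j) ?_
        change g j ≫ cZ.inj j ≫ r ≫ t = g j ≫ cZ.inj j ≫ 𝟙 _
        rw [← Category.assoc (cZ.inj j), ← Category.assoc (g j), hr, Category.assoc, ht, hG,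
          Category.comp_id] }
  refine ⟨w, IsExactCategory.of_iso ⟨?_⟩ hp⟩
  exact ShortComplex.isoMk (Iso.refl _) (Iso.refl _) e (by simp) (by simp [e, ht])

end Coproducts

/-! ### The Dold–Puppe construction -/

section DoldPuppe

/-- Idempotent complete exact categories: the Dold–Kan equivalence `K ↦ Γ K`, with inverse the
normalized chain complex functor `N`. -/
def doldKan (C : Type u) [Category.{v} C] [Preadditive C] [Conflations C] [IsExactCategory C]
    [IsIdempotentComplete C] : ChainComplex C ℕ ≌ (SimplexCategoryᵒᵖ ⥤ C) :=
  (CategoryTheory.Idempotents.DoldKan.equivalence (C := C)).symm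

/-- The functor `Γ` sends degreewise conflations to levelwise conflations. -/
theorem doldKan_preserves (C : Type u) [Category.{v} C] [Preadditive C] [Conflations C]
    [IsExactCategory C] [IsIdempotentComplete C] :
    PreservesConflations (doldKan C).functor := by
  intro K L N f g hfg
  have key : ∀ Δ, IsConflation (((doldKan C).functor.map f).app Δ)
      (((doldKan C).functor.map g).app Δ) := fun Δ =>
    isConflation_cofan (SimplicialObject.Splitting.IndexSet Δ) _ _ _
      (fun A => f.f A.1.unop.len) (fun A => g.f A.1.unop.len)
      (fun A => ⟨congr_arg (fun φ => φ.f A.1.unop.len) hfg.1, hfg.2 A.1.unop.len⟩)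
      ((AlgebraicTopology.DoldKan.Γ₀.splitting K).isColimit Δ)
      ((AlgebraicTopology.DoldKan.Γ₀.splitting L).isColimit Δ)
      ((AlgebraicTopology.DoldKan.Γ₀.splitting N).isColimit Δ) _ _
      (fun A => (AlgebraicTopology.DoldKan.Γ₀.splitting K).ι_desc Δ _ A)
      (fun A => (AlgebraicTopology.DoldKan.Γ₀.splitting L).ι_desc Δ _ A)
  exact ⟨by ext Δ; exact (key Δ).1, fun Δ => (key Δ).2⟩

variable {M : ℕ → Type u} [∀ n, Category.{v} (M n)] [∀ n, Preadditive (M n)]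
  [∀ n, Conflations (M n)] [∀ n, IsExactCategory (M n)] [∀ n, IsIdempotentComplete (M n)]

/-- The Dold–Puppe construction on the non-negatively supported complexes `C^∞ M_n`: apply `Γ`, then
the operations of `D` levelwise, then `N`. -/
def doldPuppe (D : PowerData M) (hD : D.IsAssembly) : PowerData (fun n => ChainComplex (M n) ℕ) :=
  transport (fun n => doldKan (M n)) (fun n => doldKan_preserves (M n))
    (levelwise SimplexCategoryᵒᵖ D hD)

/-- Bounded complexes. -/
def bounded (C : Type u) [Category.{v} C] [Preadditive C] : ObjectProperty (ChainComplex C ℕ) :=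
  fun K => ∃ N : ℕ, ∀ i, N < i → IsZero (K.X i)

end DoldPuppe

end PowerOps

end

noncomputable section

namespace PowerOps

open AdmSeq ZeroObject

/-! ### Basic properties of conflations -/

section Basic

variable {C : Type u} [Category.{v} C] [Preadditive C] [Conflations C]

/-! Every axiom of an assembly is either an equation between morphisms or the claim that a sequence
is a conflation. Both can be checked after applying functors that are jointly faithful, jointly
reflect conflations, and match the two sets of operations up to coherent isomorphism. This is
`PowerData.IsAssembly.of_comparison`. It is applied three times: to the evaluations of diagrams, to
the Dold–Kan functor `Γ`, and to the inclusion of bounded complexes. The point with content is that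
`Γ` reflects conflations. The term `K_n` is a natural retract of `(Γ K)_n`, and in an idempotent
complete exact category retracts of conflations are conflations, by the obscure axiom. Exactness of
the categories themselves holds because the kernels, cokernels, pushouts and pullbacks involved are
computed degreewise, and because bounded complexes are closed under subobjects, quotients and
extensions.

The real work is boundedness. The normalized complex of `Y` vanishes in degree `n + 1` as soon as
every map out of `Y_{n+1}` that kills all degeneracies is zero. The object `(Γ K)_{n+1}` is the sum
of copies of `K_p` over the surjections `A : [n+1] → [p]`. A tuple `s` of `n + 1` integers acts on
the summand `A` by the product of the `s_i` over those `i` with `A(i) < A(i+1)`. This action is not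
simplicial, but it is natural in `K`. Hence the tensor product or power operation in level `n + 1`
is the value of the levelwise operation on `Scalings n`-diagrams, which again form an assembly.
Setting `s_i = 0` gives commuting idempotents `τ_i`, each of which factors through the degeneracy
`σ_i`. A map that kills the degeneracies is therefore unchanged by precomposition with the product
of all `1 - τ_i`.

Say that an object has degree at most `d` if every product of more than `d` distinct `1 - τ_i`
vanishes on it. If `K` vanishes above `N`, then `(Γ K)_{n+1}` has degree at most `N + 1`, since a
surjection onto `[p]` can jump at few places only. Degrees add under tensor products
(`Operators.Deg.tensor`), because `1 - τ ⊗ τ = (1 - τ) ⊗ 1 + τ ⊗ (1 - τ)`. A power operation of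
length `k` multiplies degrees by at most `k` (`Operators.Deg.wedge`): the exactness axioms filter it
by tensor products of shorter power operations, until only constant sequences on objects where each
`τ_i` is `0` or `1` remain. So in level `n + 1` above the resulting degree the product of all `1 -
τ_i` is zero, and the normalized complex vanishes there. -/

theorem IsConflation.zero {X Y Z : C} {f : X ⟶ Y} {g : Y ⟶ Z} (h : IsConflation f g) :
    f ≫ g = 0 := h.1

variable [IsExactCategory C]

instance IsExactCategory.hasBinaryBiproducts : HasBinaryBiproducts C :=
  hasBinaryBiproducts_of_finite_biproducts C

theorem IsConflation.of_iso {X Y Z X' Y' Z' : C} {f : X ⟶ Y} {g : Y ⟶ Z} {f' : X' ⟶ Y'}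
    {g' : Y' ⟶ Z'} (h : IsConflation f g) (e₁ : X ≅ X') (e₂ : Y ≅ Y') (e₃ : Z ≅ Z')
    (hf : f ≫ e₂.hom = e₁.hom ≫ f') (hg : g ≫ e₃.hom = e₂.hom ≫ g') : IsConflation f' g' := by
  obtain ⟨w, h⟩ := h
  have w' : f' ≫ g' = 0 := by
    rw [← cancel_epi e₁.hom, ← Category.assoc, ← hf, Category.assoc, ← hg, ← Category.assoc, w]
    simp
  exact ⟨w', IsExactCategory.of_iso ⟨ShortComplex.isoMk e₁ e₂ e₃ hf.symm hg.symm⟩ h⟩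

theorem IsConflation.nonempty_isLimit {X Y Z : C} {f : X ⟶ Y} {g : Y ⟶ Z} (h : IsConflation f g) :
    Nonempty (IsLimit (KernelFork.ofι f h.zero)) := IsExactCategory.isKernel h.2

theorem IsConflation.nonempty_isColimit {X Y Z : C} {f : X ⟶ Y} {g : Y ⟶ Z}
    (h : IsConflation f g) : Nonempty (IsColimit (CokernelCofork.ofπ g h.zero)) :=
  IsExactCategory.isCokernel h.2

theorem IsConflation.mono {X Y Z : C} {f : X ⟶ Y} {g : Y ⟶ Z} (h : IsConflation f g) : Mono f := by
  obtain ⟨l⟩ := h.nonempty_isLimit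
  exact mono_of_isLimit_fork l

theorem IsConflation.epi {X Y Z : C} {f : X ⟶ Y} {g : Y ⟶ Z} (h : IsConflation f g) : Epi g := by
  obtain ⟨l⟩ := h.nonempty_isColimit
  exact epi_of_isColimit_cofork l

theorem IsConflation.exists_lift {X Y Z W : C} {f : X ⟶ Y} {g : Y ⟶ Z} (h : IsConflation f g)
    (t : W ⟶ Y) (ht : t ≫ g = 0) : ∃ s : W ⟶ X, s ≫ f = t := by
  obtain ⟨l⟩ := h.nonempty_isLimit
  obtain ⟨s, hs⟩ := KernelFork.IsLimit.lift' l t ht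
  exact ⟨s, hs⟩

theorem IsConflation.exists_desc {X Y Z W : C} {f : X ⟶ Y} {g : Y ⟶ Z} (h : IsConflation f g)
    (t : Y ⟶ W) (ht : f ≫ t = 0) : ∃ s : Z ⟶ W, g ≫ s = t := by
  obtain ⟨l⟩ := h.nonempty_isColimit
  obtain ⟨s, hs⟩ := CokernelCofork.IsColimit.desc' l t ht
  exact ⟨s, hs⟩

theorem IsInflation.isConflation {X Y Z : C} {f : X ⟶ Y} {g : Y ⟶ Z} (hf : IsInflation f)
    (w : f ≫ g = 0) (l : IsColimit (CokernelCofork.ofπ g w)) : IsConflation f g := by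
  obtain ⟨Z', g', h⟩ := hf
  obtain ⟨l'⟩ := h.nonempty_isColimit
  refine h.of_iso (Iso.refl _) (Iso.refl _) (l'.coconePointUniqueUpToIso l) (by simp) ?_
  simpa using l'.comp_coconePointUniqueUpToIso_hom l WalkingParallelPair.one

theorem IsDeflation.isConflation {X Y Z : C} {f : X ⟶ Y} {g : Y ⟶ Z} (hg : IsDeflation g)
    (w : f ≫ g = 0) (l : IsLimit (KernelFork.ofι f w)) : IsConflation f g := by
  obtain ⟨X', f', h⟩ := hg
  obtain ⟨l'⟩ := h.nonempty_isLimit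
  refine h.of_iso (l'.conePointUniqueUpToIso l) (Iso.refl _) (Iso.refl _) ?_ (by simp)
  simpa using (l'.conePointUniqueUpToIso_hom_comp l WalkingParallelPair.zero).symm

theorem isDeflation_of_isPullback {Y' Y Z' Z : C} {f' : Y' ⟶ Y} {p' : Y' ⟶ Z'} {p : Y ⟶ Z}
    {f : Z' ⟶ Z} (h : IsPullback f' p' p f) (hp : IsDeflation p) : IsDeflation p' := by
  obtain ⟨Y'', f'', p'', h', X, i, hi⟩ := IsExactCategory.pullback_deflation p f hp
  let e : Y'' ≅ Y' := h'.isoIsPullback _ _ h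
  exact ⟨X, i ≫ e.hom, hi.of_iso (Iso.refl _) e (Iso.refl _) (by simp) (by simp [e])⟩

theorem IsInflation.comp_iso {X Y Y' : C} {f : X ⟶ Y} (hf : IsInflation f) (e : Y ≅ Y') :
    IsInflation (f ≫ e.hom) :=
  IsExactCategory.comp_inflation _ _ hf (isInflation_of_isIso _)

/-- The inclusion is a pushout of `0 ⟶ Y`, and `0 ⟶ Y` is an admissible monomorphism because it is
the kernel of the deflation `𝟙 Y`. -/
theorem isInflation_biprod_inl (X Y : C) : IsInflation (biprod.inl : X ⟶ X ⊞ Y) := by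
  have h : IsInflation (0 : (0 : C) ⟶ Y) := by
    obtain ⟨K, i, hi⟩ := IsExactCategory.id_deflation Y
    have hi0 : i = 0 := by simpa using hi.zero
    have := hi.mono
    have hK : IsZero K := by
      rw [IsZero.iff_id_eq_zero, ← cancel_mono i, hi0]; simp
    exact ⟨_, _, hi.of_iso (hK.iso (isZero_zero C)) (Iso.refl _) (Iso.refl _)
      (by simp [hi0]) rfl⟩
  exact isInflation_of_isPushout (IsPushout.of_has_biproduct X Y).flip h

theorem isConflation_biprod (X Y : C) :
    IsConflation (biprod.inl : X ⟶ X ⊞ Y) (biprod.snd : X ⊞ Y ⟶ Y) :=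
  (isInflation_biprod_inl X Y).isConflation (by simp)
    (biprod.isCokernelInlCokernelFork X Y)

/-- The obscure axiom: a morphism with a cokernel which becomes an admissible monomorphism after
composition is an admissible monomorphism. -/
theorem isConflation_of_comp_inflation {A B Q D : C} (i : A ⟶ B) (j : B ⟶ D) (k : B ⟶ Q)
    (hij : IsInflation (i ≫ j)) (w : i ≫ k = 0) (hk : IsColimit (CokernelCofork.ofπ k w))
    (hi : IsLimit (KernelFork.ofι i w)) : IsConflation i k := by
  -- `(i, 0) : A ⟶ B ⊞ D` is an admissible monomorphism
  have h₁ : IsInflation (biprod.lift (𝟙 A) i : A ⟶ A ⊞ B) := by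
    let e : A ⊞ B ≅ A ⊞ B :=
      { hom := biprod.lift biprod.fst (biprod.fst ≫ i + biprod.snd)
        inv := biprod.lift biprod.fst (biprod.snd - biprod.fst ≫ i)
        hom_inv_id := by ext <;> simp
        inv_hom_id := by ext <;> simp }
    have : biprod.lift (𝟙 A) i = biprod.inl ≫ e.hom := by ext <;> simp [e]
    rw [this]
    exact (isInflation_biprod_inl A B).comp_iso e
  -- This is the pushout of `i ≫ j` along `biprod.inl`.
  have h₂ : IsInflation (biprod.map (i ≫ j) (𝟙 B)) := by
    refine isInflation_of_isPushout (i := i ≫ j) (f := biprod.inl) (f' := biprod.inl) ?_ hij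
    refine ⟨⟨by simp⟩, ⟨PushoutCocone.IsColimit.mk _
      (fun s => biprod.desc s.inl (biprod.inr ≫ s.inr)) (by simp) ?_ ?_⟩⟩
    · intro s
      ext
      · simpa using s.condition
      · simp
    · intro s m h h'
      ext
      · simpa using h
      · simp [← h']
  -- On elements: `a ↦ (a, i a) ↦ (j i a, i a)`, and the shear `(d, b) ↦ (d - j b, b)` sends this to
  -- `(0, i a)`.
  have h₃ : IsInflation (biprod.lift 0 i : A ⟶ D ⊞ B) := by
    let e : D ⊞ B ≅ D ⊞ B :=
      { hom := biprod.lift (biprod.fst - biprod.snd ≫ j) biprod.snd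
        inv := biprod.lift (biprod.fst + biprod.snd ≫ j) biprod.snd
        hom_inv_id := by ext <;> simp
        inv_hom_id := by ext <;> simp }
    have : biprod.lift 0 i = (biprod.lift (𝟙 A) i ≫ biprod.map (i ≫ j) (𝟙 B)) ≫ e.hom := by
      ext <;> simp [e]
    rw [this]
    exact (IsExactCategory.comp_inflation _ _ h₁ h₂).comp_iso e
  have w' : biprod.lift (0 : A ⟶ D) i ≫ biprod.map (𝟙 D) k = 0 := by
    ext <;> simp [w]
  have h₄ : IsConflation (biprod.lift (0 : A ⟶ D) i) (biprod.map (𝟙 D) k) := by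
    refine h₃.isConflation w' ?_
    refine CokernelCofork.IsColimit.ofπ _ _
      (fun g hg => biprod.desc (biprod.inl ≫ g)
        (CokernelCofork.IsColimit.desc' hk (biprod.inr ≫ g) (by
          rw [← Category.assoc, ← hg]; congr 1; ext <;> simp)).1) ?_ ?_
    · intro Z g hg
      ext
      · simp
      · have := (CokernelCofork.IsColimit.desc' hk (biprod.inr ≫ g) (by
          rw [← Category.assoc, ← hg]; congr 1; ext <;> simp)).2
        simpa using this
    · intro Z g hg m hm
      ext
      · simp [← hm]
      · apply Cofork.IsColimit.hom_ext hk
        have := (CokernelCofork.IsColimit.desc' hk (biprod.inr ≫ g) (by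
          rw [← Category.assoc, ← hg]; congr 1; ext <;> simp)).2
        simp only [biprod.inr_desc]
        refine Eq.trans ?_ this.symm
        simp [← hm]
  -- The deflation `𝟙 D ⊞ k` pulls back along `biprod.inr` to `k`.
  have h₅ : IsDeflation k := by
    refine isDeflation_of_isPullback (f' := biprod.inr) (p := biprod.map (𝟙 D) k)
      (f := biprod.inr) ?_ ⟨_, _, h₄⟩
    refine ⟨⟨by simp⟩, ⟨PullbackCone.IsLimit.mk _ (fun s => s.fst ≫ biprod.snd) ?_ ?_ ?_⟩⟩
    · intro s
      ext
      · have := s.condition =≫ biprod.fst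
        simpa using this.symm
      · simp
    · intro s
      have := s.condition =≫ biprod.snd
      simpa using this
    · intro s m h h'
      simp [← h]
  exact h₅.isConflation w hi

end Basic

/-! ### Split subobjects and retracts of conflations -/

section Idempotent

variable {C : Type u} [Category.{v} C] [Preadditive C] [IsIdempotentComplete C]

/-- The complement of a split subobject in an idempotent complete category. -/
theorem exists_complement {X Y : C} (i : X ⟶ Y) (r : Y ⟶ X) (h : i ≫ r = 𝟙 X) :
    ∃ (Z : C) (i' : Z ⟶ Y) (r' : Y ⟶ Z), i' ≫ r' = 𝟙 Z ∧ i ≫ r' = 0 ∧ i' ≫ r = 0 ∧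
      r ≫ i + r' ≫ i' = 𝟙 Y := by
  have hp : (r ≫ i) ≫ (r ≫ i) = r ≫ i := by simp [reassoc_of% h]
  obtain ⟨Z, i', r', h₁, h₂⟩ := IsIdempotentComplete.idempotents_split Y (𝟙 Y - r ≫ i)
    (Idempotents.idem_of_id_sub_idem _ hp)
  have := (⟨⟨r', h₁⟩⟩ : IsSplitMono i')
  have := (⟨⟨i', h₁⟩⟩ : IsSplitEpi r')
  refine ⟨Z, i', r', h₁, ?_, ?_, by rw [h₂]; abel⟩
  · rw [← cancel_mono i', Category.assoc, h₂]; simp [reassoc_of% h]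
  · rw [← cancel_epi r', ← Category.assoc, h₂]; simp [h]

end Idempotent

section Retract

variable {C : Type u} [Category.{v} C] [Preadditive C] [Conflations C] [IsExactCategory C]

theorem isConflation_of_split {X Y Z : C} (i : X ⟶ Y) (r : Y ⟶ X) (i' : Z ⟶ Y) (r' : Y ⟶ Z)
    (h : i ≫ r = 𝟙 X) (h' : i' ≫ r' = 𝟙 Z) (h₁ : i ≫ r' = 0) (h₂ : i' ≫ r = 0)
    (h₃ : r ≫ i + r' ≫ i' = 𝟙 Y) : IsConflation i r' := by
  let e : X ⊞ Z ≅ Y :=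
    { hom := biprod.desc i i'
      inv := biprod.lift r r'
      hom_inv_id := by ext <;> simp [h, h', h₁, h₂]
      inv_hom_id := by simp [h₃] }
  refine (isConflation_biprod X Z).of_iso (Iso.refl _) e (Iso.refl _) (by simp [e]) ?_
  ext <;> simp [e, h₁, h']

theorem isInflation_of_splitMono [IsIdempotentComplete C] {X Y : C} (i : X ⟶ Y) (r : Y ⟶ X)
    (h : i ≫ r = 𝟙 X) : IsInflation i := by
  obtain ⟨Z, i', r', h', h₁, h₂, h₃⟩ := exists_complement i r h
  exact ⟨Z, r', isConflation_of_split i r i' r' h h' h₁ h₂ h₃⟩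

/-- Retracts of conflations are conflations. -/
theorem IsConflation.of_retract [IsIdempotentComplete C] {X Y Z X' Y' Z' : C} {f : X ⟶ Y}
    {g : Y ⟶ Z} {f' : X' ⟶ Y'} {g' : Y' ⟶ Z'} (h : IsConflation f' g')
    (i₁ : X ⟶ X') (i₂ : Y ⟶ Y') (i₃ : Z ⟶ Z') (r₁ : X' ⟶ X) (r₂ : Y' ⟶ Y) (r₃ : Z' ⟶ Z)
    (h₁ : i₁ ≫ r₁ = 𝟙 _) (h₂ : i₂ ≫ r₂ = 𝟙 _) (h₃ : i₃ ≫ r₃ = 𝟙 _)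
    (hif : f ≫ i₂ = i₁ ≫ f') (hig : g ≫ i₃ = i₂ ≫ g')
    (hrf : f' ≫ r₂ = r₁ ≫ f) (hrg : g' ≫ r₃ = r₂ ≫ g) : IsConflation f g := by
  have : Mono i₃ := (⟨⟨r₃, h₃⟩⟩ : IsSplitMono i₃).mono
  have : Epi r₃ := (⟨⟨i₃, h₃⟩⟩ : IsSplitEpi r₃).epi
  have := h.mono
  have := h.epi
  have w : f ≫ g = 0 := by
    rw [← cancel_mono i₃, Category.assoc, hig, ← Category.assoc, hif, Category.assoc, h.zero]
    simp
  have hf : Mono f := by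
    have : Mono (f ≫ i₂) := by
      rw [hif]
      have : Mono i₁ := (⟨⟨r₁, h₁⟩⟩ : IsSplitMono i₁).mono
      exact mono_comp _ _
    exact mono_of_mono f i₂
  have hg : Epi g := by
    have : Epi (r₂ ≫ g) := by
      rw [← hrg]
      exact epi_comp _ _
    exact epi_of_epi r₂ g
  have hl : ∀ {W : C} (t : W ⟶ Y), t ≫ g = 0 → ∃ s, s ≫ f = t := by
    intro W t ht
    obtain ⟨s, hs⟩ := h.exists_lift (t ≫ i₂) (by
      rw [Category.assoc, ← hig, ← Category.assoc, ht, zero_comp])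
    refine ⟨s ≫ r₁, ?_⟩
    rw [Category.assoc, ← hrf, ← Category.assoc, hs, Category.assoc, h₂, Category.comp_id]
  have hc : ∀ {W : C} (t : Y ⟶ W), f ≫ t = 0 → ∃ s, g ≫ s = t := by
    intro W t ht
    obtain ⟨s, hs⟩ := h.exists_desc (r₂ ≫ t) (by
      rw [← Category.assoc, hrf, Category.assoc, ht, comp_zero])
    refine ⟨i₃ ≫ s, ?_⟩
    rw [← Category.assoc, hig, Category.assoc, hs, ← Category.assoc, h₂, Category.id_comp]
  -- The kernel and cokernel properties of `f`, `g` follow from those of `f'`, `g'` by a diagram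
  -- chase. For admissibility, `f ≫ i₂ = i₁ ≫ f'` is a split monomorphism followed by an inflation,
  -- and split monomorphisms are inflations because idempotents split. The obscure axiom then
  -- applies to `f`.
  refine isConflation_of_comp_inflation f i₂ g ?_ w
    (CokernelCofork.IsColimit.ofπ _ _ (fun t ht => (hc t ht).choose)
      (fun t ht => (hc t ht).choose_spec) (fun t ht m hm => ?_))
    (KernelFork.IsLimit.ofι _ _ (fun t ht => (hl t ht).choose)
      (fun t ht => (hl t ht).choose_spec) (fun t ht m hm => ?_))
  · rw [hif]
    exact IsExactCategory.comp_inflation _ _ (isInflation_of_splitMono i₁ r₁ h₁) ⟨_, _, h⟩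
  · rw [← cancel_epi g, hm, (hc t ht).choose_spec]
  · rw [← cancel_mono f, hm, (hl t ht).choose_spec]

end Retract

end PowerOps
end

noncomputable section

namespace PowerOps

open AdmSeq

/-! ### Existence and universal property of quotient sequences -/

section Quotients

variable {C : Type u} [Category.{v} C] [Preadditive C] [Conflations C] [IsExactCategory C]
  {a b k : ℕ}

/-- Choose cokernels of the maps out of the last term of the initial part. The induced maps between
them are admissible monomorphisms because they are pushouts of those of `V`. -/
theorem QuotientSeq.nonempty (ha : 1 ≤ a) (h : a + b = k) (V : AdmSeq k C) :
    Nonempty (QuotientSeq h V) := by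
  let i₀ : Fin k := ⟨a - 1, by omega⟩
  have hi₀ : ∀ j : Fin b, i₀ ≤ tailMap h j := fun j => by
    change a - 1 ≤ a + j.1
    omega
  choose Z p hp using fun j : Fin b => V.property i₀ (tailMap h j) (hi₀ j)
  have hepi : ∀ j, Epi (p j) := fun j => (hp j).epi
  have hle : ∀ {j l : Fin b}, j ≤ l → tailMap h j ≤ tailMap h l := fun hjl =>
    (tailMap h).monotone hjl
  have hd : ∀ (j l : Fin b) (hjl : j ≤ l), ∃ d : Z j ⟶ Z l,
      p j ≫ d = V.obj.map (homOfLE (hle hjl)) ≫ p l := fun j l hjl =>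
    (hp j).exists_desc _ (by
      rw [← Category.assoc, ← V.obj.map_comp]
      exact (hp l).zero)
  choose d hd using hd
  -- Both `p j` and `p l` are cokernels of maps out of the same object `V_a`, and the map to `V_l`
  -- factors through `V_j`. A map out of `V_l` that is compatible with one out of `Z j` thus kills
  -- `V_a` and descends to `Z l`.
  have hpush : ∀ (j l : Fin b) (hjl : j ≤ l),
      IsPushout (V.obj.map (homOfLE (hle hjl))) (p j) (p l) (d j l hjl) := by
    intro j l hjl
    have aux : ∀ s : PushoutCocone (V.obj.map (homOfLE (hle hjl))) (p j),
        ∃ t : Z l ⟶ s.pt, p l ≫ t = s.inl := fun s => (hp l).exists_desc _ (by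
      have : V.obj.map (homOfLE (hi₀ l)) =
          V.obj.map (homOfLE (hi₀ j)) ≫ V.obj.map (homOfLE (hle hjl)) := by
        rw [← V.obj.map_comp]; rfl
      rw [this, Category.assoc, s.condition, ← Category.assoc, (hp j).zero, zero_comp])
    refine ⟨⟨(hd j l hjl).symm⟩, ⟨PushoutCocone.IsColimit.mk _ (fun s => (aux s).choose)
      (fun s => (aux s).choose_spec) (fun s => ?_) (fun s m h₁ _ => ?_)⟩⟩
    · rw [← cancel_epi (p j), ← Category.assoc, hd, Category.assoc, (aux s).choose_spec,
        s.condition]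
    · rw [← cancel_epi (p l), h₁, (aux s).choose_spec]
  refine ⟨⟨⟨{ obj := Z, map := fun f => d _ _ (leOfHom f), map_id := ?_, map_comp := ?_ }, ?_⟩,
    ObjectProperty.homMk { app := p, naturality := ?_ }, ?_⟩⟩
  · intro j
    rw [← cancel_epi (p j), hd, Category.comp_id]
    exact (congr_arg (· ≫ p j) (V.obj.map_id _)).trans (Category.id_comp _)
  · intro j l m f g
    rw [← cancel_epi (p j), hd, ← Category.assoc, hd, Category.assoc, hd, ← Category.assoc,
      ← V.obj.map_comp]
    rfl
  · intro j l hjl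
    exact isInflation_of_isPushout (hpush j l hjl) (V.property _ _ _)
  · intro j l f
    exact (hd j l (leOfHom f)).symm
  · intro i hi j hij
    obtain rfl : i = i₀ := Fin.ext (by dsimp [i₀]; omega)
    exact hp j

theorem QuotientSeq.exists_desc {h : a + b = k} {V : AdmSeq k C} (ha : 1 ≤ a)
    (Q : QuotientSeq h V) {W : AdmSeq b C} (f : (tail h).obj V ⟶ W)
    (hf : ∀ (i : Fin k) (_ : i.1 + 1 = a) (j : Fin b) (hij : i ≤ tailMap h j),
      V.obj.map (homOfLE hij) ≫ f.hom.app j = 0) : ∃ g : Q.seq ⟶ W, Q.π ≫ g = f := by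
  let i₀ : Fin k := ⟨a - 1, by omega⟩
  have hi₀ : i₀.1 + 1 = a := by dsimp [i₀]; omega
  have hij : ∀ j : Fin b, i₀ ≤ tailMap h j := fun j => by
    change a - 1 ≤ a + j.1
    omega
  have hQ := fun j => Q.conf i₀ hi₀ j (hij j)
  choose g hg using fun j => (hQ j).exists_desc _ (hf i₀ hi₀ j (hij j))
  refine ⟨ObjectProperty.homMk { app := g, naturality := fun j l φ => ?_ }, ?_⟩
  · have : Epi (Q.π.hom.app j) := (hQ j).epi
    rw [← cancel_epi (Q.π.hom.app j), ← Category.assoc, ← Q.π.hom.naturality, Category.assoc]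
    refine (congr_arg (_ ≫ ·) (hg l)).trans (Eq.trans ?_
      ((congr_arg (· ≫ _) (hg j)).symm.trans (Category.assoc _ _ _)))
    exact f.hom.naturality φ
  · apply ObjectProperty.hom_ext
    ext j
    exact hg j

end Quotients

end PowerOps
end

noncomputable section

namespace PowerOps

open AdmSeq

/-! ### Exact categories of diagrams and complexes -/

section Pointwise

variable {C : Type u} [Category.{v} C] [Preadditive C] [Conflations C] [IsExactCategory C]
  {E : Type u'} [Category.{v'} E] [Preadditive E] [Conflations E]

/-- A category with a family of functors to an exact category which detect conflations and
compute limits and colimits is exact. -/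
theorem isExactCategory_of_pointwise [HasFiniteBiproducts E] {ι : Type w} (ev : ι → E ⥤ C)
    [∀ i, (ev i).Additive]
    (hconf : ∀ {X Y Z : E} (f : X ⟶ Y) (g : Y ⟶ Z), f ≫ g = 0 →
      (IsConflation f g ↔ ∀ i, IsConflation ((ev i).map f) ((ev i).map g)))
    (hlim : ∀ {K : Type} [SmallCategory K] (F : K ⥤ E) (c : Cone F),
      (∀ i, Nonempty (IsLimit ((ev i).mapCone c))) → Nonempty (IsLimit c))
    (hcolim : ∀ {K : Type} [SmallCategory K] (F : K ⥤ E) (c : Cocone F),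
      (∀ i, Nonempty (IsColimit ((ev i).mapCocone c))) → Nonempty (IsColimit c))
    (hlim' : ∀ {K : Type} [SmallCategory K] (F : K ⥤ E), (∀ i, HasLimit (F ⋙ ev i)) →
      ∃ c : Cone F, ∀ i, Nonempty (IsLimit ((ev i).mapCone c)))
    (hcolim' : ∀ {K : Type} [SmallCategory K] (F : K ⥤ E), (∀ i, HasColimit (F ⋙ ev i)) →
      ∃ c : Cocone F, ∀ i, Nonempty (IsColimit ((ev i).mapCocone c))) :
    IsExactCategory E := by
  -- The cokernels exist after applying each `ev i`. They are therefore the images of one cocone in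
  -- `E`, and its projection completes `f` to a conflation.
  have hinfl : ∀ {X Y : E} (f : X ⟶ Y), (∀ i, IsInflation ((ev i).map f)) → IsInflation f := by
    intro X Y f hf
    have hz : ∀ i, HasColimit (parallelPair f 0 ⋙ ev i) := fun i => by
      obtain ⟨Z, g, hg⟩ := hf i
      have : HasColimit (parallelPair ((ev i).map f) 0) := ⟨⟨⟨_, hg.nonempty_isColimit.some⟩⟩⟩
      exact hasColimit_of_iso (parallelPair.ext (G := parallelPair ((ev i).map f) 0)
        (Iso.refl _) (Iso.refl _) (by simp) (by simp))
    obtain ⟨c, hc⟩ := hcolim' (parallelPair f 0) hz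
    let c' : CokernelCofork f := c
    exact ⟨_, c'.π, (hconf _ _ c'.condition).2 fun i =>
      (hf i).isConflation (c'.map_condition (ev i)) (c'.isColimitMapCoconeEquiv (ev i) (hc i).some)⟩
  have hdefl : ∀ {X Y : E} (f : X ⟶ Y), (∀ i, IsDeflation ((ev i).map f)) → IsDeflation f := by
    intro X Y f hf
    have hz : ∀ i, HasLimit (parallelPair f 0 ⋙ ev i) := fun i => by
      obtain ⟨Z, g, hg⟩ := hf i
      have : HasLimit (parallelPair ((ev i).map f) 0) := ⟨⟨⟨_, hg.nonempty_isLimit.some⟩⟩⟩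
      exact hasLimit_of_iso (F := parallelPair ((ev i).map f) 0) (parallelPair.ext
        (Iso.refl _) (Iso.refl _) (by simp) (by simp))
    obtain ⟨c, hc⟩ := hlim' (parallelPair f 0) hz
    let c' : KernelFork f := c
    exact ⟨_, c'.ι, (hconf _ _ c'.condition).2 fun i =>
      (hf i).isConflation (c'.map_condition (ev i)) (c'.isLimitMapConeEquiv (ev i) (hc i).some)⟩
  have hinfl' : ∀ {X Y : E} (f : X ⟶ Y) (_ : IsInflation f) i, IsInflation ((ev i).map f) :=
    fun f ⟨Z, g, hg⟩ i => ⟨_, _, (hconf _ _ hg.zero).1 hg i⟩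
  have hdefl' : ∀ {X Y : E} (f : X ⟶ Y) (_ : IsDeflation f) i, IsDeflation ((ev i).map f) :=
    fun f ⟨Z, g, hg⟩ i => ⟨_, _, (hconf _ _ hg.zero).1 hg i⟩
  refine
    { of_iso := ?_
      isKernel := ?_
      isCokernel := ?_
      id_inflation := fun X => hinfl _ fun i => ?_
      id_deflation := fun X => hdefl _ fun i => ?_
      comp_inflation := fun f g hf hg => hinfl _ fun i => ?_
      comp_deflation := fun f g hf hg => hdefl _ fun i => ?_
      pushout_inflation := ?_
      pullback_deflation := ?_ }
  · rintro S T ⟨e⟩ hS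
    have h : IsConflation S.f S.g := ⟨S.zero, hS⟩
    rw [hconf _ _ S.zero] at h
    have h' : IsConflation T.f T.g := (hconf _ _ T.zero).2 fun i =>
      (h i).of_iso ((ev i).mapIso (ShortComplex.π₁.mapIso e))
        ((ev i).mapIso (ShortComplex.π₂.mapIso e)) ((ev i).mapIso (ShortComplex.π₃.mapIso e))
        (by
          have := congr_arg (ev i).map e.hom.comm₁₂
          rw [Functor.map_comp, Functor.map_comp] at this
          exact this.symm)
        (by
          have := congr_arg (ev i).map e.hom.comm₂₃
          rw [Functor.map_comp, Functor.map_comp] at this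
          exact this.symm)
    exact h'.2
  · intro S hS
    refine hlim _ _ fun i => ?_
    have h : IsConflation S.f S.g := ⟨S.zero, hS⟩
    exact ⟨((KernelFork.ofι S.f S.zero).isLimitMapConeEquiv (ev i)).symm
      ((hconf _ _ S.zero).1 h i).nonempty_isLimit.some⟩
  · intro S hS
    refine hcolim _ _ fun i => ?_
    have h : IsConflation S.f S.g := ⟨S.zero, hS⟩
    exact ⟨((CokernelCofork.ofπ S.g S.zero).isColimitMapCoconeEquiv (ev i)).symm
      ((hconf _ _ S.zero).1 h i).nonempty_isColimit.some⟩
  · rw [CategoryTheory.Functor.map_id]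
    exact IsExactCategory.id_inflation _
  · rw [CategoryTheory.Functor.map_id]
    exact IsExactCategory.id_deflation _
  · rw [Functor.map_comp]
    exact IsExactCategory.comp_inflation _ _ (hinfl' f hf i) (hinfl' g hg i)
  · rw [Functor.map_comp]
    exact IsExactCategory.comp_deflation _ _ (hdefl' f hf i) (hdefl' g hg i)
  -- `C` need not have all pushouts. Those of the inflations `(ev i).map j` exist, which is all that
  -- `hcolim'` asks for.
  · intro X Y X' j f hj
    obtain ⟨c, hc⟩ := hcolim' (span j f) fun i => by
      obtain ⟨_, _, _, h, _⟩ := IsExactCategory.pushout_inflation ((ev i).map j) ((ev i).map f)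
        (hinfl' j hj i)
      have : HasColimit (span ((ev i).map j) ((ev i).map f)) := ⟨⟨⟨_, h.isColimit⟩⟩⟩
      exact hasColimit_of_iso (spanCompIso (ev i) j f)
    obtain ⟨l⟩ := hcolim _ c hc
    let c' : PushoutCocone j f := c
    have h : IsPushout j f c'.inl c'.inr := IsPushout.of_isColimit l
    refine ⟨_, _, _, h, hinfl _ fun i => ?_⟩
    have : PreservesColimit (span j f) (ev i) :=
      preservesColimit_of_preserves_colimit_cocone l (hc i).some
    exact isInflation_of_isPushout (h.map (ev i)) (hinfl' j hj i)
  · intro X Y X' j f hj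
    obtain ⟨c, hc⟩ := hlim' (cospan j f) fun i => by
      obtain ⟨_, _, _, h, _⟩ := IsExactCategory.pullback_deflation ((ev i).map j) ((ev i).map f)
        (hdefl' j hj i)
      have : HasLimit (cospan ((ev i).map j) ((ev i).map f)) := ⟨⟨⟨_, h.isLimit⟩⟩⟩
      exact hasLimit_of_iso (cospanCompIso (ev i) j f).symm
    obtain ⟨l⟩ := hlim _ c hc
    let c' : PullbackCone j f := c
    have h : IsPullback c'.fst c'.snd j f := IsPullback.of_isLimit l
    refine ⟨_, _, _, h, hdefl _ fun i => ?_⟩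
    have : PreservesLimit (cospan j f) (ev i) :=
      preservesLimit_of_preserves_limit_cone l (hc i).some
    exact isDeflation_of_isPullback (h.map (ev i)) (hdefl' j hj i)

end Pointwise

section

variable {C : Type u} [Category.{v} C] [Preadditive C] [Conflations C]

theorem isConflation_functor_iff {J : Type w} [Category.{w} J] {X Y Z : J ⥤ C} (f : X ⟶ Y)
    (g : Y ⟶ Z) : IsConflation f g ↔ ∀ j, IsConflation (f.app j) (g.app j) :=
  ⟨fun h j => ⟨congr_app h.1 j, h.2 j⟩, fun h => ⟨by ext j; exact (h j).1, fun j => (h j).2⟩⟩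

theorem isConflation_complex_iff {ι : Type w} {c : ComplexShape ι} {X Y Z : HomologicalComplex C c}
    (f : X ⟶ Y) (g : Y ⟶ Z) : IsConflation f g ↔ ∀ i, IsConflation (f.f i) (g.f i) :=
  ⟨fun h i => ⟨congr_arg (fun φ => φ.f i) h.1, h.2 i⟩,
    fun h => ⟨by ext i; exact (h i).1, fun i => (h i).2⟩⟩

variable [IsExactCategory C]

instance functorIsExactCategory (J : Type) [SmallCategory J] : IsExactCategory (J ⥤ C) := by
  have : HasFiniteBiproducts (J ⥤ C) := HasFiniteBiproducts.of_hasFiniteProducts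
  refine isExactCategory_of_pointwise (fun j => (evaluation J C).obj j)
    (fun f g _ => isConflation_functor_iff f g)
    (fun F c h => ⟨evaluationJointlyReflectsLimits c fun j => (h j).some⟩)
    (fun F c h => ⟨evaluationJointlyReflectsColimits c fun j => (h j).some⟩)
    (fun F h => ?_) (fun F h => ?_)
  -- Only this particular diagram is known to have limits at each object. That is enough for its
  -- limit to exist in the functor category and to be preserved by evaluation.
  · have : ∀ j, HasLimit (F.flip.obj j) := h
    exact ⟨_, fun j => ⟨isLimitOfPreserves ((evaluation J C).obj j) (limit.isLimit F)⟩⟩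
  · have : ∀ j, HasColimit (F.flip.obj j) := h
    exact ⟨_, fun j => ⟨isColimitOfPreserves ((evaluation J C).obj j) (colimit.isColimit F)⟩⟩

instance complexIsExactCategory {ι : Type} (c : ComplexShape ι) :
    IsExactCategory (HomologicalComplex C c) := by
  have : HasFiniteProducts (HomologicalComplex C c) := ⟨fun _ => inferInstance⟩
  have : HasFiniteBiproducts (HomologicalComplex C c) := HasFiniteBiproducts.of_hasFiniteProducts
  refine isExactCategory_of_pointwise (fun j => HomologicalComplex.eval C c j)
    (fun f g _ => isConflation_complex_iff f g)
    (fun F c h => ⟨HomologicalComplex.isLimitOfEval F c fun j => (h j).some⟩)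
    (fun F c h => ⟨HomologicalComplex.isColimitOfEval F c fun j => (h j).some⟩)
    (fun F h => ?_) (fun F h => ?_)
  · exact ⟨_, fun j => ⟨isLimitOfPreserves (HomologicalComplex.eval C c j) (limit.isLimit F)⟩⟩
  · exact ⟨_, fun j => ⟨isColimitOfPreserves (HomologicalComplex.eval C c j)
      (colimit.isColimit F)⟩⟩

end

end PowerOps
end

noncomputable section

namespace PowerOps

open AdmSeq

/-! ### Exact subcategories -/

section Subcategory

variable {C : Type u} [Category.{v} C] [Preadditive C] [Conflations C]

theorem isConflation_fullSubcategory_iff {P : ObjectProperty C} {X Y Z : P.FullSubcategory}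
    (f : X ⟶ Y) (g : Y ⟶ Z) : IsConflation f g ↔ IsConflation f.hom g.hom :=
  ⟨fun ⟨w, h⟩ => ⟨congr_arg InducedCategory.Hom.hom w, h⟩,
    fun ⟨w, h⟩ => ⟨ObjectProperty.hom_ext _ w, h⟩⟩

variable [IsExactCategory C]

/-- A pushout has the same cokernel as the original map. Thus the pushout object is an extension of
`Z` by `X'`, which is what places it in an extension-closed subcategory. -/
theorem IsConflation.exists_of_isPushout {X Y Z X' Y' : C} {i : X ⟶ Y} {g : Y ⟶ Z}
    {f : X ⟶ X'} {f' : Y ⟶ Y'} {i' : X' ⟶ Y'} (hg : IsConflation i g) (h : IsPushout i f f' i') :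
    ∃ g' : Y' ⟶ Z, IsConflation i' g' ∧ f' ≫ g' = g := by
  have w : i ≫ g = f ≫ 0 := by rw [hg.zero, comp_zero]
  have := hg.epi
  have aux : ∀ {W : C} (t : Y' ⟶ W), i' ≫ t = 0 → ∃ s, g ≫ s = f' ≫ t := fun t ht =>
    hg.exists_desc _ (by rw [h.w_assoc, ht, comp_zero])
  refine ⟨h.desc g 0 w, (isInflation_of_isPushout h ⟨_, _, hg⟩).isConflation (h.inr_desc _ _ _)
    (CokernelCofork.IsColimit.ofπ _ _ (fun t ht => (aux t ht).choose) (fun t ht => ?_)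
      (fun t ht m hm => ?_)), h.inl_desc _ _ _⟩
  · apply h.hom_ext
    · rw [h.inl_desc_assoc, (aux t ht).choose_spec]
    · rw [h.inr_desc_assoc, ht, zero_comp]
  · rw [← cancel_epi g, (aux t ht).choose_spec, ← hm, h.inl_desc_assoc]

theorem IsConflation.exists_of_isPullback {X Y Z Y' Z' : C} {i : X ⟶ Y} {p : Y ⟶ Z}
    {f' : Y' ⟶ Y} {p' : Y' ⟶ Z'} {f : Z' ⟶ Z} (hi : IsConflation i p) (h : IsPullback f' p' p f) :
    ∃ i' : X ⟶ Y', IsConflation i' p' ∧ i' ≫ f' = i := by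
  have w : i ≫ p = 0 ≫ f := by rw [hi.zero, zero_comp]
  have := hi.mono
  have aux : ∀ {W : C} (t : W ⟶ Y'), t ≫ p' = 0 → ∃ s, s ≫ i = t ≫ f' := fun t ht =>
    hi.exists_lift _ (by rw [Category.assoc, h.w, reassoc_of% ht, zero_comp])
  refine ⟨h.lift i 0 w, (isDeflation_of_isPullback h ⟨_, _, hi⟩).isConflation (h.lift_snd _ _ _)
    (KernelFork.IsLimit.ofι _ _ (fun t ht => (aux t ht).choose) (fun t ht => ?_)
      (fun t ht m hm => ?_)), h.lift_fst _ _ _⟩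
  · apply h.hom_ext
    · rw [Category.assoc, h.lift_fst, (aux t ht).choose_spec]
    · rw [Category.assoc, h.lift_snd, ht, comp_zero]
  · rw [← cancel_mono i, (aux t ht).choose_spec, ← hm, Category.assoc, h.lift_fst]

/-- A full subcategory which contains the zero objects, and contains the middle term of a
conflation if and only if it contains the outer terms, is exact. -/
theorem isExactCategory_fullSubcategory (P : ObjectProperty C)
    (hzero : ∀ X : C, IsZero X → P X)
    (hP : ∀ {X Y Z : C} (f : X ⟶ Y) (g : Y ⟶ Z), IsConflation f g → (P Y ↔ P X ∧ P Z)) :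
    IsExactCategory P.FullSubcategory := by
  have hinfl : ∀ {X Y : P.FullSubcategory} (f : X ⟶ Y), IsInflation f.hom → IsInflation f := by
    rintro X Y f ⟨Z, g, h⟩
    exact ⟨⟨Z, ((hP _ _ h).1 Y.property).2⟩, ObjectProperty.homMk g,
      (isConflation_fullSubcategory_iff _ _).2 h⟩
  have hinfl' : ∀ {X Y : P.FullSubcategory} (f : X ⟶ Y), IsInflation f → IsInflation f.hom := by
    rintro X Y f ⟨Z, g, h⟩
    exact ⟨_, _, (isConflation_fullSubcategory_iff _ _).1 h⟩
  have hdefl : ∀ {Y Z : P.FullSubcategory} (f : Y ⟶ Z), IsDeflation f.hom → IsDeflation f := by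
    rintro X Y f ⟨Z, g, h⟩
    exact ⟨⟨Z, ((hP _ _ h).1 X.property).1⟩, ObjectProperty.homMk g,
      (isConflation_fullSubcategory_iff _ _).2 h⟩
  have hdefl' : ∀ {X Y : P.FullSubcategory} (f : X ⟶ Y), IsDeflation f → IsDeflation f.hom := by
    rintro X Y f ⟨Z, g, h⟩
    exact ⟨_, _, (isConflation_fullSubcategory_iff _ _).1 h⟩
  have : P.ContainsZero := ⟨⟨_, isZero_zero C, hzero _ (isZero_zero C)⟩⟩
  have : HasBinaryBiproducts P.FullSubcategory := ⟨fun X Y => by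
    have h : P (X.obj ⊞ Y.obj) :=
      (hP _ _ (isConflation_biprod X.obj Y.obj)).2 ⟨X.property, Y.property⟩
    refine hasBinaryBiproduct_of_total
      { pt := ⟨X.obj ⊞ Y.obj, h⟩
        fst := ObjectProperty.homMk biprod.fst
        snd := ObjectProperty.homMk biprod.snd
        inl := ObjectProperty.homMk biprod.inl
        inr := ObjectProperty.homMk biprod.inr
        inl_fst := ObjectProperty.hom_ext _ biprod.inl_fst
        inl_snd := ObjectProperty.hom_ext _ biprod.inl_snd
        inr_fst := ObjectProperty.hom_ext _ biprod.inr_fst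
        inr_snd := ObjectProperty.hom_ext _ biprod.inr_snd } ?_
    exact ObjectProperty.hom_ext _ biprod.total⟩
  have : HasFiniteProducts P.FullSubcategory := hasFiniteProducts_of_has_binary_and_terminal
  have : HasFiniteBiproducts P.FullSubcategory := HasFiniteBiproducts.of_hasFiniteProducts
  refine
    { of_iso := ?_
      isKernel := ?_
      isCokernel := ?_
      id_inflation := fun X => hinfl _ (IsExactCategory.id_inflation X.obj)
      id_deflation := fun X => hdefl _ (IsExactCategory.id_deflation X.obj)
      comp_inflation := fun f g hf hg => hinfl _
        (IsExactCategory.comp_inflation _ _ (hinfl' f hf) (hinfl' g hg))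
      comp_deflation := fun f g hf hg => hdefl _
        (IsExactCategory.comp_deflation _ _ (hdefl' f hf) (hdefl' g hg))
      pushout_inflation := ?_
      pullback_deflation := ?_ }
  · rintro S T ⟨e⟩ hS
    have h := (isConflation_fullSubcategory_iff S.f S.g).1 ⟨S.zero, hS⟩
    exact ((isConflation_fullSubcategory_iff T.f T.g).2
      (h.of_iso (P.ι.mapIso (ShortComplex.π₁.mapIso e)) (P.ι.mapIso (ShortComplex.π₂.mapIso e))
      (P.ι.mapIso (ShortComplex.π₃.mapIso e))
      (congr_arg InducedCategory.Hom.hom e.hom.comm₁₂.symm)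
      (congr_arg InducedCategory.Hom.hom e.hom.comm₂₃.symm))).2
  · intro S hS
    have h := (isConflation_fullSubcategory_iff S.f S.g).1 ⟨S.zero, hS⟩
    have := h.mono
    have hl : ∀ {W : P.FullSubcategory} (t : W ⟶ S.X₂), t ≫ S.g = 0 → ∃ s, s ≫ S.f = t :=
      fun t ht => by
        obtain ⟨s, hs⟩ := h.exists_lift t.hom (congr_arg InducedCategory.Hom.hom ht)
        exact ⟨ObjectProperty.homMk s, ObjectProperty.hom_ext _ hs⟩
    refine ⟨KernelFork.IsLimit.ofι _ _ (fun t ht => (hl t ht).choose)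
      (fun t ht => (hl t ht).choose_spec) (fun t ht m hm => ?_)⟩
    apply ObjectProperty.hom_ext
    rw [← cancel_mono S.f.hom]
    exact congr_arg InducedCategory.Hom.hom (hm.trans (hl t ht).choose_spec.symm)
  · intro S hS
    have h := (isConflation_fullSubcategory_iff S.f S.g).1 ⟨S.zero, hS⟩
    have := h.epi
    have hl : ∀ {W : P.FullSubcategory} (t : S.X₂ ⟶ W), S.f ≫ t = 0 → ∃ s, S.g ≫ s = t :=
      fun t ht => by
        obtain ⟨s, hs⟩ := h.exists_desc t.hom (congr_arg InducedCategory.Hom.hom ht)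
        exact ⟨ObjectProperty.homMk s, ObjectProperty.hom_ext _ hs⟩
    refine ⟨CokernelCofork.IsColimit.ofπ _ _ (fun t ht => (hl t ht).choose)
      (fun t ht => (hl t ht).choose_spec) (fun t ht m hm => ?_)⟩
    apply ObjectProperty.hom_ext
    rw [← cancel_epi S.g.hom]
    exact congr_arg InducedCategory.Hom.hom (hm.trans (hl t ht).choose_spec.symm)
  · intro X Y X' i f hi
    obtain ⟨Y', f', i', h, hi'⟩ :=
      IsExactCategory.pushout_inflation i.hom f.hom (hinfl' i hi)
    obtain ⟨Z, g, hg⟩ := hi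
    obtain ⟨g', hg', -⟩ := ((isConflation_fullSubcategory_iff i g).1 hg).exists_of_isPushout h
    -- The pushout taken in `C` is the middle term of a conflation with outer terms `X'` and `Z`, so
    -- it belongs to the subcategory.
    let Y'' : P.FullSubcategory := ⟨Y', (hP _ _ hg').2 ⟨X'.property, Z.property⟩⟩
    exact ⟨Y'', ObjectProperty.homMk f', ObjectProperty.homMk i',
      IsPushout.of_map_of_faithful (F := P.ι) h, hinfl (Y := Y'') _ hi'⟩
  · intro Y Z Z' p f hp
    obtain ⟨Y', f', p', h, hp'⟩ :=
      IsExactCategory.pullback_deflation p.hom f.hom (hdefl' p hp)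
    obtain ⟨X, i, hi⟩ := hp
    obtain ⟨i', hi', -⟩ := ((isConflation_fullSubcategory_iff i p).1 hi).exists_of_isPullback h
    let Y'' : P.FullSubcategory := ⟨Y', (hP _ _ hi').2 ⟨X.property, Z'.property⟩⟩
    exact ⟨Y'', ObjectProperty.homMk f', ObjectProperty.homMk p',
      IsPullback.of_map_of_faithful (F := P.ι) h, hdefl (Y := Y'') _ hp'⟩

theorem isExactCategory_bounded : IsExactCategory (bounded C).FullSubcategory := by
  refine isExactCategory_fullSubcategory _ (fun X hX => ⟨0, fun i _ =>
    (HomologicalComplex.eval C _ i).map_isZero hX⟩) (fun {X Y Z} f g h => ?_)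
  rw [isConflation_complex_iff] at h
  constructor
  · rintro ⟨N, hN⟩
    refine ⟨⟨N, fun i hi => ?_⟩, ⟨N, fun i hi => ?_⟩⟩
    · have := (h i).mono
      exact (hN i hi).of_mono (f.f i)
    · have := (h i).epi
      exact (hN i hi).of_epi (g.f i)
  · rintro ⟨⟨N, hN⟩, ⟨N', hN'⟩⟩
    refine ⟨max N N', fun i hi => ?_⟩
    rw [IsZero.iff_id_eq_zero]
    -- Above `N'` the quotient is zero, so the identity of `Y_i` factors through `X_i`, which is
    -- zero above `N`.
    obtain ⟨s, hs⟩ := (h i).exists_lift (𝟙 (Y.X i)) ((hN' i (by omega)).eq_of_tgt _ _)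
    rw [← hs, (hN i (by omega)).eq_of_src (f.f i) 0, comp_zero]

end Subcategory

end PowerOps
end

noncomputable section

namespace PowerOps

open AdmSeq Opposite Simplicial

/-! ### The functor `Γ` -/

section Gamma

variable {C : Type u} [Category.{v} C] [Preadditive C] [Conflations C] [IsExactCategory C]
  [IsIdempotentComplete C]

/-- The summands of `Γ K`. -/
def gammaι (K : ChainComplex C ℕ) {Δ : SimplexCategoryᵒᵖ}
    (A : SimplicialObject.Splitting.IndexSet Δ) :
    K.X A.1.unop.len ⟶ ((doldKan C).functor.obj K).obj Δ :=
  ((AlgebraicTopology.DoldKan.Γ₀.splitting K).cofan Δ).inj A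

/-- Morphisms out of `Γ K` are defined on the summands. -/
def gammaDesc (K : ChainComplex C ℕ) {Δ : SimplexCategoryᵒᵖ} {Z : C}
    (F : ∀ A : SimplicialObject.Splitting.IndexSet Δ, K.X A.1.unop.len ⟶ Z) :
    ((doldKan C).functor.obj K).obj Δ ⟶ Z :=
  (AlgebraicTopology.DoldKan.Γ₀.splitting K).desc Δ F

theorem gammaι_desc (K : ChainComplex C ℕ) {Δ : SimplexCategoryᵒᵖ} {Z : C}
    (F : ∀ A : SimplicialObject.Splitting.IndexSet Δ, K.X A.1.unop.len ⟶ Z)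
    (A : SimplicialObject.Splitting.IndexSet Δ) : gammaι K A ≫ gammaDesc K F = F A :=
  (AlgebraicTopology.DoldKan.Γ₀.splitting K).ι_desc Δ F A

theorem gamma_hom_ext (K : ChainComplex C ℕ) {Δ : SimplexCategoryᵒᵖ} {Z : C}
    {f g : ((doldKan C).functor.obj K).obj Δ ⟶ Z}
    (h : ∀ A : SimplicialObject.Splitting.IndexSet Δ, gammaι K A ≫ f = gammaι K A ≫ g) : f = g :=
  (AlgebraicTopology.DoldKan.Γ₀.splitting K).hom_ext' f g h

theorem gammaι_naturality {K L : ChainComplex C ℕ} (f : K ⟶ L) {Δ : SimplexCategoryᵒᵖ}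
    (A : SimplicialObject.Splitting.IndexSet Δ) :
    gammaι K A ≫ ((doldKan C).functor.map f).app Δ = f.f A.1.unop.len ≫ gammaι L A :=
  (AlgebraicTopology.DoldKan.Γ₀.splitting K).ι_desc Δ _ A

/-- The projection of `(Γ K)_n` to the summand `K_n`. -/
def gammaπ (K : ChainComplex C ℕ) (n : ℕ) : ((doldKan C).functor.obj K).obj (op ⦋n⦌) ⟶ K.X n :=
  (AlgebraicTopology.DoldKan.Γ₀.splitting K).πSummand
    (SimplicialObject.Splitting.IndexSet.id (op ⦋n⦌))

theorem gammaι_π_self (K : ChainComplex C ℕ) (n : ℕ) :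
    gammaι K (SimplicialObject.Splitting.IndexSet.id (op ⦋n⦌)) ≫ gammaπ K n = 𝟙 (K.X n) :=
  (AlgebraicTopology.DoldKan.Γ₀.splitting K).cofan_inj_πSummand_eq_id _

theorem gammaι_π_of_ne (K : ChainComplex C ℕ) (n : ℕ)
    (A : SimplicialObject.Splitting.IndexSet (op ⦋n⦌))
    (hA : SimplicialObject.Splitting.IndexSet.id (op ⦋n⦌) ≠ A) :
    gammaι K A ≫ gammaπ K n = 0 :=
  (AlgebraicTopology.DoldKan.Γ₀.splitting K).cofan_inj_πSummand_eq_zero _ _ hA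

/-- Degeneracies land in the summands indexed by surjections other than the identity. -/
theorem σ_gammaπ (K : ChainComplex C ℕ) (n : ℕ) (i : Fin (n + 1)) :
    ((doldKan C).functor.obj K).map (SimplexCategory.σ i).op ≫ gammaπ K (n + 1) = 0 :=
  (AlgebraicTopology.DoldKan.Γ₀.splitting K).σ_comp_πSummand_id_eq_zero i

theorem gammaπ_naturality {K L : ChainComplex C ℕ} (f : K ⟶ L) (n : ℕ) :
    ((doldKan C).functor.map f).app (op ⦋n⦌) ≫ gammaπ L n = gammaπ K n ≫ f.f n := by
  refine gamma_hom_ext K fun A => ?_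
  rw [← Category.assoc, gammaι_naturality, Category.assoc]
  by_cases hA : SimplicialObject.Splitting.IndexSet.id (op ⦋n⦌) = A
  · subst hA
    refine (congr_arg (f.f n ≫ ·) (gammaι_π_self L n)).trans (Eq.trans ?_
      ((Category.assoc _ _ _).symm.trans (congr_arg (· ≫ f.f n) (gammaι_π_self K n))).symm)
    exact (Category.comp_id _).trans (Category.id_comp _).symm
  · rw [gammaι_π_of_ne L n A hA, ← Category.assoc, gammaι_π_of_ne K n A hA, comp_zero, zero_comp]

/-- The functor `Γ` reflects conflations. -/
theorem isConflation_of_doldKan {K L N : ChainComplex C ℕ} (f : K ⟶ L) (g : L ⟶ N)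
    (h : IsConflation ((doldKan C).functor.map f) ((doldKan C).functor.map g)) :
    IsConflation f g := by
  rw [isConflation_complex_iff]
  intro n
  -- The summand indexed by the identity of `[n]` is a natural retract of level `n` of `Γ`, so
  -- degree `n` of the sequence is a retract of a conflation.
  exact (((isConflation_functor_iff _ _).1 h) (op ⦋n⦌)).of_retract
    (gammaι K (SimplicialObject.Splitting.IndexSet.id (op ⦋n⦌)))
    (gammaι L (SimplicialObject.Splitting.IndexSet.id (op ⦋n⦌)))
    (gammaι N (SimplicialObject.Splitting.IndexSet.id (op ⦋n⦌)))
    (gammaπ K n) (gammaπ L n) (gammaπ N n)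
    (gammaι_π_self K n) (gammaι_π_self L n) (gammaι_π_self N n)
    (gammaι_naturality f (SimplicialObject.Splitting.IndexSet.id (op ⦋n⦌))).symm
    (gammaι_naturality g (SimplicialObject.Splitting.IndexSet.id (op ⦋n⦌))).symm
    (gammaπ_naturality f n) (gammaπ_naturality g n)

instance doldKan_additive : (doldKan C).functor.Additive where
  map_add {K L f g} := by
    ext Δ
    refine gamma_hom_ext K fun A => ?_
    rw [NatTrans.app_add, Preadditive.comp_add, gammaι_naturality, gammaι_naturality,
      gammaι_naturality, HomologicalComplex.add_f_apply, Preadditive.add_comp]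

/-- The normalized complex of `Y` vanishes in degree `n + 1` if `Y_{n+1}` has no non-zero quotient
which kills the degeneracies. -/
theorem isZero_doldKan_inverse {Y : SimplexCategoryᵒᵖ ⥤ C} {n : ℕ}
    (h : ∀ {Z : C} (p : Y.obj (op ⦋n + 1⦌) ⟶ Z),
      (∀ i : Fin (n + 1), Y.map (SimplexCategory.σ i).op ≫ p = 0) → p = 0) :
    IsZero (((doldKan C).inverse.obj Y).X (n + 1)) := by
  let K := (doldKan C).inverse.obj Y
  let c : (doldKan C).functor.obj K ≅ Y := (doldKan C).counitIso.app Y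
  -- The projection of `(Γ K)_{n+1}` to `K_{n+1}` kills degeneracies. Carried over to `Y_{n+1}` it
  -- must vanish by hypothesis. Being a split epimorphism, it can vanish only if `K_{n+1}` is zero.
  have hc : c.inv.app (op ⦋n + 1⦌) ≫ gammaπ K (n + 1) = 0 := by
    refine h _ fun i => ?_
    rw [← Category.assoc, c.inv.naturality, Category.assoc, σ_gammaπ, comp_zero]
  have hπ : gammaπ K (n + 1) = 0 := by
    rw [← Category.id_comp (gammaπ K (n + 1)), ← NatTrans.id_app, ← c.hom_inv_id,
      NatTrans.comp_app, Category.assoc, hc, comp_zero]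
  rw [IsZero.iff_id_eq_zero]
  exact (gammaι_π_self K (n + 1)).symm.trans ((congr_arg _ hπ).trans comp_zero)

end Gamma

end PowerOps
end

noncomputable section

namespace PowerOps

open AdmSeq

/-! ### Comparison of power operations along functors -/

section Comparison

variable {A : ℕ → Type u} [∀ n, Category.{v} (A n)] [∀ n, Preadditive (A n)]
  [∀ n, Conflations (A n)]
  {B : ℕ → Type u'} [∀ n, Category.{v'} (B n)] [∀ n, Preadditive (B n)]
  [∀ n, Conflations (B n)]

/-- Functors between two families of categories with power operations which are compatible, up to
specified isomorphisms, with all the data. -/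
structure Comparison (DA : PowerData A) (DB : PowerData B) where
  /-- the functors -/
  F : ∀ n, A n ⥤ B n
  preserves : ∀ n, PreservesConflations (F n)
  /-- compatibility with tensor products -/
  μ : ∀ {n p m : ℕ} (h : n + p = m) (X : A n) (Y : A p),
    (F m).obj (DA.tObj h X Y) ≅ DB.tObj h ((F n).obj X) ((F p).obj Y)
  /-- compatibility with power operations -/
  ω : ∀ {k n m : ℕ} (hk : 1 ≤ k) (h : n * k = m) (V : AdmSeq k (A n)),
    (F m).obj ((DA.wedge hk h).obj V) ≅ (DB.wedge hk h).obj ((mapSeq k (F n) (preserves n)).obj V)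
  μ_natural : ∀ {n p m : ℕ} (h : n + p = m) {X X' : A n} {Y Y' : A p} (f : X ⟶ X') (g : Y ⟶ Y'),
    (F m).map (DA.tMap h f g) ≫ (μ h X' Y').hom =
      (μ h X Y).hom ≫ DB.tMap h ((F n).map f) ((F p).map g)
  ω_natural : ∀ {k n m : ℕ} (hk : 1 ≤ k) (h : n * k = m) {V V' : AdmSeq k (A n)} (f : V ⟶ V'),
    (F m).map ((DA.wedge hk h).map f) ≫ (ω hk h V').hom =
      (ω hk h V).hom ≫ (DB.wedge hk h).map ((mapSeq k (F n) (preserves n)).map f)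
  assoc : ∀ {n p q np pq m : ℕ} (h₁ : n + p = np) (h₂ : np + q = m) (h₃ : p + q = pq)
    (h₄ : n + pq = m) (X : A n) (Y : A p) (Z : A q),
    (F m).map (DA.assoc h₁ h₂ h₃ h₄ X Y Z).hom ≫ (μ h₄ X (DA.tObj h₃ Y Z)).hom ≫
        DB.tMap h₄ (𝟙 _) (μ h₃ Y Z).hom =
      (μ h₂ (DA.tObj h₁ X Y) Z).hom ≫ DB.tMap h₂ (μ h₁ X Y).hom (𝟙 _) ≫
        (DB.assoc h₁ h₂ h₃ h₄ ((F n).obj X) ((F p).obj Y) ((F q).obj Z)).hom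
  wedgeOne : ∀ {n : ℕ} (hn : n * 1 = n) (V : AdmSeq 1 (A n)),
    (F n).map (DA.wedgeOne hn V).hom =
      (ω le_rfl hn V).hom ≫ (DB.wedgeOne hn ((mapSeq 1 (F n) (preserves n)).obj V)).hom
  mul : ∀ {n a b k na nb nk : ℕ} (ha : 1 ≤ a) (hb : 1 ≤ b) (hk : a + b = k) (hna : n * a = na)
    (hnb : n * b = nb) (hnk : n * k = nk) (V : AdmSeq k (A n)),
    (F nk).map (DA.mul ha hb hk hna hnb hnk V) ≫ (ω (one_le_total hk ha) hnk V).hom =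
      (μ (add_index hk hna hnb hnk) _ _).hom ≫
        DB.tMap (add_index hk hna hnb hnk) (ω ha hna _).hom (ω hb hnb _).hom ≫
        DB.mul ha hb hk hna hnb hnk ((mapSeq k (F n) (preserves n)).obj V)
  comul : ∀ {n a b k na nb nk : ℕ} (ha : 1 ≤ a) (hb : 1 ≤ b) (hk : a + b = k) (hna : n * a = na)
    (hnb : n * b = nb) (hnk : n * k = nk) (V : AdmSeq k (A n)) (Q : QuotientSeq hk V),
    (F nk).map (DA.comul ha hb hk hna hnb hnk V Q) ≫ (μ (add_index hk hna hnb hnk) _ _).hom ≫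
        DB.tMap (add_index hk hna hnb hnk) (ω ha hna _).hom (ω hb hnb _).hom =
      (ω (one_le_total hk ha) hnk V).hom ≫
        DB.comul ha hb hk hna hnb hnk ((mapSeq k (F n) (preserves n)).obj V)
          (Q.map (F n) (preserves n))

/-- Needed for `mul_comul_right`. A functor applied to `Q.ofTail`, and `ofTail` applied to the image
of `Q`, have the same underlying sequence, but their quotient maps agree only after rewriting the
image of a composite. -/
theorem PowerData.comul_congr (D : PowerData B) {n a b k na nb nk : ℕ} (ha : 1 ≤ a) (hb : 1 ≤ b)
    (hk : a + b = k) (hna : n * a = na) (hnb : n * b = nb) (hnk : n * k = nk) {V : AdmSeq k (B n)}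
    (Q : QuotientSeq hk V) (π : (tail hk).obj V ⟶ Q.seq) (h : π = Q.π) :
    D.comul ha hb hk hna hnb hnk V ⟨Q.seq, π, by subst h; exact Q.conf⟩ =
      D.comul ha hb hk hna hnb hnk V Q := by
  subst h
  rfl

theorem PowerFunctors.tMap_id_left (D : PowerFunctors B) {n p m : ℕ}
    (h : n + p = m) {X : B n} {Y Y' : B p} (g : Y ⟶ Y') :
    D.tMap h (𝟙 X) g = ((D.tensor h).obj X).map g := by
  dsimp only [PowerFunctors.tMap]
  simp

theorem PowerFunctors.tMap_id_right (D : PowerFunctors B) {n p m : ℕ}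
    (h : n + p = m) {X X' : B n} {Y : B p} (f : X ⟶ X') :
    D.tMap h f (𝟙 Y) = ((D.tensor h).map f).app Y := by
  dsimp only [PowerFunctors.tMap]
  simp

/-- The tensor product of isomorphisms. -/
def PowerFunctors.tIso (D : PowerFunctors B) {n p m : ℕ} (h : n + p = m) {X X' : B n} {Y Y' : B p}
    (f : X ≅ X') (g : Y ≅ Y') : D.tObj h X Y ≅ D.tObj h X' Y' where
  hom := D.tMap h f.hom g.hom
  inv := D.tMap h f.inv g.inv
  hom_inv_id := by rw [← D.tMap_comp, f.hom_inv_id, g.hom_inv_id, D.tMap_id]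
  inv_hom_id := by rw [← D.tMap_comp, f.inv_hom_id, g.inv_hom_id, D.tMap_id]

namespace Comparison

variable {DA : PowerData A} {DB : PowerData B} (c : Comparison DA DB)

/-- The induced functor on sequences. -/
abbrev S (k n : ℕ) : AdmSeq k (A n) ⥤ AdmSeq k (B n) := mapSeq k (c.F n) (c.preserves n)

theorem map_tMap {n p m : ℕ} (h : n + p = m) {X X' : A n} {Y Y' : A p} (f : X ⟶ X') (g : Y ⟶ Y') :
    (c.F m).map (DA.tMap h f g) =
      (c.μ h X Y).hom ≫ DB.tMap h ((c.F n).map f) ((c.F p).map g) ≫ (c.μ h X' Y').inv := by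
  rw [← Category.assoc, Iso.eq_comp_inv, c.μ_natural]

/-- `f` corresponds to `f'` under the isomorphisms `i` and `j`. -/
def Sq {m : ℕ} {X Y : A m} {X' Y' : B m} (i : (c.F m).obj X ≅ X') (f : X ⟶ Y)
    (j : (c.F m).obj Y ≅ Y') (f' : X' ⟶ Y') : Prop :=
  (c.F m).map f ≫ j.hom = i.hom ≫ f'

/-- The isomorphism `F (X ⊗ Y) ≅ X' ⊗ Y'` induced by `F X ≅ X'` and `F Y ≅ Y'`. -/
def t {n p m : ℕ} (h : n + p = m) {X : A n} {Y : A p} {X' : B n} {Y' : B p}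
    (i : (c.F n).obj X ≅ X') (j : (c.F p).obj Y ≅ Y') :
    (c.F m).obj (DA.tObj h X Y) ≅ DB.tObj h X' Y' :=
  c.μ h X Y ≪≫ DB.tIso h i j

theorem t_hom {n p m : ℕ} (h : n + p = m) {X : A n} {Y : A p} {X' : B n} {Y' : B p}
    (i : (c.F n).obj X ≅ X') (j : (c.F p).obj Y ≅ Y') :
    (c.t h i j).hom = (c.μ h X Y).hom ≫ DB.tMap h i.hom j.hom := rfl

variable {c}

namespace Sq

/-- This reduces an axiom for `DA` to the same axiom for `DB`. Each side is assembled from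
`Sq`-squares with the same outer isomorphisms `i` and `j`, so no coherence isomorphism remains to be
cancelled by hand. -/
theorem map_eq {m : ℕ} {X Y : A m} {X' Y' : B m} {i : (c.F m).obj X ≅ X'} {f g : X ⟶ Y}
    {j : (c.F m).obj Y ≅ Y'} {f' g' : X' ⟶ Y'} (h : c.Sq i f j f') (h' : c.Sq i g j g')
    (e : f' = g') : (c.F m).map f = (c.F m).map g := by
  subst e
  rw [← cancel_mono j.hom]
  exact h.trans h'.symm

theorem isConflation [∀ n, IsExactCategory (B n)] {m : ℕ} {X Y Z : A m} {X' Y' Z' : B m}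
    {i : (c.F m).obj X ≅ X'} {f : X ⟶ Y} {j : (c.F m).obj Y ≅ Y'} {f' : X' ⟶ Y'} {g : Y ⟶ Z}
    {l : (c.F m).obj Z ≅ Z'} {g' : Y' ⟶ Z'} (h : c.Sq i f j f') (h' : c.Sq j g l g')
    (e : IsConflation f' g') : IsConflation ((c.F m).map f) ((c.F m).map g) :=
  e.of_iso i.symm j.symm l.symm
    (by rw [Iso.symm_hom, Iso.symm_hom, Iso.comp_inv_eq, Category.assoc, h, Iso.inv_hom_id_assoc])
    (by rw [Iso.symm_hom, Iso.symm_hom, Iso.comp_inv_eq, Category.assoc, h', Iso.inv_hom_id_assoc])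

theorem of_map {m : ℕ} {X Y : A m} (f : X ⟶ Y) :
    c.Sq (Iso.refl ((c.F m).obj X)) f (Iso.refl ((c.F m).obj Y)) ((c.F m).map f) :=
  (Category.comp_id _).trans (Category.id_comp _).symm

theorem comp {m : ℕ} {X Y Z : A m} {X' Y' Z' : B m} {i : (c.F m).obj X ≅ X'} {f : X ⟶ Y}
    {j : (c.F m).obj Y ≅ Y'} {f' : X' ⟶ Y'} {g : Y ⟶ Z} {l : (c.F m).obj Z ≅ Z'} {g' : Y' ⟶ Z'}
    (h : c.Sq i f j f') (h' : c.Sq j g l g') : c.Sq i (f ≫ g) l (f' ≫ g') := by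
  dsimp only [Sq] at *
  rw [Functor.map_comp, Category.assoc, h', reassoc_of% h]

theorem id {m : ℕ} {X : A m} {X' : B m} (i : (c.F m).obj X ≅ X') : c.Sq i (𝟙 X) i (𝟙 X') := by
  dsimp only [Sq]
  rw [CategoryTheory.Functor.map_id, Category.id_comp, Category.comp_id]

theorem inv {m : ℕ} {X Y : A m} {X' Y' : B m} {i : (c.F m).obj X ≅ X'} {e : X ≅ Y}
    {j : (c.F m).obj Y ≅ Y'} {e' : X' ≅ Y'} (h : c.Sq i e.hom j e'.hom) :
    c.Sq j e.inv i e'.inv := by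
  dsimp only [Sq] at *
  rw [← cancel_epi ((c.F m).map e.hom), ← Category.assoc, ← Functor.map_comp, e.hom_inv_id,
    CategoryTheory.Functor.map_id, Category.id_comp, reassoc_of% h, e'.hom_inv_id,
    Category.comp_id]

theorem tMap {n p m : ℕ} (h : n + p = m) {X Y : A n} {X' Y' : B n} {Z W : A p} {Z' W' : B p}
    {i : (c.F n).obj X ≅ X'} {f : X ⟶ Y} {j : (c.F n).obj Y ≅ Y'} {f' : X' ⟶ Y'}
    {k : (c.F p).obj Z ≅ Z'} {g : Z ⟶ W} {l : (c.F p).obj W ≅ W'} {g' : Z' ⟶ W'}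
    (hf : c.Sq i f j f') (hg : c.Sq k g l g') :
    c.Sq (c.t h i k) (DA.tMap h f g) (c.t h j l) (DB.tMap h f' g') := by
  dsimp only [Sq] at *
  rw [t_hom, t_hom, ← Category.assoc, c.μ_natural, Category.assoc, Category.assoc, ← DB.tMap_comp,
    ← DB.tMap_comp, hf, hg]

/-- The structure only gives compatibility with `μ`. Naturality of the associativity isomorphisms in
`DB` is what allows arbitrary isomorphisms `i`, `j`, `k` on the three factors. -/
theorem assoc (hB : DB.IsAssembly) {n p q np pq m : ℕ} (h₁ : n + p = np) (h₂ : np + q = m)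
    (h₃ : p + q = pq) (h₄ : n + pq = m) {X : A n} {Y : A p} {Z : A q} {X' : B n} {Y' : B p}
    {Z' : B q} (i : (c.F n).obj X ≅ X') (j : (c.F p).obj Y ≅ Y') (k : (c.F q).obj Z ≅ Z') :
    c.Sq (c.t h₂ (c.t h₁ i j) k) (DA.assoc h₁ h₂ h₃ h₄ X Y Z).hom (c.t h₄ i (c.t h₃ j k))
      (DB.assoc h₁ h₂ h₃ h₄ X' Y' Z').hom := by
  have h := c.assoc h₁ h₂ h₃ h₄ X Y Z
  have h' := hB.assoc_natural h₁ h₂ h₃ h₄ i.hom j.hom k.hom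
  dsimp only [Sq]
  rw [t_hom, t_hom, t_hom, t_hom]
  have e₁ : DB.tMap h₄ i.hom ((c.μ h₃ Y Z).hom ≫ DB.tMap h₃ j.hom k.hom) =
      DB.tMap h₄ (𝟙 _) (c.μ h₃ Y Z).hom ≫ DB.tMap h₄ i.hom (DB.tMap h₃ j.hom k.hom) := by
    rw [← DB.tMap_comp, Category.id_comp]
  have e₂ : DB.tMap h₂ ((c.μ h₁ X Y).hom ≫ DB.tMap h₁ i.hom j.hom) k.hom =
      DB.tMap h₂ (c.μ h₁ X Y).hom (𝟙 _) ≫ DB.tMap h₂ (DB.tMap h₁ i.hom j.hom) k.hom := by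
    rw [← DB.tMap_comp, Category.id_comp]
  rw [e₁, e₂, reassoc_of% h, ← h']
  simp only [Category.assoc]

theorem wedge {k n m : ℕ} (hk : 1 ≤ k) (h : n * k = m) {V V' : AdmSeq k (A n)} (f : V ⟶ V') :
    c.Sq (c.ω hk h V) ((DA.wedge hk h).map f) (c.ω hk h V')
      ((DB.wedge hk h).map ((c.S k n).map f)) :=
  c.ω_natural hk h f

theorem wedgeOne {n : ℕ} (hn : n * 1 = n) (V : AdmSeq 1 (A n)) :
    c.Sq (c.ω le_rfl hn V) (DA.wedgeOne hn V).hom (Iso.refl ((c.F n).obj (V.obj.obj 0)))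
      (DB.wedgeOne hn ((c.S 1 n).obj V)).hom :=
  (Category.comp_id _).trans (c.wedgeOne hn V)

theorem mul {n a b k na nb nk : ℕ} (ha : 1 ≤ a) (hb : 1 ≤ b) (hk : a + b = k) (hna : n * a = na)
    (hnb : n * b = nb) (hnk : n * k = nk) (V : AdmSeq k (A n)) :
    c.Sq (c.t (add_index hk hna hnb hnk) (c.ω ha hna _) (c.ω hb hnb _))
      (DA.mul ha hb hk hna hnb hnk V) (c.ω (one_le_total hk ha) hnk V)
      (DB.mul ha hb hk hna hnb hnk ((c.S k n).obj V)) :=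
  (c.mul ha hb hk hna hnb hnk V).trans (Category.assoc _ _ _).symm

theorem comul {n a b k na nb nk : ℕ} (ha : 1 ≤ a) (hb : 1 ≤ b) (hk : a + b = k) (hna : n * a = na)
    (hnb : n * b = nb) (hnk : n * k = nk) (V : AdmSeq k (A n)) (Q : QuotientSeq hk V) :
    c.Sq (c.ω (one_le_total hk ha) hnk V) (DA.comul ha hb hk hna hnb hnk V Q)
      (c.t (add_index hk hna hnb hnk) (c.ω ha hna _) (c.ω hb hnb _))
      (DB.comul ha hb hk hna hnb hnk ((c.S k n).obj V) (Q.map (c.F n) (c.preserves n))) :=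
  c.comul ha hb hk hna hnb hnk V Q

end Sq

end Comparison

open Comparison in
/-- The axioms of an assembly may be checked after applying a family of comparisons which is
jointly faithful and jointly reflects conflations. -/
theorem PowerData.IsAssembly.of_comparison [∀ n, IsExactCategory (B n)] {DA : PowerData A}
    {DB : PowerData B} (hB : DB.IsAssembly) {S : Type w} (c : S → Comparison DA DB)
    (hadd : ∀ s n, ((c s).F n).Additive)
    (hfaith : ∀ {n : ℕ} {X Y : A n} (f g : X ⟶ Y),
      (∀ s, ((c s).F n).map f = ((c s).F n).map g) → f = g)
    (hrefl : ∀ {n : ℕ} {X Y Z : A n} (f : X ⟶ Y) (g : Y ⟶ Z),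
      (∀ s, IsConflation (((c s).F n).map f) (((c s).F n).map g)) → IsConflation f g) :
    DA.IsAssembly where
  tensor_left {n p m} h X :=
    -- After applying the faithful family, tensoring in `DA` becomes tensoring in `DB` conjugated by
    -- `μ`. The latter is additive.
    { additive := ⟨fun {Y Z f g} => hfaith _ _ fun s => by
        have h₁ := hadd s m
        have h₂ := hadd s p
        have h₃ := (hB.tensor_left h (((c s).F n).obj X)).additive
        rw [((c s).F m).map_add, ← DA.tMap_id_left, ← DA.tMap_id_left, ← DA.tMap_id_left,
          map_tMap, map_tMap, map_tMap, ← Preadditive.comp_add, ← Preadditive.add_comp]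
        simp only [CategoryTheory.Functor.map_id, DB.tMap_id_left, Functor.map_add]⟩
      preserves := fun f g hfg => hrefl _ _ fun s => by
        rw [← DA.tMap_id_left, ← DA.tMap_id_left]
        refine Sq.isConflation (Sq.tMap h (Sq.id (Iso.refl _)) (Sq.of_map f))
          (Sq.tMap h (Sq.id (Iso.refl _)) (Sq.of_map g)) ?_
        rw [DB.tMap_id_left, DB.tMap_id_left]
        exact (hB.tensor_left h _).preserves _ _ ((c s).preserves p _ _ hfg) }
  tensor_right {n p m} h Y :=
    { additive := ⟨fun {X Z f g} => hfaith _ _ fun s => by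
        have h₁ := hadd s m
        have h₂ := hadd s n
        have h₃ := (hB.tensor_right h (((c s).F p).obj Y)).additive
        dsimp only [Functor.flip_obj_map]
        rw [((c s).F m).map_add, ← DA.tMap_id_right, ← DA.tMap_id_right, ← DA.tMap_id_right,
          map_tMap, map_tMap, map_tMap, ← Preadditive.comp_add, ← Preadditive.add_comp]
        simp only [CategoryTheory.Functor.map_id, DB.tMap_id_right, ← Functor.flip_obj_map,
          Functor.map_add]⟩
      preserves := fun f g hfg => hrefl _ _ fun s => by
        dsimp only [Functor.flip_obj_map]
        rw [← DA.tMap_id_right, ← DA.tMap_id_right]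
        refine Sq.isConflation (Sq.tMap h (Sq.of_map f) (Sq.id (Iso.refl _)))
          (Sq.tMap h (Sq.of_map g) (Sq.id (Iso.refl _))) ?_
        rw [DB.tMap_id_right, DB.tMap_id_right]
        exact (hB.tensor_right h _).preserves _ _ ((c s).preserves n _ _ hfg) }
  -- From here on each equation gets one square for its left side, one for its right side, and then
  -- the same axiom of `DB` at the image data.
  assoc_natural h₁ h₂ h₃ h₄ _ _ _ _ _ _ f g h := hfaith _ _ fun s => Sq.map_eq
    (((Sq.tMap h₂ (Sq.tMap h₁ (Sq.of_map f) (Sq.of_map g)) (Sq.of_map h))).comp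
      (Sq.assoc hB h₁ h₂ h₃ h₄ _ _ _))
    ((Sq.assoc hB h₁ h₂ h₃ h₄ _ _ _).comp
      (Sq.tMap h₄ (Sq.of_map f) (Sq.tMap h₃ (Sq.of_map g) (Sq.of_map h))))
    (hB.assoc_natural h₁ h₂ h₃ h₄ _ _ _)
  pentagon hnp hpq hqr h₁ h₂ h₃ h₄ h₅ h₆ h₇ W X Y Z := hfaith _ _ fun s => Sq.map_eq
    ((Sq.tMap h₅ (Sq.assoc hB hnp h₁ hpq h₂ (Iso.refl _) (Iso.refl _) (Iso.refl _))
      (Sq.id (Iso.refl _))).comp ((Sq.assoc hB h₂ h₅ h₄ h₆ _ _ _).comp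
        (Sq.tMap h₆ (Sq.id _) (Sq.assoc hB hpq h₄ hqr h₃ _ _ _))))
    ((Sq.assoc hB h₁ h₅ hqr h₇ _ _ _).comp (Sq.assoc hB hnp h₇ h₃ h₆ _ _ _))
    (hB.pentagon hnp hpq hqr h₁ h₂ h₃ h₄ h₅ h₆ h₇ _ _ _ _)
  wedgeOne_natural hn _ _ f := hfaith _ _ fun s => Sq.map_eq
    ((Sq.wedge le_rfl hn f).comp (Sq.wedgeOne hn _))
    ((Sq.wedgeOne hn _).comp (Sq.of_map _))
    (hB.wedgeOne_natural hn (((c s).S 1 _).map f))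
  mul_natural ha hb hk hna hnb hnk _ _ f := hfaith _ _ fun s => Sq.map_eq
    ((Sq.tMap _ (Sq.wedge ha hna _) (Sq.wedge hb hnb _)).comp (Sq.mul ha hb hk hna hnb hnk _))
    ((Sq.mul ha hb hk hna hnb hnk _).comp (Sq.wedge _ hnk f))
    (hB.mul_natural ha hb hk hna hnb hnk (((c s).S _ _).map f))
  mul_assoc ha hb hc had hbc hd he hna hnb hnc hnd hne hnk V := hfaith _ _ fun s => Sq.map_eq
    ((Sq.tMap _ (Sq.mul ha hb had hna hnb hnd _) (Sq.id _)).comp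
      (Sq.mul _ hc hd hnd hnc hnk V))
    ((Sq.assoc hB _ _ _ _ _ _ _).comp ((Sq.tMap _ (Sq.id _)
      ((Sq.tMap _ (Sq.id _) (Sq.wedge hc hnc _)).comp (Sq.mul hb hc hbc hnb hnc hne _))).comp
        (Sq.mul ha _ he hna hne hnk V)))
    (hB.mul_assoc ha hb hc had hbc hd he hna hnb hnc hnd hne hnk (((c s).S _ _).obj V))
  comul_natural ha hb hk hna hnb hnk V V' f Q Q' g hg := hfaith _ _ fun s => Sq.map_eq
    ((Sq.comul ha hb hk hna hnb hnk V Q).comp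
      (Sq.tMap _ (Sq.wedge ha hna _) (Sq.wedge hb hnb g)))
    ((Sq.wedge _ hnk f).comp (Sq.comul ha hb hk hna hnb hnk V' Q'))
    (hB.comul_natural ha hb hk hna hnb hnk (((c s).S _ _).map f)
      (Q.map ((c s).F _) ((c s).preserves _)) (Q'.map ((c s).F _) ((c s).preserves _))
      (((c s).S _ _).map g) (by
        have := congr_arg ((c s).S _ _).map hg
        rw [Functor.map_comp, Functor.map_comp] at this
        exact this))
  comul_assoc ha hb hc had hbc hd he hna hnb hnc hnd hne hnk V Q₁ Q₂ Q₁₂ g hg :=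
    hfaith _ _ fun s => Sq.map_eq
    ((Sq.comul _ hc hd hnd hnc hnk V Q₂).comp
      ((Sq.tMap _ (Sq.comul ha hb had hna hnb hnd _ (Q₁.initial had hbc hd he)) (Sq.id _)).comp
        (Sq.assoc hB _ _ _ _ _ _ _)))
    ((Sq.comul ha _ he hna hne hnk V Q₁).comp (Sq.tMap _ (Sq.id _)
      ((Sq.comul hb hc hbc hnb hnc hne Q₁.seq Q₁₂).comp
        (Sq.tMap _ (Sq.id _) (Sq.wedge hc hnc g)))))
    (hB.comul_assoc ha hb hc had hbc hd he hna hnb hnc hnd hne hnk (((c s).S _ _).obj V)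
      (Q₁.map ((c s).F _) ((c s).preserves _)) (Q₂.map ((c s).F _) ((c s).preserves _))
      (Q₁₂.map ((c s).F _) ((c s).preserves _)) (((c s).S _ _).map g) (by
        have := congr_arg ((c s).S _ _).map hg
        rw [Functor.map_comp, Functor.map_comp, Functor.map_comp] at this
        exact this))
  mul_comul_left ha hb hc had hbc hd he hna hnb hnc hnd hne hnk V Q :=
    hfaith _ _ fun s => Sq.map_eq
    ((Sq.mul _ hc hd hnd hnc hnk V).comp (Sq.comul ha _ he hna hne hnk V Q))
    ((Sq.tMap _ (Sq.comul ha hb had hna hnb hnd _ (Q.initial had hbc hd he))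
      (Sq.wedge hc hnc _)).comp ((Sq.assoc hB _ _ _ _ _ _ _).comp
        (Sq.tMap _ (Sq.id _) (Sq.mul hb hc hbc hnb hnc hne Q.seq))))
    (by
      rw [Functor.map_comp ((c s).S _ _)]
      exact hB.mul_comul_left ha hb hc had hbc hd he hna hnb hnc hnd hne hnk (((c s).S _ _).obj V)
        (Q.map ((c s).F _) ((c s).preserves _)))
  mul_comul_right ha hb hc had hbc hd he hna hnb hnc hnd hne hnk V Q :=
    hfaith _ _ fun s => Sq.map_eq
    ((Sq.mul ha _ he hna hne hnk V).comp (Sq.comul _ hc hd hnd hnc hnk V Q))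
    ((Sq.tMap _ (Sq.id _) (Sq.comul hb hc hbc hnb hnc hne _ (Q.ofTail hb had hbc hd he))).comp
      ((Sq.assoc hB _ _ _ _ _ _ _).inv.comp
        (Sq.tMap _ (Sq.mul ha hb had hna hnb hnd _) (Sq.id _))))
    ((hB.mul_comul_right ha hb hc had hbc hd he hna hnb hnc hnd hne hnk (((c s).S _ _).obj V)
      (Q.map ((c s).F _) ((c s).preserves _))).trans
      -- The quotient map of the image of `Q.ofTail` is the image of a composite, whereas `ofTail`
      -- of the image is a composite of images.
      (congr_arg (fun t => DB.tMap _ (𝟙 _) t ≫ _ ≫ _)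
        (DB.comul_congr hb hc hbc hnb hnc hne ((Q.ofTail hb had hbc hd he).map ((c s).F _)
          ((c s).preserves _)) _ (by
          apply ObjectProperty.hom_ext
          ext j
          exact (((c s).F _).map_comp _ _).symm))))
  exact_zero hk hnk R Q := hrefl _ _ fun s =>
    Sq.isConflation (Sq.wedge hk hnk _) (Sq.wedge hk hnk _) (by
      rw [Functor.map_comp]
      exact hB.exact_zero hk hnk (((c s).S _ _).obj R) (Q.map ((c s).F _) ((c s).preserves _)))
  exact_succ ha hb hk hna hnb hnk R Q Q' g hg := hrefl _ _ fun s =>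
    Sq.isConflation (Sq.wedge _ hnk _) ((Sq.comul ha hb hk hna hnb hnk _ Q').comp
      (Sq.tMap _ (Sq.id _) (Sq.wedge hb hnb g)))
      (hB.exact_succ ha hb hk hna hnb hnk (((c s).S _ _).obj R)
        (Q.map ((c s).F _) ((c s).preserves _)) (Q'.map ((c s).F _) ((c s).preserves _))
        (((c s).S _ _).map g)
        ((((c s).S _ _).map_comp Q'.π g).symm.trans ((congr_arg ((c s).S _ _).map hg).trans
          (((c s).S _ _).map_comp _ _))))

end Comparison

end PowerOps
end

noncomputable section

namespace PowerOps

open AdmSeq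

/-! ### The axioms for levelwise operations on diagrams -/

section LevelwiseAssembly

variable {M : ℕ → Type u} [∀ n, Category.{v} (M n)] [∀ n, Preadditive (M n)]
  [∀ n, Conflations (M n)] (J : Type) [SmallCategory J]

theorem levelwise_tMap_app (D : PowerFunctors M) {n p m : ℕ} (h : n + p = m) {X X' : J ⥤ M n}
    {Y Y' : J ⥤ M p} (f : X ⟶ X') (g : Y ⟶ Y') (j : J) :
    ((levelwiseFunctors J D).tMap h f g).app j = D.tMap h (f.app j) (g.app j) := by
  change D.tMap h (f.app j) (𝟙 _) ≫ D.tMap h (𝟙 _) (g.app j) = _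
  rw [← D.tMap_comp, Category.comp_id, Category.id_comp]

/-- Evaluation at `j` as a comparison of the levelwise operations with the given ones. -/
def evaluationComparison (D : PowerData M) (hD : D.IsAssembly) (j : J) :
    Comparison (levelwise J D hD) D where
  F n := (evaluation J (M n)).obj j
  preserves n := evaluation_preserves J j
  μ h X Y := Iso.refl _
  ω hk h V := Iso.refl _
  μ_natural h _ _ _ _ f g := (Category.comp_id _).trans
    ((levelwise_tMap_app J D.toPowerFunctors h f g j).trans (Category.id_comp _).symm)
  ω_natural hk h _ _ f := (Category.comp_id _).trans (Category.id_comp _).symm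
  assoc h₁ h₂ h₃ h₄ X Y Z := by
    refine Eq.trans ?_ (Eq.trans (Category.id_comp _).symm
      (congr_arg (𝟙 _ ≫ ·) (Eq.trans (Category.id_comp _).symm
        (congr_arg (· ≫ _) (D.tMap_id _ _ _).symm))))
    exact (congr_arg (_ ≫ ·) ((Category.id_comp _).trans (D.tMap_id _ _ _))).trans
      (Category.comp_id _)
  wedgeOne hn V := (Category.id_comp _).symm
  mul ha hb hk hna hnb hnk V := by
    refine Eq.trans ?_ (Eq.trans (Category.id_comp _).symm
      (congr_arg (𝟙 _ ≫ ·) (Eq.trans (Category.id_comp _).symm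
        (congr_arg (· ≫ _) (D.tMap_id _ _ _).symm))))
    exact Category.comp_id _
  comul ha hb hk hna hnb hnk V Q := by
    refine Eq.trans ?_ (Category.id_comp _).symm
    exact (congr_arg (_ ≫ ·) ((Category.id_comp _).trans (D.tMap_id _ _ _))).trans
      (Category.comp_id _)

/-- The evaluations are jointly faithful and detect conflations. The generality in `J` matters:
besides simplicial objects, it is needed for diagrams over `Scalings n`. -/
theorem levelwise_isAssembly [∀ n, IsExactCategory (M n)] (D : PowerData M) (hD : D.IsAssembly) :
    (levelwise J D hD).IsAssembly :=
  hD.of_comparison (evaluationComparison J D hD)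
    (fun j n => inferInstanceAs (((evaluation J (M n)).obj j).Additive))
    (fun _ _ h => NatTrans.ext (funext h))
    (fun _ _ h => (isConflation_functor_iff _ _).2 h)

end LevelwiseAssembly

/-! ### The axioms after transport along equivalences -/

section TransportAssembly

variable {A : ℕ → Type u} [∀ n, Category.{v} (A n)] {B : ℕ → Type u'} [∀ n, Category.{v'} (B n)]

/-- The shape of the associativity check for transported data. The isomorphism `d` inserted in the
transported associator is undone by the comparison `d'`, and `a`, `a'` are two forms of the same
tensored counit. -/
theorem comp_cancel {C : Type u} [Category.{v} C] {V W X Y Z : C} {e : V ⟶ W} {a a' : W ⟶ X}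
    {b : X ⟶ Y} {d : Y ⟶ Z} {d' : Z ⟶ Y} (ha : a = a') (h : d ≫ d' = 𝟙 Y) :
    (e ≫ a ≫ b ≫ d) ≫ d' = e ≫ a' ≫ b := by
  simp [ha, h]

theorem comp_cancel' {C : Type u} [Category.{v} C] {W X Y Z : C} {a : W ⟶ X}
    {b : X ⟶ Y} {d : Y ⟶ Z} {d' : Z ⟶ Y} (h : d ≫ d' = 𝟙 Y) :
    (a ≫ b ≫ d) ≫ d' = a ≫ b := by
  simp [h]

theorem cancel_naturality (E : ∀ n, A n ≌ B n) {n : ℕ} {X Y : B n} (f : X ⟶ Y) :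
    (E n).functor.map ((E n).inverse.map f) ≫ (cancel E Y).hom = (cancel E X).hom ≫ f :=
  (E n).counitIso.hom.naturality f

variable [∀ n, Preadditive (A n)] [∀ n, Conflations (A n)] [∀ n, Preadditive (B n)]
  [∀ n, Conflations (B n)]

theorem transport_tMap (E : ∀ n, A n ≌ B n) (hE : ∀ n, PreservesConflations (E n).functor)
    (D : PowerFunctors B) {n p m : ℕ} (h : n + p = m) {X X' : A n} {Y Y' : A p} (f : X ⟶ X')
    (g : Y ⟶ Y') :
    (transportFunctors E hE D).tMap h f g =
      (E m).inverse.map (D.tMap h ((E n).functor.map f) ((E p).functor.map g)) :=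
  ((E m).inverse.map_comp _ _).symm

/-- The functors of the equivalences as a comparison of the transported operations with the given
ones. -/
def transportComparison (E : ∀ n, A n ≌ B n) (hE : ∀ n, PreservesConflations (E n).functor)
    (D : PowerData B) : Comparison (transport E hE D) D where
  F n := (E n).functor
  preserves n := hE n
  μ h X Y := cancel E _
  ω hk h V := cancel E _
  μ_natural {n p m} h _ _ _ _ f g := (congr_arg (fun t => (E m).functor.map t ≫ _)
    (transport_tMap E hE D.toPowerFunctors h f g)).trans (cancel_naturality E _)
  ω_natural hk h _ _ f := cancel_naturality E _
  assoc {n p q _ _ m} h₁ h₂ h₃ h₄ X Y Z := by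
    refine (Category.assoc _ _ _).symm.trans
      ((congr_arg (· ≫ _) (cancel_naturality E _)).trans ?_)
    exact comp_cancel (D.tMap_id_right h₂ _).symm
      ((congr_arg (_ ≫ ·) (D.tMap_id_left h₄ _)).trans
        ((((D.tensor h₄).obj _).map_comp _ _).symm.trans
          ((congr_arg _ (Iso.inv_hom_id _)).trans (((D.tensor h₄).obj _).map_id _))))
  wedgeOne {n} hn V := by
    refine ((E n).functor.map_comp _ _).trans (Eq.trans (congr_arg _ ?_)
      (cancel_naturality E (D.wedgeOne hn ((mapSeq 1 (E n).functor (hE n)).obj V)).hom))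
    exact ((E n).counit_app_functor _).symm
  mul ha hb hk hna hnb hnk V := cancel_naturality E _
  comul {n a b k na nb nk} ha hb hk hna hnb hnk V Q := by
    refine (Category.assoc _ _ _).symm.trans
      ((congr_arg (· ≫ _) (cancel_naturality E _)).trans ?_)
    exact comp_cancel' (D.tIso (add_index hk hna hnb hnk) (cancel E _) (cancel E _)).inv_hom_id

/-- An equivalence is faithful, so one comparison suffices. The conflations of `A n` are not defined
through `E n`, hence reflection has to be assumed. -/
theorem transport_isAssembly [∀ n, IsExactCategory (B n)] (E : ∀ n, A n ≌ B n)
    (hE : ∀ n, PreservesConflations (E n).functor) (hadd : ∀ n, (E n).functor.Additive)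
    (hrefl : ∀ {n : ℕ} {X Y Z : A n} (f : X ⟶ Y) (g : Y ⟶ Z),
      IsConflation ((E n).functor.map f) ((E n).functor.map g) → IsConflation f g)
    (D : PowerData B) (hD : D.IsAssembly) : (transport E hE D).IsAssembly :=
  hD.of_comparison (S := Unit) (fun _ => transportComparison E hE D) (fun _ => hadd)
    (fun _ _ h => (E _).functor.map_injective (h ())) (fun _ _ h => hrefl _ _ (h ()))

end TransportAssembly

/-! ### The axioms on full subcategories -/

section RestrictionAssembly

variable {M : ℕ → Type u} [∀ n, Category.{v} (M n)] [∀ n, Preadditive (M n)]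
  [∀ n, Conflations (M n)]

/-- The inclusions as a comparison of the restricted operations with the given ones. -/
def restrictionComparison (D : PowerData M) (P : ∀ n, ObjectProperty (M n))
    (ht : TensorClosed D.toPowerFunctors P) (hw : WedgeClosed D.toPowerFunctors P) :
    Comparison (restrictData D P ht hw) D where
  F n := (P n).ι
  preserves n := ι_preserves (P n)
  μ h X Y := Iso.refl _
  ω hk h V := Iso.refl _
  μ_natural h _ _ _ _ f g := (Category.comp_id _).trans (Category.id_comp _).symm
  ω_natural hk h _ _ f := (Category.comp_id _).trans (Category.id_comp _).symm
  assoc h₁ h₂ h₃ h₄ X Y Z := by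
    refine Eq.trans ?_ (Eq.trans (Category.id_comp _).symm
      (congr_arg (𝟙 _ ≫ ·) (Eq.trans (Category.id_comp _).symm
        (congr_arg (· ≫ _) (D.tMap_id _ _ _).symm))))
    exact (congr_arg (_ ≫ ·) ((Category.id_comp _).trans (D.tMap_id _ _ _))).trans
      (Category.comp_id _)
  wedgeOne hn V := (Category.id_comp _).symm
  mul ha hb hk hna hnb hnk V := by
    refine Eq.trans ?_ (Eq.trans (Category.id_comp _).symm
      (congr_arg (𝟙 _ ≫ ·) (Eq.trans (Category.id_comp _).symm
        (congr_arg (· ≫ _) (D.tMap_id _ _ _).symm))))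
    exact Category.comp_id _
  comul ha hb hk hna hnb hnk V Q := by
    refine Eq.trans ?_ (Category.id_comp _).symm
    exact (congr_arg (_ ≫ ·) ((Category.id_comp _).trans (D.tMap_id _ _ _))).trans
      (Category.comp_id _)

theorem restrictData_isAssembly [∀ n, IsExactCategory (M n)] (D : PowerData M)
    (hD : D.IsAssembly) (P : ∀ n, ObjectProperty (M n))
    (ht : TensorClosed D.toPowerFunctors P) (hw : WedgeClosed D.toPowerFunctors P) :
    (restrictData D P ht hw).IsAssembly :=
  hD.of_comparison (S := Unit) (fun _ => restrictionComparison D P ht hw)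
    (fun _ n => inferInstanceAs ((P n).ι.Additive))
    (fun _ _ h => (P _).ι.map_injective (h ()))
    (fun _ _ h => (isConflation_fullSubcategory_iff _ _).2 (h ()))

end RestrictionAssembly

end PowerOps
end

noncomputable section

namespace PowerOps

open AdmSeq

/-! ### The axioms for the Dold–Puppe construction -/

section DoldPuppeAssembly

variable {M : ℕ → Type u} [∀ n, Category.{v} (M n)] [∀ n, Preadditive (M n)]
  [∀ n, Conflations (M n)] [∀ n, IsExactCategory (M n)] [∀ n, IsIdempotentComplete (M n)]

theorem doldPuppe_isAssembly (D : PowerData M) (hD : D.IsAssembly) :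
    (doldPuppe D hD).IsAssembly :=
  transport_isAssembly _ _ (fun _ => doldKan_additive) isConflation_of_doldKan _
    (levelwise_isAssembly _ D hD)

end DoldPuppeAssembly

/-! ### Degrees with respect to commuting idempotents -/

section Operators

variable {M : ℕ → Type u} [∀ n, Category.{v} (M n)] [∀ n, Preadditive (M n)]
  [∀ n, Conflations (M n)]

/-- A natural endomorphism of the identity acts on sequences. -/
def seqEnd {C : Type u} [Category.{v} C] [Preadditive C] [Conflations C] {k : ℕ}
    (t : 𝟭 C ⟶ 𝟭 C) (V : AdmSeq k C) : V ⟶ V :=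
  ObjectProperty.homMk
    { app := fun j => t.app (V.obj.obj j)
      naturality := fun _ _ f => t.naturality (V.obj.map f) }

/-- A family of idempotent natural endomorphisms of the identity functors which is compatible with
tensor products and power operations. -/
structure Operators (D : PowerFunctors M) (ι : Type) where
  /-- the endomorphisms -/
  τ : ι → ∀ n, 𝟭 (M n) ⟶ 𝟭 (M n)
  idem : ∀ (i : ι) (n : ℕ) (X : M n), (τ i n).app X ≫ (τ i n).app X = (τ i n).app X
  tensor : ∀ (i : ι) {n p m : ℕ} (h : n + p = m) (X : M n) (Y : M p),
    (τ i m).app (D.tObj h X Y) = D.tMap h ((τ i n).app X) ((τ i p).app Y)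
  wedge : ∀ (i : ι) {k n m : ℕ} (hk : 1 ≤ k) (h : n * k = m) (V : AdmSeq k (M n)),
    (τ i m).app ((D.wedge hk h).obj V) = (D.wedge hk h).map (seqEnd (τ i n) V)

namespace Operators

variable {D : PowerFunctors M} {ι : Type} (T : Operators D ι)

/-- The action of `τ i` on an object. -/
def act (i : ι) {n : ℕ} (X : M n) : X ⟶ X := (T.τ i n).app X

theorem act_natural (i : ι) {n : ℕ} {X Y : M n} (f : X ⟶ Y) : f ≫ T.act i Y = T.act i X ≫ f :=
  (T.τ i n).naturality f

theorem act_idem (i : ι) {n : ℕ} (X : M n) : T.act i X ≫ T.act i X = T.act i X := T.idem i n X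

/-- The product of the idempotents `1 - τ i` for `i` in a list. -/
def q {n : ℕ} (X : M n) : List ι → (X ⟶ X)
  | [] => 𝟙 X
  | i :: I => (𝟙 X - T.act i X) ≫ q X I

theorem q_natural {n : ℕ} {X Y : M n} (f : X ⟶ Y) (I : List ι) : f ≫ T.q Y I = T.q X I ≫ f := by
  induction I with
  | nil => simp [q]
  | cons i I ih =>
    dsimp only [q]
    have e : f ≫ (𝟙 Y - T.act i Y) = (𝟙 X - T.act i X) ≫ f := by
      rw [Preadditive.comp_sub, Preadditive.sub_comp, act_natural, Category.comp_id,
        Category.id_comp]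
    rw [reassoc_of% e, ih, Category.assoc]

theorem q_idem {n : ℕ} (X : M n) (I : List ι) : T.q X I ≫ T.q X I = T.q X I := by
  induction I with
  | nil => simp [q]
  | cons i I ih =>
    dsimp only [q]
    rw [Category.assoc, ← Category.assoc (T.q X I), ← q_natural, Category.assoc, ih,
      ← Category.assoc]
    congr 1
    simp [Preadditive.sub_comp, Preadditive.comp_sub, act_idem]

theorem q_eq_zero_of_mem {n : ℕ} {X : M n} {I : List ι} {i : ι} (hi : i ∈ I)
    (h : T.act i X = 𝟙 X) : T.q X I = 0 := by
  induction I with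
  | nil => simp at hi
  | cons j I ih =>
    dsimp only [q]
    rcases List.mem_cons.1 hi with rfl | hi
    · rw [h, sub_self, zero_comp]
    · rw [ih hi, comp_zero]

theorem q_eq_id {n : ℕ} {X : M n} {I : List ι} (h : ∀ i ∈ I, T.act i X = 0) : T.q X I = 𝟙 X := by
  induction I with
  | nil => rfl
  | cons j I ih =>
    dsimp only [q]
    rw [ih (fun i hi => h i (List.mem_cons_of_mem _ hi)), h j List.mem_cons_self, sub_zero,
      Category.comp_id]

theorem q_eq_zero_of_isZero {n : ℕ} {X : M n} (I : List ι) (h : IsZero X) : T.q X I = 0 :=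
  h.eq_of_src _ _

theorem q_eq_zero_of_epi {n : ℕ} {X Y : M n} {I : List ι} (f : X ⟶ Y) [Epi f]
    (h : T.q X I = 0) : T.q Y I = 0 := by
  rw [← cancel_epi f, q_natural, h, zero_comp, comp_zero]

theorem q_eq_zero_of_mono {n : ℕ} {X Y : M n} {I : List ι} (f : X ⟶ Y) [Mono f]
    (h : T.q Y I = 0) : T.q X I = 0 := by
  rw [← cancel_mono f, ← q_natural, h, zero_comp, comp_zero]

/-- `X` has degree at most `d` if all products of more than `d` of the `1 - τ i` vanish on `X`. -/
def Deg (d : ℕ) {n : ℕ} (X : M n) : Prop := ∀ I : List ι, I.Nodup → d < I.length → T.q X I = 0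

theorem Deg.of_epi {d : ℕ} {n : ℕ} {X Y : M n} (h : T.Deg d X) (f : X ⟶ Y) [Epi f] : T.Deg d Y :=
  fun I hI hd => T.q_eq_zero_of_epi f (h I hI hd)

theorem Deg.of_mono {d : ℕ} {n : ℕ} {X Y : M n} (h : T.Deg d Y) (f : X ⟶ Y) [Mono f] :
    T.Deg d X :=
  fun I hI hd => T.q_eq_zero_of_mono f (h I hI hd)

/-- Since `q` vanishes on `Z`, it maps `Y` into `X`, where it vanishes too. So `q ≫ q = 0` on `Y`,
and `q` is idempotent. -/
theorem q_eq_zero_of_isConflation [∀ n, IsExactCategory (M n)] {n : ℕ} {X Y Z : M n} {f : X ⟶ Y}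
    {g : Y ⟶ Z} (hfg : IsConflation f g) {I : List ι} (hX : T.q X I = 0) (hZ : T.q Z I = 0) :
    T.q Y I = 0 := by
  obtain ⟨s, hs⟩ := hfg.exists_lift (T.q Y I) (by rw [← q_natural, hZ, comp_zero])
  rw [← q_idem]
  nth_rw 1 [← hs]
  rw [Category.assoc, q_natural, hX, zero_comp, comp_zero]

end Operators

end Operators

/-! ### Additivity of degrees under tensor products -/

section TensorDegree

variable {M : ℕ → Type u} [∀ n, Category.{v} (M n)] [∀ n, Preadditive (M n)]
  [∀ n, Conflations (M n)] {D : PowerData M}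

theorem PowerData.IsAssembly.tMap_sub_left (hD : D.IsAssembly) {n p m : ℕ} (h : n + p = m)
    {X X' : M n} {Y Y' : M p} (f f' : X ⟶ X') (g : Y ⟶ Y') :
    D.tMap h (f - f') g = D.tMap h f g - D.tMap h f' g := by
  have := (hD.tensor_right h Y).additive
  have e : ∀ t : X ⟶ X', D.tMap h t g =
      ((D.tensor h).flip.obj Y).map t ≫ ((D.tensor h).obj X').map g := fun t => rfl
  rw [e, e, e, Functor.map_sub, Preadditive.sub_comp]

theorem PowerData.IsAssembly.tMap_sub_right (hD : D.IsAssembly) {n p m : ℕ} (h : n + p = m)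
    {X X' : M n} {Y Y' : M p} (f : X ⟶ X') (g g' : Y ⟶ Y') :
    D.tMap h f (g - g') = D.tMap h f g - D.tMap h f g' := by
  have := (hD.tensor_left h X').additive
  dsimp only [PowerFunctors.tMap]
  rw [Functor.map_sub, Preadditive.comp_sub]

theorem PowerData.IsAssembly.tMap_zero_left (hD : D.IsAssembly) {n p m : ℕ} (h : n + p = m)
    {X X' : M n} {Y Y' : M p} (g : Y ⟶ Y') : D.tMap h (0 : X ⟶ X') g = 0 := by
  rw [← sub_self (0 : X ⟶ X'), hD.tMap_sub_left, sub_self]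

theorem PowerData.IsAssembly.tMap_zero_right (hD : D.IsAssembly) {n p m : ℕ} (h : n + p = m)
    {X X' : M n} {Y Y' : M p} (f : X ⟶ X') : D.tMap h f (0 : Y ⟶ Y') = 0 := by
  rw [← sub_self (0 : Y ⟶ Y'), hD.tMap_sub_right, sub_self]

namespace Operators

variable {ι : Type} (T : Operators D.toPowerFunctors ι)

/-- The generalization over `J` and `K` makes the induction on `I` work. Each factor `1 - τ_i` of
the tensor product splits into two terms, one adding `i` to `J` and the other adding `i` to `K`.
Once `I` is used up, `J` is longer than `d` or `K` is longer than `e`. -/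
theorem tMap_q_comp_q (hD : D.IsAssembly) {n p m : ℕ} (h : n + p = m) {X : M n} {Y : M p}
    {d e : ℕ} (hX : T.Deg d X) (hY : T.Deg e Y) (I : List ι) :
    ∀ J K : List ι, (J ++ I).Nodup → (K ++ I).Nodup → d + e < J.length + K.length + I.length →
      D.tMap h (T.q X J) (T.q Y K) ≫ T.q (D.tObj h X Y) I = 0 := by
  induction I with
  | nil =>
    intro J K hJ hK hd
    rw [List.append_nil] at hJ hK
    by_cases h' : d < J.length
    · rw [hX J hJ h', hD.tMap_zero_left, zero_comp]
    · rw [hY K hK (by simp only [List.length_nil] at hd; omega), hD.tMap_zero_right, zero_comp]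
  | cons i I ih =>
    intro J K hJ hK hd
    have hJ' := List.nodup_middle.1 hJ
    have hK' := List.nodup_middle.1 hK
    -- `1 - τ ⊗ τ = (1 - τ) ⊗ 1 + τ ⊗ (1 - τ)`.
    have e₁ : 𝟙 (D.tObj h X Y) - T.act i (D.tObj h X Y) =
        D.tMap h (𝟙 X - T.act i X) (𝟙 Y) + D.tMap h (T.act i X) (𝟙 Y - T.act i Y) := by
      rw [hD.tMap_sub_left, hD.tMap_sub_right, D.tMap_id, sub_add_sub_cancel]
      exact congr_arg (_ - ·) (T.tensor i h X Y)
    have e₂ : D.tMap h (T.q X J) (T.q Y K) ≫ D.tMap h (𝟙 X - T.act i X) (𝟙 Y) =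
        D.tMap h (T.q X (i :: J)) (T.q Y K) := by
      rw [← D.tMap_comp, Category.comp_id, ← T.q_natural]
      rfl
    have e₃ : D.tMap h (T.q X J) (T.q Y K) ≫ D.tMap h (T.act i X) (𝟙 Y - T.act i Y) =
        D.tMap h (T.act i X) (𝟙 Y) ≫ D.tMap h (T.q X J) (T.q Y (i :: K)) := by
      rw [← D.tMap_comp, ← D.tMap_comp, ← T.q_natural, ← T.q_natural, Category.id_comp]
      rfl
    dsimp only [q]
    rw [e₁, Preadditive.add_comp, Preadditive.comp_add, reassoc_of% e₂, reassoc_of% e₃,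
      ih (i :: J) K hJ' (List.nodup_cons.1 hK').2 (by simp only [List.length_cons] at hd ⊢; omega),
      ih J (i :: K) (List.nodup_cons.1 hJ').2 hK' (by simp only [List.length_cons] at hd ⊢; omega),
      comp_zero, add_zero]

theorem Deg.tensor {T : Operators D.toPowerFunctors ι} (hD : D.IsAssembly) {n p m : ℕ}
    (h : n + p = m) {X : M n} {Y : M p} {d e : ℕ} (hX : T.Deg d X) (hY : T.Deg e Y) :
    T.Deg (d + e) (D.tObj h X Y) := by
  intro I hI hd
  have := T.tMap_q_comp_q hD h hX hY I [] [] (by simpa) (by simpa) (by simpa using hd)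
  dsimp only [q] at this
  rwa [D.tMap_id, Category.id_comp] at this

end Operators

end TensorDegree

end PowerOps
end

noncomputable section

namespace PowerOps

open AdmSeq

/-! ### Degrees of power operations -/

theorem QuotientSeq.epi_π {C : Type u} [Category.{v} C] [Preadditive C] [Conflations C]
    [IsExactCategory C] {a b k : ℕ} (ha : 1 ≤ a) {h : a + b = k} {V : AdmSeq k C}
    (Q : QuotientSeq h V) (j : Fin b) : Epi (Q.π.hom.app j) :=
  (Q.conf ⟨a - 1, by omega⟩ (by dsimp only; omega) j (by
    change a - 1 ≤ a + j.1
    omega)).epi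

theorem isZero_admSeq {C : Type u} [Category.{v} C] [Preadditive C] [Conflations C] {k : ℕ}
    {V : AdmSeq k C} (h : ∀ j, IsZero (V.obj.obj j)) : IsZero V := by
  rw [IsZero.iff_id_eq_zero]
  apply ObjectProperty.hom_ext
  ext j
  exact (h j).eq_of_src _ _

section ConstantSequences

variable {C : Type u} [Category.{v} C] [Preadditive C] [Conflations C] [IsExactCategory C]

/-- The constant sequence. -/
def constSeq (k : ℕ) (X : C) : AdmSeq k C :=
  ⟨(Functor.const _).obj X, fun _ _ _ => IsExactCategory.id_inflation X⟩

/-- Restricting a sequence along a constant map gives a constant sequence. -/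
def restrictConstIso {k l : ℕ} (j : Fin l) (V : AdmSeq l C) :
    (restrict (OrderHom.const (Fin k) j)).obj V ≅ constSeq k (V.obj.obj j) :=
  ObjectProperty.isoMk _ (NatIso.ofComponents (fun _ => Iso.refl _) (fun _ => by
    refine (Category.comp_id _).trans (Eq.trans ?_ (Category.comp_id _).symm)
    exact V.obj.map_id j))

/-- The sequence of length two given by an admissible monomorphism. -/
def pairSeq {X Y : C} {i : X ⟶ Y} (hi : IsInflation i) : AdmSeq 2 C :=
  ⟨ComposableArrows.mk₁ i, fun a b h => by
    fin_cases a <;> fin_cases b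
    · exact IsExactCategory.id_inflation X
    · exact hi
    · exact absurd h (by decide)
    · exact IsExactCategory.id_inflation Y⟩

end ConstantSequences

/-- The map `i ↦ 0` for `i < c` and `i ↦ i` for `i ≥ c`. -/
def foldMap (k c : ℕ) : Fin k →o Fin k :=
  ⟨fun i => ⟨if i.1 < c then 0 else i.1, by split_ifs <;> omega⟩, fun i j h => by
    have h' : i.1 ≤ j.1 := h
    simp only [Fin.mk_le_mk]
    split_ifs <;> omega⟩

/-- The map `i ↦ 0` for `i ≤ a` and `i ↦ i - 1` for `i > a`. -/
def repeatMap {k : ℕ} (hk : 1 ≤ k) (a : ℕ) : Fin (k + 1) →o Fin k :=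
  ⟨fun i => ⟨if i.1 ≤ a then 0 else i.1 - 1, by split_ifs <;> omega⟩, fun i j h => by
    have h' : i.1 ≤ j.1 := h
    simp only [Fin.mk_le_mk]
    split_ifs <;> omega⟩

/-- The map with value `0` at `0` and `1` elsewhere. -/
def stepMap (k : ℕ) : Fin k →o Fin 2 :=
  ⟨fun i => if i.1 = 0 then 0 else 1, fun i j h => by
    have h' : i.1 ≤ j.1 := h
    dsimp only
    split_ifs <;> first | exact le_rfl | omega⟩

theorem val_skipMap {k p : ℕ} (hp : p < k + 1) (i : Fin k) :
    (skipMap p hp i).1 = if i.1 < p then i.1 else i.1 + 1 := by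
  change (Fin.succAbove ⟨p, hp⟩ i).1 = _
  simp only [Fin.succAbove, Fin.lt_def, Fin.val_castSucc]
  split_ifs <;> rfl

/-- The sequence `V` reindexed by `repeatMap` is `V_0` repeated `a + 1` times, followed by `V_a,
V_{a+1}, …` (indices from `0`). Omitting the term `V_a` folds one more entry into `V_0`, while
omitting one copy of `V_0` does not. These are the first two terms of the conflation in
`exact_succ`. -/
theorem repeatMap_comp_skipMap_succ {k : ℕ} (hk : 1 ≤ k) (a : ℕ) (ha : a + 1 < k + 1) :
    (repeatMap hk a).comp (skipMap (a + 1) ha) = foldMap k (a + 1) := by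
  ext i
  change (if (skipMap (a + 1) ha i).1 ≤ a then 0 else (skipMap (a + 1) ha i).1 - 1) =
    if i.1 < a + 1 then 0 else i.1
  rw [val_skipMap]
  split_ifs <;> omega

theorem repeatMap_comp_skipMap {k : ℕ} (hk : 1 ≤ k) (a : ℕ) (ha : a < k + 1) :
    (repeatMap hk a).comp (skipMap a ha) = foldMap k a := by
  ext i
  change (if (skipMap a ha i).1 ≤ a then 0 else (skipMap a ha i).1 - 1) =
    if i.1 < a then 0 else i.1
  rw [val_skipMap]
  split_ifs <;> omega

theorem foldMap_one (k : ℕ) : foldMap k 1 = OrderHom.id := by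
  ext i
  change (if i.1 < 1 then 0 else i.1) = i.1
  split_ifs <;> omega

theorem stepMap_comp_skipMap_zero (k : ℕ) (h : 0 < k + 1) :
    (stepMap (k + 1)).comp (skipMap 0 h) = OrderHom.const (Fin k) 1 := by
  ext1
  funext i
  change (if (skipMap 0 h i).1 = 0 then (0 : Fin 2) else 1) = 1
  rw [val_skipMap, if_neg (by simp)]

theorem stepMap_comp_skipMap_one_comp_foldMap (k : ℕ) (h : 1 < k + 1) :
    ((stepMap (k + 1)).comp (skipMap 1 h)).comp (foldMap k k) = OrderHom.const (Fin k) 0 := by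
  ext1
  funext i
  change (if (skipMap 1 h (foldMap k k i)).1 = 0 then (0 : Fin 2) else 1) = 0
  have : (foldMap k k i).1 = 0 := if_pos i.2
  rw [val_skipMap, if_pos]
  split_ifs <;> omega

/-! ### Degrees of power operations by filtration -/

section WedgeDegree

variable {M : ℕ → Type u} [∀ n, Category.{v} (M n)] [∀ n, Preadditive (M n)]
  [∀ n, Conflations (M n)] [∀ n, IsExactCategory (M n)] {D : PowerData M}

/-- Power operations are not additive, so this needs an axiom. In `exact_zero` for a constant
sequence of zero objects, both maps are images of isomorphisms between zero sequences. Their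
composite is zero, which forces the object to be zero. -/
theorem PowerData.IsAssembly.isZero_wedge_constSeq (hD : D.IsAssembly) {k n m : ℕ} (hk : 1 ≤ k)
    (h : n * k = m) {X : M n} (hX : IsZero X) : IsZero ((D.wedge hk h).obj (constSeq k X)) := by
  obtain ⟨Q⟩ := QuotientSeq.nonempty le_rfl (add_comm 1 k) (constSeq (k + 1) X)
  have hQ : IsZero Q.seq := isZero_admSeq fun j => by
    have := Q.epi_π le_rfl j
    exact IsZero.of_epi (X := ((tail _).obj (constSeq (k + 1) X)).obj.obj j) (Q.π.hom.app j) hX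
  have hX' : IsZero (constSeq k X) := isZero_admSeq fun _ => hX
  have e := (hD.exact_zero hk h (constSeq (k + 1) X) Q).zero
  rw [← Functor.map_comp, (isZero_admSeq fun _ => hX :
    IsZero ((restrict (skipMap 1 (by omega))).obj (constSeq (k + 1) X))).eq_of_src (_ ≫ _)
      (((isZero_admSeq fun _ => hX).iso hX').hom ≫ (hX'.iso hQ).hom), Functor.map_comp] at e
  have e' : (D.wedge hk h).map (hX'.iso hQ).hom = 0 := by
    rw [← cancel_epi ((D.wedge hk h).map
      ((isZero_admSeq fun _ => hX : IsZero ((restrict (skipMap 1 (by omega))).obj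
        (constSeq (k + 1) X))).iso hX').hom), e, comp_zero]
  rw [IsZero.iff_id_eq_zero, ← CategoryTheory.Functor.map_id, ← (hX'.iso hQ).hom_inv_id, Functor.map_comp, e',
    zero_comp]

namespace Operators

variable {ι : Type} {T : Operators D.toPowerFunctors ι}

/-- The statement that power operations of length less than `k` multiply degrees by at most their
length. -/
def WedgeDeg (T : Operators D.toPowerFunctors ι) (k : ℕ) : Prop :=
  ∀ {l n m d : ℕ} (hl : 1 ≤ l) (h : n * l = m) (V : AdmSeq l (M n)), l < k →
    (∀ j, T.Deg d (V.obj.obj j)) → T.Deg (l * d) ((D.wedge hl h).obj V)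

/-- By `exact_succ`, the operation on `V_0, …, V_0, V_a, …` (with `a` copies of `V_0`) is an
extension. The subobject is the operation with one more entry folded into `V_0`. The quotient is the
tensor product of operations of lengths `a` and `k - a`, both shorter than `k`, so it has degree at
most `a * d + (k - a) * d = k * d`. -/
theorem q_wedge_foldMap_step (hD : D.IsAssembly) {k : ℕ} (ih : T.WedgeDeg k) {n m d : ℕ}
    (hk : 1 ≤ k) (h : n * k = m) {V : AdmSeq k (M n)} (hV : ∀ j, T.Deg d (V.obj.obj j))
    {I : List ι} (hI : I.Nodup) (hd : k * d < I.length) {a : ℕ} (ha : 1 ≤ a) (hak : a < k)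
    (hq : T.q ((D.wedge hk h).obj ((restrict (foldMap k (a + 1))).obj V)) I = 0) :
    T.q ((D.wedge hk h).obj ((restrict (foldMap k a)).obj V)) I = 0 := by
  obtain ⟨b, rfl⟩ := Nat.exists_eq_add_of_lt hak
  let R := (restrict (repeatMap hk a)).obj V
  have hab : a + (b + 1) = a + b + 1 := rfl
  obtain ⟨Q⟩ := QuotientSeq.nonempty (show 1 ≤ a + 1 by omega)
    (show a + 1 + (b + 1) = a + b + 1 + 1 by omega) R
  obtain ⟨Q'⟩ := QuotientSeq.nonempty ha hab ((restrict (skipMap a (by omega))).obj R)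
  obtain ⟨g, hg⟩ := Q'.exists_desc ha (shift (φ := (skipMap a (by omega)).comp (tailMap hab))
      (skip_tail_le hab) R ≫ Q.π) (by
    intro i hi j hij
    have hval : (skipMap (k := a + b + 1) a (by omega) i).1 = a - 1 := by
      rw [val_skipMap, if_pos (by omega)]; omega
    -- The index of the object by which `Q` takes quotients. The last term of the initial part, at
    -- index `a - 1`, maps through it and hence dies in `Q`.
    let x : Fin (a + b + 1 + 1) := ⟨a, by omega⟩
    have h₁ : skipMap (k := a + b + 1) a (by omega) i ≤ x := by
      rw [Fin.le_def, hval]; dsimp [x]; omega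
    have h₂ : x ≤ tailMap (show a + 1 + (b + 1) = a + b + 1 + 1 by omega) j := by
      rw [Fin.le_def]
      change a ≤ a + 1 + j.1
      omega
    have e : ((restrict (skipMap a (by omega))).obj R).obj.map (homOfLE hij) ≫
        R.obj.map (homOfLE (skip_tail_le hab j)) = R.obj.map (homOfLE h₁) ≫
          R.obj.map (homOfLE h₂) := by
      refine Eq.trans ?_ (R.obj.map_comp (homOfLE h₁) (homOfLE h₂))
      exact (R.obj.map_comp (homOfLE ((skipMap a (by omega)).monotone hij)) _).symm
    refine (Category.assoc _ _ _).symm.trans ((congr_arg (· ≫ Q.π.hom.app j) e).trans ?_)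
    exact (Category.assoc _ _ _).trans
      ((congr_arg (_ ≫ ·) (Q.conf x rfl j h₂).zero).trans comp_zero))
  have key := hD.exact_succ ha (show 1 ≤ b + 1 by omega) hab rfl rfl h R Q Q' g hg
  have h₁ : T.q ((D.wedge hk h).obj ((restrict (skipMap (a + 1) (by omega))).obj R)) I = 0 := by
    change T.q ((D.wedge hk h).obj
      ((restrict ((repeatMap hk a).comp (skipMap (a + 1) (by omega)))).obj V)) I = 0
    rwa [repeatMap_comp_skipMap_succ]
  have h₂ := T.q_eq_zero_of_isConflation key h₁ (Deg.tensor hD _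
    (ih ha rfl _ (by omega) (d := d) fun j => hV _)
    (ih (show 1 ≤ b + 1 by omega) rfl Q.seq (by omega) (d := d) fun j => by
      have := Q.epi_π (show 1 ≤ a + 1 by omega) j
      exact Deg.of_epi T (X := ((tail _).obj R).obj.obj j) (hV _) (Q.π.hom.app j)) I hI (by
        rw [← add_mul]
        exact hd))
  rw [← repeatMap_comp_skipMap hk a (by omega)]
  exact h₂

/-- Descending induction on the number of entries replaced by the first term: folding `k` entries
gives a constant sequence, and folding one entry changes nothing. -/
theorem q_wedge_of_foldMap (hD : D.IsAssembly) {k : ℕ} (ih : T.WedgeDeg k) {n m d : ℕ}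
    (hk : 1 ≤ k) (h : n * k = m) {V : AdmSeq k (M n)} (hV : ∀ j, T.Deg d (V.obj.obj j))
    {I : List ι} (hI : I.Nodup) (hd : k * d < I.length)
    (hq : T.q ((D.wedge hk h).obj ((restrict (foldMap k k)).obj V)) I = 0) :
    T.q ((D.wedge hk h).obj V) I = 0 := by
  have key : ∀ a, 1 ≤ a → ∀ _ : a ≤ k,
      T.q ((D.wedge hk h).obj ((restrict (foldMap k a)).obj V)) I = 0 := by
    intro a ha hak
    induction hak using Nat.decreasingInduction with
    | self => exact hq
    | of_succ a hak ih' =>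
      exact q_wedge_foldMap_step hD ih hk h hV hI hd ha (by omega) (ih' (by omega))
  have := key 1 le_rfl hk
  rw [foldMap_one] at this
  exact this

/-- The list `J` contains the indices at which `τ_i` may still act on `X` other than by `0` or `1`.
Each induction step removes one of them by splitting `X` along `τ_i`. Length `k` itself is not
covered by `ih`, so the split pieces are handled by the inner induction. -/
theorem q_wedge_constSeq [∀ n, IsIdempotentComplete (M n)] (hD : D.IsAssembly) {k : ℕ}
    (ih : T.WedgeDeg k) {n m d : ℕ} (hk : 1 ≤ k) (h : n * k = m) {I : List ι} (hI : I.Nodup)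
    (hd : k * d < I.length) (J : List ι) : ∀ {X : M n}, T.Deg d X →
    (∀ i ∈ I, i ∉ J → T.act i X = 0 ∨ T.act i X = 𝟙 X) →
    T.q ((D.wedge hk h).obj (constSeq k X)) I = 0 := by
  induction J with
  | nil =>
    intro X hX hJ
    -- If some `τ_i` is the identity on `X`, it is also the identity on the power operation, and the
    -- factor `1 - τ_i` vanishes. Otherwise all `τ_i` vanish on `X`, so the product of the `1 - τ_i`
    -- is the identity. It is also zero, since `I` has more than `k * d ≥ d` elements; hence `X =
    -- 0`.
    by_cases hi : ∃ i ∈ I, T.act i X = 𝟙 X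
    · obtain ⟨i, hi, hi'⟩ := hi
      refine T.q_eq_zero_of_mem hi ((T.wedge i hk h _).trans ?_)
      have : seqEnd (T.τ i n) (constSeq k X) = 𝟙 _ := by
        apply ObjectProperty.hom_ext
        ext j
        exact hi'
      rw [this, CategoryTheory.Functor.map_id]
    · have hz : ∀ i ∈ I, T.act i X = 0 := fun i hi' =>
        (hJ i hi' List.not_mem_nil).resolve_right fun h => hi ⟨i, hi', h⟩
      refine T.q_eq_zero_of_isZero _ (hD.isZero_wedge_constSeq hk h ?_)
      rw [IsZero.iff_id_eq_zero, ← T.q_eq_id hz]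
      exact hX I hI (lt_of_le_of_lt (Nat.le_mul_of_pos_left d hk) hd)
  | cons i J ihJ =>
    intro X hX hJ
    -- `Y` is the image of `τ_i`, on which `τ_i` is `1`. Its complement `Z` is where `τ_i` is `0`.
    obtain ⟨Y, s, r, hsr, hrs⟩ :=
      IsIdempotentComplete.idempotents_split X (T.act i X) (T.act_idem i X)
    obtain ⟨Z, s', r', hsr', h₁, h₂, h₃⟩ := exists_complement s r hsr
    have hc := isConflation_of_split s r s' r' hsr hsr' h₁ h₂ h₃
    have := hc.mono
    have := hc.epi
    have hs' : Mono s' := (SplitMono.mk r' hsr').mono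
    have hY : ∀ j ∈ I, j ∉ J → T.act j Y = 0 ∨ T.act j Y = 𝟙 Y := by
      intro j hj hj'
      rw [← cancel_mono s, ← cancel_mono s, ← T.act_natural, zero_comp, Category.id_comp]
      by_cases hij : j = i
      · subst hij
        right
        rw [← hrs, reassoc_of% hsr]
      · rcases hJ j hj (by simp [hij, hj']) with e | e <;> simp [e]
    have hZ : ∀ j ∈ I, j ∉ J → T.act j Z = 0 ∨ T.act j Z = 𝟙 Z := by
      intro j hj hj'
      rw [← cancel_mono s', ← cancel_mono s', ← T.act_natural, zero_comp, Category.id_comp]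
      by_cases hij : j = i
      · subst hij
        left
        rw [← hrs, reassoc_of% h₂, zero_comp]
      · rcases hJ j hj (by simp [hij, hj']) with e | e <;> simp [e]
    have qY := ihJ (Deg.of_mono T hX s) hY
    have qZ := ihJ (Deg.of_epi T hX r') hZ
    let W : AdmSeq 2 (M n) := pairSeq ⟨Z, r', hc⟩
    have hW : ∀ j, T.Deg d (W.obj.obj j) := by
      intro j
      fin_cases j
      · exact Deg.of_mono T (X := Y) (Y := X) hX s
      · exact hX
    -- The sequence `Y ↣ X = ⋯ = X`. In `exact_zero` it makes the operation on the constant sequence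
    -- `X` an extension of that on the constant sequence `Z` by that on `Y, X, …, X`, and the latter
    -- reduces by folding to the constant sequence `Y`.
    let R : AdmSeq (k + 1) (M n) := (restrict (stepMap (k + 1))).obj W
    -- The values of `stepMap` are `0` and `1` only propositionally. The conflation is therefore
    -- stated for variable indices, with the identity written as the transition map to the last
    -- term.
    have hconf : ∀ (x y : Fin 2) (_ : x = 0) (_ : y = 1) (hxy : x ≤ y),
        IsConflation (W.obj.map (homOfLE hxy))
          (W.obj.map (homOfLE (Fin.le_last y)) ≫ (r' : W.obj.obj (Fin.last 1) ⟶ Z)) := by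
      rintro x y rfl rfl hxy
      have e : W.obj.map (homOfLE (Fin.le_last 1)) ≫ (r' : W.obj.obj (Fin.last 1) ⟶ Z) = r' :=
        (congr_arg (· ≫ _) (W.obj.map_id _)).trans (Category.id_comp _)
      rw [e]
      exact hc
    let Q : QuotientSeq (add_comm 1 k) R :=
      { seq := constSeq k Z
        π := ObjectProperty.homMk
          { app := fun j => W.obj.map (homOfLE (Fin.le_last _)) ≫
              (r' : W.obj.obj (Fin.last 1) ⟶ Z)
            naturality := fun _ _ f => by
              refine Eq.trans ?_ (Category.comp_id _).symm
              refine (Category.assoc _ _ _).symm.trans (congr_arg (· ≫ _) ?_)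
              exact (W.obj.map_comp (homOfLE ((stepMap (k + 1)).monotone
                ((tailMap (add_comm 1 k)).monotone (leOfHom f)))) _).symm }
        conf := fun a ha j haj => hconf _ _
          (if_pos (by omega)) (if_neg (by change ¬ 1 + j.1 = 0; omega))
          ((stepMap (k + 1)).monotone haj) }
    have key := hD.exact_zero hk h R Q
    have q₁ : T.q ((D.wedge hk h).obj ((restrict (skipMap 1 (by omega))).obj R)) I = 0 := by
      refine q_wedge_of_foldMap hD ih hk h (fun j => hW _) hI hd ?_
      change T.q ((D.wedge hk h).obj ((restrict (((stepMap (k + 1)).comp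
        (skipMap 1 (by omega))).comp (foldMap k k))).obj W)) I = 0
      rw [stepMap_comp_skipMap_one_comp_foldMap]
      exact T.q_eq_zero_of_mono ((D.wedge hk h).map (restrictConstIso 0 W).hom) qY
    have q₀ := T.q_eq_zero_of_isConflation key q₁ qZ
    have e : T.q ((D.wedge hk h).obj ((restrict (OrderHom.const (Fin k) 1)).obj W)) I = 0 := by
      rw [← stepMap_comp_skipMap_zero k (by omega)]
      exact q₀
    have e' : T.q ((D.wedge hk h).obj (constSeq k (W.obj.obj 1))) I = 0 :=
      T.q_eq_zero_of_epi ((D.wedge hk h).map (restrictConstIso 1 W).hom) e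
    exact e'

/-- Strong induction on the length: folding reduces to the constant sequence on the first term, and
there every index of `I` may be treated as unsplit. -/
theorem Deg.wedge [∀ n, IsIdempotentComplete (M n)] (hD : D.IsAssembly) {k n m d : ℕ}
    (hk : 1 ≤ k) (h : n * k = m) {V : AdmSeq k (M n)} (hV : ∀ j, T.Deg d (V.obj.obj j)) :
    T.Deg (k * d) ((D.wedge hk h).obj V) := by
  induction k using Nat.strong_induction_on generalizing n m d with
  | _ k ih =>
    have ih' : T.WedgeDeg k := fun hl h V hlk hV => ih _ hlk hl h hV
    intro I hI hd
    refine q_wedge_of_foldMap hD ih' hk h hV hI hd ?_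
    have e : foldMap k k = OrderHom.const (Fin k) ⟨0, hk⟩ := by
      ext i
      exact if_pos i.2
    rw [e]
    exact T.q_eq_zero_of_mono ((D.wedge hk h).map (restrictConstIso _ V).hom)
      (q_wedge_constSeq hD ih' hk h hI hd I (hV _) (fun _ hi hi' => absurd hi hi'))

end Operators

end WedgeDegree

end PowerOps
end

noncomputable section

namespace PowerOps

open AdmSeq Opposite Simplicial

/-! ### Multilinear scalings of `Γ` -/

/-- The category with one object and the endomorphisms `ℤ ^ (n + 1)` (under multiplication). -/
abbrev Scalings (n : ℕ) : Type := SingleObj (Fin (n + 1) → ℤ)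

/-- The idempotent which replaces the `i`-th coordinate by zero. -/
def killCoord {n : ℕ} (i : Fin (n + 1)) : Fin (n + 1) → ℤ := Function.update 1 i 0

theorem killCoord_mul_self {n : ℕ} (i : Fin (n + 1)) : killCoord i * killCoord i = killCoord i := by
  funext j
  by_cases h : j = i
  · subst h
    simp [killCoord]
  · simp [killCoord, h]

/-- The idempotent `killCoord i` as an endomorphism in the category `Scalings n`. -/
def killHom {n : ℕ} (i : Fin (n + 1)) (j : Scalings n) : j ⟶ j := killCoord i

/-! ### Coordinate idempotents acting on diagrams of scalings -/

section ScalingOperators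

variable {C : Type u} [Category.{v} C]

/-- The natural endomorphism given by the idempotent `killCoord i`. -/
def killEnd {n : ℕ} (i : Fin (n + 1)) : 𝟭 (Scalings n ⥤ C) ⟶ 𝟭 (Scalings n ⥤ C) where
  app X :=
    { app := fun j => X.map (killHom i j)
      naturality := fun j l f => by
        refine (X.map_comp f (killHom i l)).symm.trans (Eq.trans ?_ (X.map_comp (killHom i j) f))
        exact congr_arg X.map (mul_comm (killCoord i) (f : Fin (n + 1) → ℤ)) }
  naturality X Y f := by
    ext j
    exact (f.naturality _).symm

variable {M : ℕ → Type u} [∀ n, Category.{v} (M n)] [∀ n, Preadditive (M n)]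
  [∀ n, Conflations (M n)]

/-- The idempotents `killCoord i` as operators on levelwise power operations. -/
def scalingOperators (D : PowerFunctors M) (n : ℕ) :
    Operators (levelwiseFunctors (Scalings n) D) (Fin (n + 1)) where
  τ i _ := killEnd i
  idem i p X := by
    ext j
    exact (X.map_comp _ _).symm.trans (congr_arg X.map (killCoord_mul_self i))
  tensor i _ _ _ h X Y := by
    ext j
    exact (levelwise_tMap_app (Scalings n) D h ((killEnd i).app X) ((killEnd i).app Y) j).symm
  wedge i _ _ _ hk h V := by
    ext j
    rfl

/-- The factors commute by naturality, so any one of them can be moved to the front. -/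
theorem Operators.exists_q_eq {D : PowerFunctors M} {ι : Type} (T : Operators D ι) {n : ℕ}
    (X : M n) {I : List ι} {i : ι} (hi : i ∈ I) : ∃ g, T.q X I = (𝟙 X - T.act i X) ≫ g := by
  induction I with
  | nil => exact absurd hi List.not_mem_nil
  | cons j I ih =>
    rcases List.mem_cons.1 hi with rfl | hi
    · exact ⟨_, rfl⟩
    · obtain ⟨g, hg⟩ := ih hi
      refine ⟨(𝟙 X - T.act j X) ≫ g, ?_⟩
      dsimp only [q]
      rw [hg, ← Category.assoc, ← Category.assoc]
      congr 1
      rw [Preadditive.comp_sub, Preadditive.sub_comp _ _ (𝟙 X - T.act j X), T.act_natural,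
        Category.comp_id, Category.id_comp]

/-- If every `τ_i` with `i` in `I` is killed by `f`, each factor `1 - τ_i` acts on `f` as the
identity. -/
theorem scalingOperators_q_comp (D : PowerFunctors M) {n p : ℕ} (X : Scalings n ⥤ M p) {Z : M p}
    (f : X.obj (SingleObj.star _) ⟶ Z) (I : List (Fin (n + 1)))
    (hf : ∀ i ∈ I, X.map (killHom i (SingleObj.star _)) ≫ f = 0) :
    ((scalingOperators D n).q X I).app (SingleObj.star _) ≫ f = f := by
  induction I with
  | nil => exact Category.id_comp f
  | cons i I ih =>
    have h₁ := ih fun j hj => hf j (List.mem_cons_of_mem _ hj)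
    have h₂ := hf i List.mem_cons_self
    dsimp only [Operators.q]
    rw [NatTrans.comp_app, Category.assoc, h₁, NatTrans.app_sub, Preadditive.sub_comp]
    refine (congr_arg₂ (· - ·) (Category.id_comp f) h₂).trans (sub_zero f)

end ScalingOperators

/-! ### The action of scalings on the summands of `Γ` -/

section GammaScale

variable {C : Type u} [Category.{v} C] [Preadditive C] [Conflations C] [IsExactCategory C]
  [IsIdempotentComplete C] {n : ℕ}

/-- The summand `A` of `Γ` does not jump between `i` and `i + 1`. -/
def IsFlat (A : SimplicialObject.Splitting.IndexSet (op ⦋n + 1⦌)) (i : Fin (n + 1)) : Prop :=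
  A.e.toOrderHom i.castSucc = A.e.toOrderHom i.succ

open Classical in
/-- The weight of the scaling by `s` on the summand `A`. -/
def weight (A : SimplicialObject.Splitting.IndexSet (op ⦋n + 1⦌)) (s : Fin (n + 1) → ℤ) : ℤ :=
  ∏ i, if IsFlat A i then 1 else s i

theorem weight_one (A : SimplicialObject.Splitting.IndexSet (op ⦋n + 1⦌)) : weight A 1 = 1 := by
  simp [weight]

theorem weight_mul (A : SimplicialObject.Splitting.IndexSet (op ⦋n + 1⦌))
    (s t : Fin (n + 1) → ℤ) : weight A (s * t) = weight A s * weight A t := by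
  dsimp only [weight]
  rw [← Finset.prod_mul_distrib]
  refine Finset.prod_congr rfl fun i _ => ?_
  split_ifs <;> simp

theorem weight_killCoord_of_isFlat (A : SimplicialObject.Splitting.IndexSet (op ⦋n + 1⦌))
    {i : Fin (n + 1)} (h : IsFlat A i) : weight A (killCoord i) = 1 := by
  refine Finset.prod_eq_one fun j _ => ?_
  split_ifs with hj
  · rfl
  · have : j ≠ i := by
      rintro rfl
      exact hj h
    simp [killCoord, this]

theorem weight_killCoord_of_not_isFlat (A : SimplicialObject.Splitting.IndexSet (op ⦋n + 1⦌))
    {i : Fin (n + 1)} (h : ¬ IsFlat A i) : weight A (killCoord i) = 0 :=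
  Finset.prod_eq_zero (Finset.mem_univ i) (by simp [killCoord, h])

/-- The scaling of `(Γ K)_{n + 1}` by `s`. -/
def gammaScale (K : ChainComplex C ℕ) (s : Fin (n + 1) → ℤ) :
    ((doldKan C).functor.obj K).obj (op ⦋n + 1⦌) ⟶ ((doldKan C).functor.obj K).obj (op ⦋n + 1⦌) :=
  gammaDesc K fun A => weight A s • gammaι K A

theorem gammaι_scale (K : ChainComplex C ℕ) (s : Fin (n + 1) → ℤ)
    (A : SimplicialObject.Splitting.IndexSet (op ⦋n + 1⦌)) :
    gammaι K A ≫ gammaScale K s = weight A s • gammaι K A :=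
  gammaι_desc K _ A

theorem gammaScale_one (K : ChainComplex C ℕ) : gammaScale K (1 : Fin (n + 1) → ℤ) = 𝟙 _ := by
  refine gamma_hom_ext K fun A => ?_
  rw [gammaι_scale, weight_one, one_smul, Category.comp_id]

theorem gammaScale_mul (K : ChainComplex C ℕ) (s t : Fin (n + 1) → ℤ) :
    gammaScale K (s * t) = gammaScale K t ≫ gammaScale K s := by
  refine gamma_hom_ext K fun A => ?_
  rw [← Category.assoc, gammaι_scale, gammaι_scale, Preadditive.zsmul_comp, gammaι_scale,
    weight_mul, smul_smul, mul_comm]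

theorem gammaScale_naturality {K L : ChainComplex C ℕ} (f : K ⟶ L) (s : Fin (n + 1) → ℤ) :
    gammaScale K s ≫ ((doldKan C).functor.map f).app (op ⦋n + 1⦌) =
      ((doldKan C).functor.map f).app (op ⦋n + 1⦌) ≫ gammaScale L s := by
  refine gamma_hom_ext K fun A => ?_
  rw [← Category.assoc, ← Category.assoc, gammaι_scale, Preadditive.zsmul_comp, gammaι_naturality,
    Category.assoc, gammaι_scale, Preadditive.comp_zsmul]

theorem gammaι_map (K : ChainComplex C ℕ) {Δ : SimplexCategoryᵒᵖ}
    (A : SimplicialObject.Splitting.IndexSet Δ) (θ : Δ.unop ⟶ Δ.unop) (h : θ ≫ A.e = A.e) :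
    gammaι K A ≫ ((doldKan C).functor.obj K).map θ.op = gammaι K A := by
  have e : gammaι K A = (AlgebraicTopology.DoldKan.Γ₀.splitting K).ι A.1.unop.len ≫
      ((doldKan C).functor.obj K).map A.e.op := rfl
  rw [e]
  refine (Category.assoc _ _ _).trans (congr_arg (_ ≫ ·) ?_)
  refine (((doldKan C).functor.obj K).map_comp A.e.op θ.op).symm.trans ?_
  rw [← op_comp, h]

/-- A surjection that does not jump at `i` factors through `σ i`, and `δ i.succ` is a section of `σ
i`. -/
theorem σ_δ_comp_of_isFlat (A : SimplicialObject.Splitting.IndexSet (op ⦋n + 1⦌))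
    {i : Fin (n + 1)} (h : IsFlat A i) :
    (SimplexCategory.σ i ≫ SimplexCategory.δ i.succ) ≫ A.e = A.e := by
  obtain ⟨θ, hθ⟩ := SimplexCategory.eq_σ_comp_of_not_injective' A.e i h
  rw [hθ, Category.assoc, ← Category.assoc (SimplexCategory.δ i.succ),
    SimplexCategory.δ_comp_σ_succ, Category.id_comp]

/-- Killing the `i`-th coordinate factors through the `i`-th degeneracy. -/
theorem gammaScale_killCoord (K : ChainComplex C ℕ) (i : Fin (n + 1)) :
    (gammaScale K (killCoord i) ≫
      ((doldKan C).functor.obj K).map (SimplexCategory.δ i.succ).op) ≫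
        ((doldKan C).functor.obj K).map (SimplexCategory.σ i).op =
      gammaScale K (killCoord i) := by
  rw [Category.assoc, ← Functor.map_comp, ← op_comp]
  refine gamma_hom_ext K fun A => ?_
  rw [← Category.assoc, gammaι_scale]
  -- On flat summands the face followed by the degeneracy acts as the identity. The other summands
  -- have already been killed by the scaling.
  by_cases h : IsFlat A i
  · rw [Preadditive.zsmul_comp]
    exact congr_arg (_ • ·) (gammaι_map K A _ (σ_δ_comp_of_isFlat A h))
  · rw [weight_killCoord_of_not_isFlat A h, zero_smul, zero_comp]

variable (C n) in
/-- The functor sending `K` to `(Γ K)_{n + 1}` with all its scalings. -/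
def scaledGamma : ChainComplex C ℕ ⥤ (Scalings n ⥤ C) where
  obj K :=
    { obj := fun _ => ((doldKan C).functor.obj K).obj (op ⦋n + 1⦌)
      map := fun s => gammaScale K s
      map_id := fun _ => gammaScale_one K
      map_comp := fun s t => gammaScale_mul K t s }
  map f :=
    { app := fun _ => ((doldKan C).functor.map f).app (op ⦋n + 1⦌)
      naturality := fun _ _ s => gammaScale_naturality f s }
  map_id K := by
    ext
    exact congr_app ((doldKan C).functor.map_id K) _
  map_comp f g := by
    ext
    exact congr_app ((doldKan C).functor.map_comp f g) _

theorem scaledGamma_preserves : PreservesConflations (scaledGamma C n) := by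
  intro K L N f g h
  rw [isConflation_functor_iff]
  intro j
  exact (isConflation_functor_iff _ _).1 (doldKan_preserves C f g h) (op ⦋n + 1⦌)

/-- At distinct jumps `i` the values `A(i+1)` are distinct elements of `[p]`, which has `p + 1`
elements. The value `0` is never taken, so `p` would also be a bound, but the cruder one suffices
for boundedness. -/
theorem length_le_of_not_isFlat (A : SimplicialObject.Splitting.IndexSet (op ⦋n + 1⦌))
    {I : List (Fin (n + 1))} (hI : I.Nodup) (h : ∀ i ∈ I, ¬ IsFlat A i) :
    I.length ≤ A.1.unop.len + 1 := by
  have hlt : ∀ i ∈ I, A.e.toOrderHom i.castSucc < A.e.toOrderHom i.succ := fun i hi =>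
    lt_of_le_of_ne (A.e.toOrderHom.monotone i.castSucc_lt_succ.le) (h i hi)
  have hmono : ∀ i ∈ I, ∀ j ∈ I, i < j → A.e.toOrderHom i.succ < A.e.toOrderHom j.succ :=
    fun i _ j hj hij => lt_of_le_of_lt
      (A.e.toOrderHom.monotone (Fin.le_def.2 (by simpa using hij))) (hlt j hj)
  have hnd : (I.map fun i => A.e.toOrderHom i.succ).Nodup := by
    refine List.Nodup.map_on (fun i hi j hj hij => ?_) hI
    rcases lt_trichotomy i j with hlt | rfl | hlt
    · exact absurd hij (hmono i hi j hj hlt).ne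
    · rfl
    · exact absurd hij (hmono j hj i hi hlt).ne'
  simpa using hnd.length_le_card

end GammaScale

/-! ### Vanishing of the normalized complex in high degrees -/

section Boundedness

variable {M : ℕ → Type u} [∀ n, Category.{v} (M n)] [∀ n, Preadditive (M n)]
  [∀ n, Conflations (M n)] [∀ n, IsExactCategory (M n)] [∀ n, IsIdempotentComplete (M n)]

/-- On a summand that is flat at some `i ∈ I`, the factor `1 - τ_i` vanishes. A summand that jumps
at all of `I` is a copy of `K_p` with `p + 1 ≥ |I| > N + 1`, which is zero. -/
theorem deg_scaledGamma (D : PowerFunctors M) {n p N : ℕ} {K : ChainComplex (M p) ℕ}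
    (hK : ∀ i, N < i → IsZero (K.X i)) :
    (scalingOperators D n).Deg (N + 1) ((scaledGamma (M p) n).obj K) := by
  intro I hI hN
  ext j
  refine gamma_hom_ext K fun A => ?_
  by_cases hA : ∃ i ∈ I, IsFlat A i
  · obtain ⟨i, hi, hi'⟩ := hA
    obtain ⟨g, hg⟩ := (scalingOperators D n).exists_q_eq ((scaledGamma (M p) n).obj K) hi
    have e : gammaι K A ≫ (𝟙 _ - gammaScale K (killCoord i)) = 0 := by
      rw [Preadditive.comp_sub, gammaι_scale, weight_killCoord_of_isFlat A hi', one_smul,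
        Category.comp_id, sub_self]
    rw [hg]
    refine ((Category.assoc _ _ _).symm.trans (congr_arg (· ≫ g.app j) e)).trans ?_
    exact zero_comp.trans comp_zero.symm
  · have := length_le_of_not_isFlat A hI fun i hi h => hA ⟨i, hi, h⟩
    exact (hK _ (by omega)).eq_of_src _ _

/-- Let `f` kill all degeneracies. Each `τ_i` factors through `σ_i`, so `f` is unchanged by the
product of all `n + 1` factors `1 - τ_i`. That product is zero because `n + 1` exceeds the degree,
hence `f = 0`. The scaling diagram is linked to `Y` only through level `n + 1`, since scalings are
not simplicial maps. -/
theorem isZero_doldKan_inverse_of_scaling (D : PowerFunctors M) {n p d : ℕ}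
    {Y : SimplexCategoryᵒᵖ ⥤ M p} (X : Scalings n ⥤ M p)
    (e : X.obj (SingleObj.star _) = Y.obj (op ⦋n + 1⦌))
    (hX : (scalingOperators D n).Deg d X) (hd : d < n + 1)
    (h : ∀ i : Fin (n + 1), ∃ u,
      X.map (killHom i (SingleObj.star _)) ≫ eqToHom e =
        u ≫ Y.map (SimplexCategory.σ i).op) :
    IsZero (((doldKan (M p)).inverse.obj Y).X (n + 1)) := by
  refine isZero_doldKan_inverse fun {Z} f hf => ?_
  have hq := hX (List.finRange (n + 1)) (List.nodup_finRange _) (by simpa using hd)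
  have := scalingOperators_q_comp D X (eqToHom e ≫ f) (List.finRange (n + 1)) fun i _ => by
    obtain ⟨u, hu⟩ := h i
    rw [reassoc_of% hu, hf, comp_zero]
  rw [hq] at this
  rw [← cancel_epi (eqToHom e), ← this]
  exact zero_comp.trans comp_zero.symm

theorem doldPuppe_tensorClosed (D : PowerData M) (hD : D.IsAssembly) :
    TensorClosed (doldPuppe D hD).toPowerFunctors (fun n => bounded (M n)) := by
  rintro p q r h K L ⟨N, hN⟩ ⟨N', hN'⟩
  -- The sum of the degrees `N + 1` and `N' + 1` of the two factors.
  refine ⟨N + 1 + (N' + 1), fun i hi => ?_⟩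
  obtain ⟨n, rfl⟩ := Nat.exists_eq_succ_of_ne_zero (show i ≠ 0 by omega)
  refine isZero_doldKan_inverse_of_scaling D.toPowerFunctors
    (Y := levelwiseTensorObj SimplexCategoryᵒᵖ D.toPowerFunctors h ((doldKan (M p)).functor.obj K)
      ((doldKan (M q)).functor.obj L))
    (levelwiseTensorObj (Scalings n) D.toPowerFunctors h ((scaledGamma (M p) n).obj K)
      ((scaledGamma (M q) n).obj L)) rfl
    (Operators.Deg.tensor (D := levelwise (Scalings n) D hD) (levelwise_isAssembly _ D hD) h
      (deg_scaledGamma D.toPowerFunctors hN) (deg_scaledGamma D.toPowerFunctors hN')) hi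
    -- On both factors killing the coordinate `i` factors through `σ i`, so the same holds for the
    -- tensor product of the two idempotents.
    fun i => ⟨D.tMap h
      (gammaScale K (killCoord i) ≫
        ((doldKan (M p)).functor.obj K).map (SimplexCategory.δ i.succ).op)
      (gammaScale L (killCoord i) ≫
        ((doldKan (M q)).functor.obj L).map (SimplexCategory.δ i.succ).op), ?_⟩
  refine (Category.comp_id _).trans (Eq.trans ?_ (D.tMap_comp h _ _ _ _))
  exact congr_arg₂ (D.tMap h) (gammaScale_killCoord K i).symm (gammaScale_killCoord L i).symm

theorem doldPuppe_wedgeClosed (D : PowerData M) (hD : D.IsAssembly) :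
    WedgeClosed (doldPuppe D hD).toPowerFunctors (fun n => bounded (M n)) := by
  intro k p r hk h V
  choose N hN using fun j => (V.obj.obj j).property
  let N' := Finset.univ.sup N
  let W : AdmSeq k (ChainComplex (M p) ℕ) :=
    (mapSeq k (bounded (M p)).ι (ι_preserves (bounded (M p)))).obj V
  have hW : ∀ j i, N' < i → IsZero ((W.obj.obj j).X i) := fun j i hi =>
    hN j i (lt_of_le_of_lt (Finset.le_sup (Finset.mem_univ j)) hi)
  -- All terms of the sequence have degree at most `N' + 1`, with `N'` a common bound for the
  -- complexes, and the power operation multiplies this by `k`.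
  refine ⟨k * (N' + 1), fun i hi => ?_⟩
  obtain ⟨n, rfl⟩ := Nat.exists_eq_succ_of_ne_zero (show i ≠ 0 by omega)
  refine isZero_doldKan_inverse_of_scaling D.toPowerFunctors
    (Y := levelwiseWedgeObj SimplexCategoryᵒᵖ D.toPowerFunctors hk h
      ((mapSeq k (doldKan (M p)).functor (doldKan_preserves (M p))).obj W))
    (levelwiseWedgeObj (Scalings n) D.toPowerFunctors hk h
      ((mapSeq k (scaledGamma (M p) n) scaledGamma_preserves).obj W)) rfl
    (Operators.Deg.wedge (D := levelwise (Scalings n) D hD) (levelwise_isAssembly _ D hD) hk h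
      fun j => deg_scaledGamma D.toPowerFunctors (hW j)) hi
    -- The factorization through `σ i` has to be a morphism of sequences before the power operation
    -- can be applied. This holds because scalings and faces are natural in the complex.
    fun i => ⟨(D.wedge hk h).map (ObjectProperty.homMk
      { app := fun j => gammaScale (W.obj.obj j) (killCoord i) ≫
          ((doldKan (M p)).functor.obj (W.obj.obj j)).map (SimplexCategory.δ i.succ).op
        naturality := fun j l f => ?_ }), ?_⟩
  · refine Eq.trans ?_ (Category.assoc _ _ _).symm
    refine Eq.trans ?_ (congr_arg (_ ≫ ·)
      (((doldKan (M p)).functor.map (W.obj.map f)).naturality (SimplexCategory.δ i.succ).op).symm)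
    refine (Category.assoc _ _ _).symm.trans (Eq.trans ?_ (Category.assoc _ _ _))
    exact congr_arg (· ≫ _) (gammaScale_naturality (W.obj.map f) _).symm
  · refine (Category.comp_id _).trans (Eq.trans ?_ ((D.wedge hk h).map_comp _ _))
    refine congr_arg (D.wedge hk h).map ?_
    apply ObjectProperty.hom_ext
    ext j
    exact (gammaScale_killCoord (W.obj.obj j) i).symm

end Boundedness

end PowerOps
end

theorem mainTheorem7 {M : ℕ → Type u} [∀ n, Category.{v} (M n)] [∀ n, Preadditive (M n)]
    [∀ n, PowerOps.Conflations (M n)] [∀ n, PowerOps.IsExactCategory (M n)]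
    [∀ n, IsIdempotentComplete (M n)] (D : PowerOps.PowerData M) (hD : D.IsAssembly) :
    ((∀ n, PowerOps.IsExactCategory (ChainComplex (M n) ℕ)) ∧
      (PowerOps.doldPuppe D hD).IsAssembly) ∧
    ((∀ n, PowerOps.IsExactCategory (PowerOps.bounded (M n)).FullSubcategory) ∧
      ∃ (ht : PowerOps.TensorClosed (PowerOps.doldPuppe D hD).toPowerFunctors
          (fun n => PowerOps.bounded (M n)))
        (hw : PowerOps.WedgeClosed (PowerOps.doldPuppe D hD).toPowerFunctors
          (fun n => PowerOps.bounded (M n))),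
        (PowerOps.restrictData (PowerOps.doldPuppe D hD)
          (fun n => PowerOps.bounded (M n)) ht hw).IsAssembly) :=
  ⟨⟨fun _ => inferInstance, PowerOps.doldPuppe_isAssembly D hD⟩,
    fun _ => PowerOps.isExactCategory_bounded, PowerOps.doldPuppe_tensorClosed D hD,
    PowerOps.doldPuppe_wedgeClosed D hD,
    PowerOps.restrictData_isAssembly _ (PowerOps.doldPuppe_isAssembly D hD) _ _ _⟩
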